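/- **Proposition 2.4 (Carleman solvability).** Let $n\ge 3$, let $\Omega\subset\mathbf R^n$ be a bounded open set and let $\tilde\Omega\subset\mathbf R^n$ be an open set with $\overline\Omega\subset\tilde\Omega$. Write $D_j=-i\partial_{x_j}$. Let $\varphi$ be a limiting Carleman weight on $\tilde\Omega$: a real-valued $C^\infty$ function on $\tilde\Omega$ with nowhere vanishing gradient such that the symbol $p_\varphi(x,\xi)=|\xi|^2-|\nabla\varphi(x)|^2+2i\,\nabla\varphi(x)\cdot\xi$ satisfies $\{\operatorname{Re}p_\varphi,\operatorname{Im}p_\varphi\}(x,\xi)=0$ at every $(x,\xi)\in\tilde\Omega\times\mathbf R^n$ with $p_\varphi(x,\xi)=0$, where $\{a,b\}=\nabla_\xi a\cdot\nabla_x b-\nabla_x a\cdot\nabla_\xi b$ is the Poisson bracket. Let $A=(A_1,\dots,A_n)$ be a real $C^1$ vector field on $\overline\Omega$ (that is, $A$ is $C^1$ in $\Omega$, and $A$ and its first derivatives extend continuously to $\overline\Omega$), let $q\in L^\infty(\Omega;\mathbf C)$, and let $$\mathcal L_{A,q}=\sum_{j=1}^n (D_j+A_j)^2+q .$$ Then there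 exist constants $h_0>0$ and $C>0$, depending only on $n,\Omega,\tilde\Omega,\varphi,A,q$, such that for all $0<h\le h_0$ and all $w\in L^2(\Omega;\mathbf C)$ there exists $u\in H^1(\Omega;\mathbf C)$ with $$h^2\mathcal L_{A,q}\big(e^{\varphi/h}u\big)=e^{\varphi/h}w \quad\text{in } \Omega \text{ in the sense of distributions, and}\quad h\,\|u\|_{H^1_{\rm scl}(\Omega)}\le C\,\|w\|_{L^2(\Omega)},$$ where $\|u\|_{H^1_{\rm scl}(\Omega)}^2=\|h\nabla u\|_{L^2(\Omega)}^2+\|u\|_{L^2(\Omega)}^2$. -/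

import Mathlib

open MeasureTheory
open scoped ContDiff Gradient

noncomputable section

namespace MagneticSchrodinger

/-- The Euclidean space `ℝⁿ`. -/
abbrev Space (n : ℕ) : Type := EuclideanSpace ℝ (Fin n)

/-! ### Limiting Carleman weights -/

/-- The symbol `p_φ(x, ξ) = ξ² - (∇φ)² + 2i ∇φ·ξ`. -/
def carlemanSymbol {n : ℕ} (φ : Space n → ℝ) (x ξ : Space n) : ℂ :=
  ((‖ξ‖ ^ 2 - ‖∇ φ x‖ ^ 2 : ℝ) : ℂ) + 2 * Complex.I * ((inner ℝ (∇ φ x) ξ : ℝ) : ℂ)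

/-- The Poisson bracket `{a, b} = ∇_ξ a · ∇_x b - ∇_x a · ∇_ξ b` of two real symbols on
`T*ℝⁿ = ℝⁿ × ℝⁿ`, at the point `(x, ξ)`. -/
def poissonBracket {n : ℕ} (a b : Space n → Space n → ℝ) (x ξ : Space n) : ℝ :=
  inner ℝ (∇ (fun η => a x η) ξ) (∇ (fun y => b y ξ) x)
    - inner ℝ (∇ (fun y => a y ξ) x) (∇ (fun η => b x η) ξ)

/-- `φ` is a limiting Carleman weight on the open set `U`: it is real and smooth on `U`, its gradient
does not vanish on `U`, and `{Re p_φ, Im p_φ} = 0` at all `(x, ξ) ∈ T*U` with `p_φ(x, ξ) = 0`. -/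
structure IsLimitingCarlemanWeight {n : ℕ} (U : Set (Space n)) (φ : Space n → ℝ) : Prop where
  smooth : ContDiffOn ℝ ∞ φ U
  gradient_ne_zero : ∀ x ∈ U, ∇ φ x ≠ 0
  bracket_eq_zero : ∀ x ∈ U, ∀ ξ : Space n, carlemanSymbol φ x ξ = 0 →
    poissonBracket (fun y η => (carlemanSymbol φ y η).re)
      (fun y η => (carlemanSymbol φ y η).im) x ξ = 0

/-! ### The magnetic Schrödinger operator -/

/-- `A` is a real `C¹` vector field on the closure of the open set `Ω`: it is `C¹` in `Ω`, and `A` and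
its first derivatives extend continuously to the closure of `Ω`. -/
structure IsC1OnClosure {n : ℕ} (Ω : Set (Space n)) (A : Space n → Space n) : Prop where
  contDiffOn : ContDiffOn ℝ 1 A Ω
  extends_continuously : ∃ A₀ : Space n → Space n,
    ContinuousOn A₀ (closure Ω) ∧ Set.EqOn A₀ A Ω
  fderiv_extends_continuously : ∃ A₁ : Space n → (Space n →L[ℝ] Space n),
    ContinuousOn A₁ (closure Ω) ∧ Set.EqOn A₁ (fderiv ℝ A) Ω

/-- The partial derivative `∂_j v` of a complex-valued function. -/
def partialDeriv {n : ℕ} (j : Fin n) (v : Space n → ℂ) (x : Space n) : ℂ :=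
  fderiv ℝ v x (EuclideanSpace.single j (1 : ℝ))

/-- The first-order operator `D_j + A_j`, where `D_j = -i ∂_j`. -/
def magneticD {n : ℕ} (A : Space n → Space n) (j : Fin n) (v : Space n → ℂ) (x : Space n) : ℂ :=
  -Complex.I * partialDeriv j v x + ((A x j : ℝ) : ℂ) * v x

/-- The operator `L_{A,q} = ∑_j (D_j + A_j)² + q`, acting on twice differentiable functions. -/
def magneticSchrodinger {n : ℕ} (A : Space n → Space n) (q : Space n → ℂ) (v : Space n → ℂ)
    (x : Space n) : ℂ :=
  (∑ j : Fin n, magneticD A j (magneticD A j v) x) + q x * v x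

/-- Test functions: `v ∈ C_c^∞(Ω; ℂ)`. -/
structure IsTestFunction {n : ℕ} (Ω : Set (Space n)) (v : Space n → ℂ) : Prop where
  smooth : ContDiff ℝ ∞ v
  hasCompactSupport : HasCompactSupport v
  tsupport_subset : tsupport v ⊆ Ω

/-- `c · L_{A,q} U = F` in `Ω` in the sense of distributions. Since the (real, bilinear) transpose of
`D_j + A_j` is `-D_j + A_j = -(D_j - A_j)`, the transpose of `L_{A,q}` is `L_{-A,q}`, and the
distribution `L_{A,q} U` is `v ↦ ∫_Ω U · L_{-A,q} v`. -/
def SolvesWeakly {n : ℕ} (Ω : Set (Space n)) (A : Space n → Space n) (q : Space n → ℂ) (c : ℂ)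
    (U F : Space n → ℂ) : Prop :=
  ∀ v : Space n → ℂ, IsTestFunction Ω v →
    c * ∫ x in Ω, U x * magneticSchrodinger (-A) q v x = ∫ x in Ω, F x * v x

/-! ### Function spaces and norms -/

/-- `f ∈ L²(Ω; ℂ)`. -/
abbrev MemL2 {n : ℕ} (Ω : Set (Space n)) (f : Space n → ℂ) : Prop :=
  MemLp f 2 (volume.restrict Ω)

/-- The norm of `L²(Ω)`. -/
def normL2 {n : ℕ} (Ω : Set (Space n)) (f : Space n → ℂ) : ℝ :=
  Real.sqrt (∫ x in Ω, ‖f x‖ ^ 2)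

/-- `u` belongs to the Sobolev space `H¹(Ω)`, and `g = (g_1, …, g_n)` is its weak gradient (which is
unique up to equality almost everywhere in `Ω`). -/
structure IsH1WithGradient {n : ℕ} (Ω : Set (Space n)) (u : Space n → ℂ)
    (g : Fin n → Space n → ℂ) : Prop where
  memL2 : MemL2 Ω u
  gradient_memL2 : ∀ j, MemL2 Ω (g j)
  weak_gradient : ∀ j, ∀ v : Space n → ℂ, IsTestFunction Ω v →
    ∫ x in Ω, u x * partialDeriv j v x = -∫ x in Ω, g j x * v x

/-- The semiclassical norm `‖u‖_{H¹_scl(Ω)} = (‖h ∇u‖² + ‖u‖²)^{1/2}` of a function `u ∈ H¹(Ω)` with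
weak gradient `g`. -/
def normH1scl {n : ℕ} (Ω : Set (Space n)) (h : ℝ) (u : Space n → ℂ) (g : Fin n → Space n → ℂ) : ℝ :=
  Real.sqrt ((∑ j : Fin n, normL2 Ω (fun x => (h : ℂ) * g j x) ^ 2) + normL2 Ω u ^ 2)

end MagneticSchrodinger

end

/-! Solvability with an H¹ bound is dual to an a priori estimate for the transposed operator in a
negative-order norm. Substituting v = e^{-ψ/h} y in the weak formulation turns h² L_{-A,q} into T =
e^{ψ/h}(-h²Δ)e^{-ψ/h} plus h times a first-order semiclassical operator with bounded coefficients
(`sq_mul_magneticSchrodinger_weight_mul`).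

Carleman estimate. Write T = S + K with S = -h²Δ - |∇ψ|² symmetric and K = 2h∇ψ·∇ + hΔψ
antisymmetric. Then ‖Tv‖² = ‖Sv‖² + ‖Kv‖² + a commutator term, which `conjLap_sq` writes out
pointwise modulo divergences; its main part is 4h times the Hessian of ψ on h∇v plus 4h v² times the
Hessian on ∇ψ. For a limiting weight φ the bracket condition says that, with r = |∇φ|⁻², φ''(ξ,ξ) =
-r φ''(∇φ,∇φ)|ξ|² + 2r(∇φ·ξ)φ''(∇φ,ξ) (`quadratic_form_structure`). The first term is traded through
S for a multiple of v² that cancels the other Hessian term, and the second contains ∇φ·h∇v, which K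
controls. So φ alone gives no negative term of order h, and no gain either. The gain comes from
convexification, ψ = φ + (h/ε)φ²/2, whose Hessian has the extra part (h/ε)∇φ⊗∇φ. The result is ‖Tv‖²
≥ c(h²/ε)(‖v‖² + ‖h∇v‖²) (`carleman_real`, `carleman_complex`). Taking ε small absorbs the
first-order perturbation (`carleman_perturbed`), while e^{ψ/h} and e^{φ/h} differ only by the factor
e^{φ²/(2ε)}, which is bounded independently of h.

Negative norm. The estimate needed is h‖y‖ ≤ C(‖Ty + h div v‖ + ‖v‖) for all vector test fields v,
which bounds y by the H⁻¹ norm of Ty. For each component, solve (1 - h²Δ)g = h∂_j v_j by Fourier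
transform and cut off: z_j = χg is O(‖v_j‖) in semiclassical H¹, and Tz_j - h∂_j v_j is O(‖v_j‖) in
L², because T - (1 - h²Δ) has order one (`exists_parametrix`). The Carleman estimate applied to y +
Σ z_j then gives the claim (`carleman_negative`).

Duality. The functional (y, v) ↦ ∫ w y is bounded by the norm of (Ty + h div v, v) in (L²)^{n+1}.
Hahn-Banach and Riesz represent it by a vector whose first component solves the transposed equation
and whose remaining components are h times the weak gradient of the first (`exists_weak_solution`).
-/

noncomputable section

namespace MagneticSchrodinger

/-! ### Calculus in the algebra of smooth functions -/

section

/-- The algebra of smooth functions on `ℝⁿ` with values in `𝕜`. -/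
def smoothAlgebra (n : ℕ) (𝕜 : Type*) [RCLike 𝕜] : Subalgebra 𝕜 (Space n → 𝕜) where
  carrier := {f | ContDiff ℝ ∞ f}
  mul_mem' {f g} hf hg := by
    have hf : ContDiff ℝ ∞ f := hf
    exact hf.mul hg
  add_mem' {f g} hf hg := by
    have hf : ContDiff ℝ ∞ f := hf
    exact hf.add hg
  algebraMap_mem' c := (contDiff_const : ContDiff ℝ ∞ fun _ : Space n => algebraMap 𝕜 𝕜 c)

/-- Smooth functions on `ℝⁿ`. -/
abbrev Smooth (n : ℕ) (𝕜 : Type*) [RCLike 𝕜] : Type _ := smoothAlgebra n 𝕜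

namespace Smooth

variable {n : ℕ} {𝕜 : Type*} [RCLike 𝕜]

instance : CoeFun (Smooth n 𝕜) (fun _ => Space n → 𝕜) := ⟨fun f => f.1⟩

@[ext] lemma ext {f g : Smooth n 𝕜} (h : ∀ x, f x = g x) : f = g := Subtype.ext (funext h)

@[simp] lemma add_apply (f g : Smooth n 𝕜) (x : Space n) : (f + g) x = f x + g x := rfl
@[simp] lemma sub_apply (f g : Smooth n 𝕜) (x : Space n) : (f - g) x = f x - g x := rfl
@[simp] lemma neg_apply (f : Smooth n 𝕜) (x : Space n) : (-f) x = -f x := rfl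
@[simp] lemma mul_apply (f g : Smooth n 𝕜) (x : Space n) : (f * g) x = f x * g x := rfl
@[simp] lemma pow_apply (f : Smooth n 𝕜) (k : ℕ) (x : Space n) : (f ^ k) x = f x ^ k := rfl
@[simp] lemma smul_apply (c : 𝕜) (f : Smooth n 𝕜) (x : Space n) : (c • f) x = c * f x := rfl
@[simp] lemma zero_apply (x : Space n) : (0 : Smooth n 𝕜) x = 0 := rfl
@[simp] lemma one_apply (x : Space n) : (1 : Smooth n 𝕜) x = 1 := rfl
@[simp] lemma sum_apply {ι : Type*} (s : Finset ι) (f : ι → Smooth n 𝕜) (x : Space n) :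
    (∑ i ∈ s, f i) x = ∑ i ∈ s, f i x := by
  simp

/-- Constants, as smooth functions. -/
def const (c : 𝕜) : Smooth n 𝕜 := algebraMap 𝕜 _ c

@[simp] lemma const_apply (c : 𝕜) (x : Space n) : (const c : Smooth n 𝕜) x = c := rfl

lemma contDiff (f : Smooth n 𝕜) : ContDiff ℝ ∞ f := f.2
lemma differentiable (f : Smooth n 𝕜) : Differentiable ℝ f := f.contDiff.differentiable (by simp)
lemma continuous (f : Smooth n 𝕜) : Continuous f := f.contDiff.continuous

lemma contDiff_deriv (e : Space n) {f : Space n → 𝕜} (hf : ContDiff ℝ ∞ f) :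
    ContDiff ℝ ∞ (fun x => fderiv ℝ f x e) :=
  (hf.fderiv_right (m := ∞) (by simp)).clm_apply contDiff_const

/-- The partial derivative `∂_j` on smooth functions. -/
def d (j : Fin n) : Smooth n 𝕜 →ₗ[𝕜] Smooth n 𝕜 where
  toFun f := ⟨fun x => fderiv ℝ f x (EuclideanSpace.single j (1 : ℝ)), contDiff_deriv _ f.contDiff⟩
  map_add' f g := by
    ext x
    have := fderiv_add (f.differentiable x) (g.differentiable x)
    simp only [add_apply]
    change fderiv ℝ (f.1 + g.1) x _ = _
    rw [this]; rfl
  map_smul' c f := by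
    ext x
    have := fderiv_const_smul (f.differentiable x) c
    simp only [RingHom.id_apply, smul_apply]
    change fderiv ℝ (c • f.1) x _ = _
    rw [this]; rfl

lemma d_apply (j : Fin n) (f : Smooth n 𝕜) (x : Space n) :
    d j f x = fderiv ℝ f x (EuclideanSpace.single j (1 : ℝ)) := rfl

lemma d_mul (j : Fin n) (f g : Smooth n 𝕜) : d j (f * g) = f * d j g + g * d j f := by
  ext x
  have := fderiv_mul (f.differentiable x) (g.differentiable x)
  simp only [add_apply, mul_apply, d_apply]
  change fderiv ℝ (f.1 * g.1) x _ = _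
  rw [this]; rfl

@[simp] lemma d_one (j : Fin n) : d j (1 : Smooth n 𝕜) = 0 := by
  have := d_mul (𝕜 := 𝕜) j 1 1
  simpa using this

@[simp] lemma d_const (j : Fin n) (c : 𝕜) : d j (const c : Smooth n 𝕜) = 0 := by
  have : (const c : Smooth n 𝕜) = c • 1 := by ext x; simp
  rw [this, map_smul, d_one, smul_zero]

lemma d_comm (j k : Fin n) (f : Smooth n 𝕜) : d j (d k f) = d k (d j f) := by
  ext x
  have h2 : ContDiff ℝ 2 f := contDiff_infty.1 f.contDiff 2
  have hs : IsSymmSndFDerivAt ℝ f x := h2.contDiffAt.isSymmSndFDerivAt (by simp)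
  have hd : DifferentiableAt ℝ (fderiv ℝ f.1) x :=
    ((h2.fderiv_right (m := 1) (by norm_num)).differentiable (by simp)) x
  have key : ∀ a b : Space n, fderiv ℝ (fun y => fderiv ℝ f.1 y a) x b
      = fderiv ℝ (fderiv ℝ f.1) x b a := by
    intro a b
    rw [fderiv_clm_apply hd (differentiableAt_const a)]
    simp
  simp only [d_apply]
  change fderiv ℝ (fun y => fderiv ℝ f.1 y _) x _ = fderiv ℝ (fun y => fderiv ℝ f.1 y _) x _
  rw [key, key]
  exact hs _ _

lemma d_eq_zero_of_notMem (j : Fin n) (f : Smooth n 𝕜) {x : Space n} (hx : x ∉ tsupport f) :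
    d j f x = 0 := by
  have h : f.1 =ᶠ[nhds x] 0 := notMem_tsupport_iff_eventuallyEq.1 hx
  rw [d_apply, h.fderiv_eq]; simp

lemma tsupport_d_subset (j : Fin n) (f : Smooth n 𝕜) : tsupport (d j f) ⊆ tsupport f := by
  apply closure_minimal _ (isClosed_tsupport _)
  intro x hx
  by_contra h
  exact hx (d_eq_zero_of_notMem j f h)

lemma hasCompactSupport_d (j : Fin n) {f : Smooth n 𝕜} (hf : HasCompactSupport f) :
    HasCompactSupport (d j f) :=
  hf.mono' ((subset_tsupport _).trans (tsupport_d_subset j f))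

lemma integrable {f : Smooth n 𝕜} (hf : HasCompactSupport f) : Integrable f :=
  f.continuous.integrable_of_hasCompactSupport hf

lemma integral_d (j : Fin n) {f : Smooth n 𝕜} (hf : HasCompactSupport f) :
    ∫ x, d j f x = 0 := by
  have := integral_mul_fderiv_eq_neg_fderiv_mul_of_integrable (𝕜 := 𝕜) (μ := volume)
    (f := fun _ : Space n => (1 : 𝕜)) (g := f.1) (v := EuclideanSpace.single j (1 : ℝ))
    (by simp) (by simp only [one_mul]; exact integrable (hasCompactSupport_d j hf))
    (by simpa using integrable hf) (fun x _ => by fun_prop) (fun x _ => f.differentiable x)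
  simpa [d_apply] using this

lemma d_eq_zero_of_tsupport_subset (j : Fin n) {f : Smooth n 𝕜} {U : Set (Space n)}
    (hf : tsupport f ⊆ U) {x : Space n} (hx : x ∉ U) : d j f x = 0 :=
  d_eq_zero_of_notMem j f (fun h => hx (hf h))

lemma eq_zero_of_tsupport_subset {f : Smooth n 𝕜} {U : Set (Space n)}
    (hf : tsupport f ⊆ U) {x : Space n} (hx : x ∉ U) : f x = 0 :=
  image_eq_zero_of_notMem_tsupport (fun h => hx (hf h))

lemma exists_bound (f : Smooth n 𝕜) {U : Set (Space n)} (hU : IsCompact (closure U)) :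
    ∃ M : ℝ, ∀ x ∈ U, ‖f x‖ ≤ M := by
  obtain ⟨M, hM⟩ := hU.exists_bound_of_continuousOn f.continuous.continuousOn
  exact ⟨M, fun x hx => hM x (subset_closure hx)⟩

lemma exists_bound_family {ι : Type*} [Finite ι] (f : ι → Smooth n 𝕜) {U : Set (Space n)}
    (hU : IsCompact (closure U)) : ∃ M : ℝ, ∀ i, ∀ x ∈ U, ‖f i x‖ ≤ M := by
  cases nonempty_fintype ι
  choose M hM using fun i => (f i).exists_bound hU
  refine ⟨∑ i, |M i|, fun i x hx => ((hM i x hx).trans (le_abs_self _)).trans ?_⟩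
  exact Finset.single_le_sum (f := fun i => |M i|) (fun _ _ => abs_nonneg _) (Finset.mem_univ i)

/-- The Laplacian. -/
def lap (f : Smooth n 𝕜) : Smooth n 𝕜 := ∑ j, d j (d j f)

/-- The bilinear pairing `∇f · ∇g` of gradients. -/
def gradMul (f g : Smooth n 𝕜) : Smooth n 𝕜 := ∑ j, d j f * d j g

/-- The conjugated operator `v ↦ e^{ψ/h} (-h² Δ) (e^{-ψ/h} v)`. -/
def conjLap (h : 𝕜) (ψ v : Smooth n 𝕜) : Smooth n 𝕜 :=
  -(const (h ^ 2) * lap v) - gradMul ψ ψ * v + const (2 * h) * gradMul ψ v + const h * lap ψ * v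

end Smooth

end

/-! ### The square of the conjugated Laplacian modulo divergences -/

section

namespace Smooth

variable {n : ℕ}

/-- The density of `‖T v‖²`, up to divergences, where `T` is the conjugated Laplacian. -/
def carlemanDensity (h : ℝ) (ψ v : Smooth n ℝ) : Smooth n ℝ :=
  (-(const (h ^ 2) * lap v) - gradMul ψ ψ * v) ^ 2
    + (const (2 * h) * gradMul ψ v + const h * lap ψ * v) ^ 2
    + ∑ j, ∑ k, (const (4 * h ^ 3) * d j (d k ψ) * d j v * d k v
      + const (4 * h) * d j ψ * d j (d k ψ) * d k ψ * v ^ 2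
      + const (2 * h ^ 3) * v * d j v * d j (d k (d k ψ)))

/-- The cross term 2(Sv)(Kv) integrates to the commutator form of S and K. Keeping every divergence
explicit replaces the integrations by parts by a pointwise algebraic identity. -/
lemma conjLap_sq (h : ℝ) (ψ v : Smooth n ℝ) :
    conjLap h ψ v ^ 2 = carlemanDensity h ψ v
      + ∑ j, ∑ k, (d j (const (-4 * h ^ 3) * d k ψ * d k v * d j v
            + const (-2 * h ^ 3) * d k (d k ψ) * v * d j v)
        + d k (const (2 * h ^ 3) * d j v ^ 2 * d k ψ
            - const (2 * h) * d j ψ ^ 2 * d k ψ * v ^ 2)) := by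
  have hS : -(const (h ^ 2) * lap v) - gradMul ψ ψ * v
      = ∑ j, (-(const (h ^ 2) * d j (d j v)) - d j ψ * d j ψ * v) := by
    rw [Finset.sum_sub_distrib, Finset.sum_neg_distrib, ← Finset.mul_sum, ← Finset.sum_mul]
    rfl
  have hK : const (2 * h) * gradMul ψ v + const h * lap ψ * v
      = ∑ k, (const (2 * h) * (d k ψ * d k v) + const h * d k (d k ψ) * v) := by
    rw [Finset.sum_add_distrib, ← Finset.mul_sum, ← Finset.sum_mul, ← Finset.mul_sum]
    rfl
  have h2 : 2 * (∑ j, (-(const (h ^ 2) * d j (d j v)) - d j ψ * d j ψ * v))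
      * (∑ k, (const (2 * h) * (d k ψ * d k v) + const h * d k (d k ψ) * v))
      = ∑ j, ∑ k, 2 * ((-(const (h ^ 2) * d j (d j v)) - d j ψ * d j ψ * v)
        * (const (2 * h) * (d k ψ * d k v) + const h * d k (d k ψ) * v)) := by
    rw [mul_assoc, Finset.sum_mul_sum, Finset.mul_sum]
    simp_rw [Finset.mul_sum]
  have : conjLap h ψ v ^ 2 = (-(const (h ^ 2) * lap v) - gradMul ψ ψ * v) ^ 2
    + (const (2 * h) * gradMul ψ v + const h * lap ψ * v) ^ 2
    + 2 * (-(const (h ^ 2) * lap v) - gradMul ψ ψ * v) *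
      (const (2 * h) * gradMul ψ v + const h * lap ψ * v) := by
    rw [conjLap]; ring
  rw [this, carlemanDensity, add_assoc _ _ (∑ j, ∑ k, (d j _ + d k _)), ← Finset.sum_add_distrib]
  congr 1
  rw [hS, hK, h2]
  -- The identity holds for each pair (j, k) separately, j indexing the terms of S and k those of K;
  -- no symmetrisation in (j, k) is needed.
  refine Finset.sum_congr rfl fun j _ => ?_
  rw [← Finset.sum_add_distrib]
  refine Finset.sum_congr rfl fun k _ => ?_
  simp only [map_add, map_sub, d_mul, pow_two, d_const, d_comm k j v, d_comm k j ψ]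
  ext x
  have two : (2 : Smooth n ℝ) x = 2 := rfl
  simp only [add_apply, sub_apply, mul_apply, neg_apply, const_apply, zero_apply, two]
  ring

lemma integral_sum_d {ι : Type*} (s : Finset ι) (j : ι → Fin n) (W : ι → Smooth n ℝ)
    (hW : ∀ i ∈ s, HasCompactSupport (W i)) : ∫ x, (∑ i ∈ s, d (j i) (W i)) x = 0 := by
  simp only [sum_apply]
  rw [integral_finsetSum _ fun i hi => integrable (hasCompactSupport_d _ (hW i hi))]
  exact Finset.sum_eq_zero fun i hi => integral_d _ (hW i hi)

lemma hasCompactSupport_mul_left (f : Smooth n ℝ) {g : Smooth n ℝ} (hg : HasCompactSupport g) :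
    HasCompactSupport (f * g : Smooth n ℝ) :=
  HasCompactSupport.mul_left (f := f.1) (f' := g.1) hg

lemma hasCompactSupport_add {f g : Smooth n ℝ} (hf : HasCompactSupport f)
    (hg : HasCompactSupport g) : HasCompactSupport (f + g : Smooth n ℝ) :=
  HasCompactSupport.add (f := f.1) (f' := g.1) hf hg

lemma hasCompactSupport_sub {f g : Smooth n ℝ} (hf : HasCompactSupport f)
    (hg : HasCompactSupport g) : HasCompactSupport (f - g : Smooth n ℝ) :=
  HasCompactSupport.sub (f := f.1) (f' := g.1) hf hg

lemma hasCompactSupport_sq {f : Smooth n ℝ} (hf : HasCompactSupport f) :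
    HasCompactSupport (f ^ 2 : Smooth n ℝ) := by
  rw [pow_two]; exact hasCompactSupport_mul_left _ hf

/-- The divergence of `h² β v ∇v`. -/
def energyDiv (h : ℝ) (β v : Smooth n ℝ) : Smooth n ℝ :=
  ∑ j, d j (const (h ^ 2) * β * v * d j v)

lemma integral_eq_integral_sub_add {F₁ F₂ F₃ F₄ : Space n → ℝ} (c : ℝ) (i₁ : Integrable F₁)
    (i₂ : Integrable F₂) (i₃ : Integrable F₃) (i₄ : Integrable F₄) (z₂ : ∫ x, F₂ x = 0)
    (z₃ : ∫ x, F₃ x = 0) (z₄ : ∫ x, F₄ x = 0) :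
    ∫ x, F₁ x = ∫ x, (F₁ x - F₂ x - c * F₃ x + F₄ x) := by
  rw [integral_add (f := fun x => F₁ x - F₂ x - c * F₃ x) ((i₁.sub i₂).sub (i₃.const_mul c)) i₄,
    integral_sub (f := fun x => F₁ x - F₂ x) (i₁.sub i₂) (i₃.const_mul c), integral_sub i₁ i₂,
    integral_const_mul, z₂, z₃, z₄]
  ring

/-- Divergences of compactly supported fields integrate to zero, so those of `conjLap_sq` can be
dropped and h² div(βv∇v) added for any β. That divergence is β|h∇v|² + βv·h²Δv plus a term with ∇β;
since h²Δv = -Sv - |∇ψ|²v, it trades |h∇v|² for |∇ψ|²v² + vSv. The multipliers α and μ stay free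
until `carleman_real`. -/
lemma integral_conjLap_sq (h : ℝ) (ψ α μ v : Smooth n ℝ) (hv : HasCompactSupport v) :
    ∫ x, conjLap h ψ v x ^ 2 = ∫ x, (carlemanDensity h ψ v x
      - 4 * h * energyDiv h α v x + energyDiv h μ v x) := by
  have e1 : ∀ j k, HasCompactSupport (const (-4 * h ^ 3) * d k ψ * d k v * d j v
            + const (-2 * h ^ 3) * d k (d k ψ) * v * d j v : Smooth n ℝ) := fun j k =>
    hasCompactSupport_add (hasCompactSupport_mul_left _ (hasCompactSupport_d j hv))
      (hasCompactSupport_mul_left _ (hasCompactSupport_d j hv))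
  have e2 : ∀ j k, HasCompactSupport (const (2 * h ^ 3) * d j v ^ 2 * d k ψ
            - const (2 * h) * d j ψ ^ 2 * d k ψ * v ^ 2 : Smooth n ℝ) := fun j k =>
    hasCompactSupport_sub (by
      rw [mul_comm]
      exact hasCompactSupport_mul_left _ (hasCompactSupport_mul_left _
        (hasCompactSupport_sq (hasCompactSupport_d j hv))))
      (hasCompactSupport_mul_left _ (hasCompactSupport_sq hv))
  have e3 : ∀ β : Smooth n ℝ, ∀ j, HasCompactSupport (const (h ^ 2) * β * v * d j v : Smooth n ℝ) :=
    fun β j => hasCompactSupport_mul_left _ (hasCompactSupport_d j hv)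
  have i0 : ∀ β : Smooth n ℝ, ∫ x, energyDiv h β v x = 0 := fun β =>
    integral_sum_d _ _ _ fun j _ => e3 β j
  have i0' : ∀ β : Smooth n ℝ, Integrable (energyDiv h β v) := fun β => by
    have : (energyDiv h β v : Space n → ℝ) = fun x => ∑ j, d j (const (h ^ 2) * β * v * d j v) x := by
      ext x; simp [energyDiv]
    rw [this]
    exact integrable_finsetSum _ fun j _ => integrable (hasCompactSupport_d _ (e3 β j))
  have key : ∀ x, carlemanDensity h ψ v x = conjLap h ψ v x ^ 2
      - ∑ j, ∑ k, (d j (const (-4 * h ^ 3) * d k ψ * d k v * d j v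
            + const (-2 * h ^ 3) * d k (d k ψ) * v * d j v) x
        + d k (const (2 * h ^ 3) * d j v ^ 2 * d k ψ
            - const (2 * h) * d j ψ ^ 2 * d k ψ * v ^ 2) x) := by
    intro x
    have := congrArg (fun f : Smooth n ℝ => f x) (conjLap_sq h ψ v)
    simp only [add_apply, sum_apply, pow_apply] at this
    linarith
  have hT : HasCompactSupport (conjLap h ψ v) := by
    refine hv.mono' ?_
    intro x hx
    by_contra hx'
    apply hx
    have hz : ∀ j, d j (d j v) x = 0 := fun j =>
      d_eq_zero_of_tsupport_subset j (tsupport_d_subset j v) hx'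
    simp [conjLap, lap, gradMul, image_eq_zero_of_notMem_tsupport hx',
      d_eq_zero_of_notMem _ v hx', hz]
  have iT : Integrable (fun x => conjLap h ψ v x ^ 2) := integrable (hasCompactSupport_sq hT)
  have iS : ∀ j k, Integrable (fun x => d j (const (-4 * h ^ 3) * d k ψ * d k v * d j v
            + const (-2 * h ^ 3) * d k (d k ψ) * v * d j v) x
        + d k (const (2 * h ^ 3) * d j v ^ 2 * d k ψ
            - const (2 * h) * d j ψ ^ 2 * d k ψ * v ^ 2) x) := fun j k =>
    (integrable (hasCompactSupport_d _ (e1 j k))).add (integrable (hasCompactSupport_d _ (e2 j k)))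
  have iSS : Integrable (fun x => ∑ j, ∑ k, (d j (const (-4 * h ^ 3) * d k ψ * d k v * d j v
            + const (-2 * h ^ 3) * d k (d k ψ) * v * d j v) x
        + d k (const (2 * h ^ 3) * d j v ^ 2 * d k ψ
            - const (2 * h) * d j ψ ^ 2 * d k ψ * v ^ 2) x)) :=
    integrable_finsetSum _ fun j _ => integrable_finsetSum _ fun k _ => iS j k
  have : ∀ j, ∫ x, ∑ k, (d j (const (-4 * h ^ 3) * d k ψ * d k v * d j v
            + const (-2 * h ^ 3) * d k (d k ψ) * v * d j v) x
        + d k (const (2 * h ^ 3) * d j v ^ 2 * d k ψ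
            - const (2 * h) * d j ψ ^ 2 * d k ψ * v ^ 2) x) = 0 := by
    intro j
    rw [integral_finsetSum _ fun k _ => iS j k]
    refine Finset.sum_eq_zero fun k _ => ?_
    rw [integral_add (integrable (hasCompactSupport_d _ (e1 j k)))
      (integrable (hasCompactSupport_d _ (e2 j k))), integral_d _ (e1 j k), integral_d _ (e2 j k),
      add_zero]
  simp_rw [key]
  refine integral_eq_integral_sub_add _ iT iSS (i0' α) (i0' μ) ?_ (i0 α) (i0 μ)
  rw [integral_finsetSum _ fun j _ => integrable_finsetSum _ fun k _ => iS j k]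
  exact Finset.sum_eq_zero fun j _ => this j

end Smooth

end

/-! ### Pointwise positivity: absorbing the error terms -/

section

set_option maxHeartbeats 400000 in
/-- The pointwise positivity behind the Carleman estimate. -/
lemma carleman_scalar_bound {c₀ M lam ε h S K v P B X₁ X₂ L α G g s mp : ℝ}
    (hc₀ : 0 < c₀) (hM : 1 ≤ M) (hlam : 0 < lam) (hlam1 : lam ≤ 1) (hlamM : lam * M ≤ c₀ ^ 2 / 4)
    (hε : 0 < ε) (hε1 : 26 * M ^ 2 * ε ≤ lam) (hε2 : 52 * M ^ 2 * ε ≤ c₀ ^ 2)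
    (hh : 0 < h) (hhε : h ≤ ε)
    (hB : |B| ≤ M * P) (hX₁ : |X₁| ≤ M * P) (hX₂ : |X₂| ≤ M * P) (hL : |L| ≤ M) (hα : |α| ≤ M)
    (hG : G ≤ M) (hg : c₀ ≤ g) (hs : 1 / 2 ≤ s) (hK : 2 * s * mp + h * L * v = K) :
    h ^ 2 / ε * (lam / 2 * P ^ 2 + c₀ ^ 2 / 4 * v ^ 2) ≤
      S ^ 2 + K ^ 2 + 4 * h * (s * mp * B + h / ε * mp ^ 2 + h / ε * s ^ 2 * g ^ 2 * v ^ 2)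
        + 4 * h * α * v * S - 4 * h ^ 2 * v * X₁ + 2 * h ^ 2 * v * X₂
        + lam * (h / ε) * h * (P ^ 2 - G * v ^ 2 - v * S) := by
  set κ := h / ε with hκ
  have hκ0 : 0 < κ := div_pos hh hε
  have hκ1 : κ ≤ 1 := (div_le_one hε).2 hhε
  have hM0 : 0 < M := by linarith
  have hh2 : h ^ 2 / ε = h * κ := by rw [hκ]; ring
  have hhκ : h = ε * κ := by rw [hκ]; field_simp
  have hM2 : M ≤ M ^ 2 := by nlinarith
  -- A direct bound would be of size hP², too large to absorb. The relation 2s·mp = K - hLv makes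
  -- the term O(h²) at the cost of all of K².
  have e1 : 4 * h * (s * mp * B) ≥ -K ^ 2 - 2 * M ^ 2 * h ^ 2 * P ^ 2 - M ^ 2 * h ^ 2 * v ^ 2 := by
    have : 4 * h * (s * mp * B) = 2 * h * K * B - 2 * h ^ 2 * (L * v) * B := by rw [← hK]; ring
    rw [this]
    have b2 : B ^ 2 ≤ M ^ 2 * P ^ 2 := by
      rw [← mul_pow]; exact sq_le_sq' (by linarith [neg_le_of_abs_le hB]) (le_of_abs_le hB)
    have l2 : L ^ 2 ≤ M ^ 2 := sq_le_sq' (by linarith [neg_le_of_abs_le hL]) (le_of_abs_le hL)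
    have q1 : 2 * h * K * B ≥ -K ^ 2 - h ^ 2 * B ^ 2 := by linarith [sq_nonneg (K + h * B), add_sq K (h * B)]
    have q2 : 2 * h ^ 2 * (L * v) * B ≤ h ^ 2 * (L ^ 2 * v ^ 2) + h ^ 2 * B ^ 2 := by
      linarith [sq_nonneg (h * (L * v - B)), show (h * (L * v - B)) ^ 2 = h ^ 2 * (L ^ 2 * v ^ 2) - 2 * h ^ 2 * (L * v) * B + h ^ 2 * B ^ 2 by ring]
    have q3 : h ^ 2 * B ^ 2 ≤ h ^ 2 * (M ^ 2 * P ^ 2) := by gcongr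
    have q4 : h ^ 2 * (L ^ 2 * v ^ 2) ≤ h ^ 2 * (M ^ 2 * v ^ 2) := by gcongr
    linarith
  have e2 : 4 * h * (κ * mp ^ 2) ≥ 0 := by positivity
  have e3 : 4 * h * (κ * s ^ 2 * g ^ 2 * v ^ 2) ≥ h * κ * c₀ ^ 2 * v ^ 2 := by
    have s2 : 1 ≤ 4 * s ^ 2 := by nlinarith
    have g2 : c₀ ^ 2 ≤ g ^ 2 := by gcongr
    have : c₀ ^ 2 ≤ 4 * s ^ 2 * g ^ 2 := by nlinarith [sq_nonneg g]
    have := mul_le_mul_of_nonneg_left this (show 0 ≤ h * κ * v ^ 2 by positivity)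
    linarith
  -- Half of S² is spent here, the other half in `e8`.
  have e4 : 4 * h * α * v * S ≥ -(1 / 2) * S ^ 2 - 8 * M ^ 2 * h ^ 2 * v ^ 2 := by
    have a2 : α ^ 2 ≤ M ^ 2 := sq_le_sq' (by linarith [neg_le_of_abs_le hα]) (le_of_abs_le hα)
    have := mul_le_mul_of_nonneg_left a2 (show 0 ≤ h ^ 2 * v ^ 2 by positivity)
    linarith [sq_nonneg (S + 4 * h * α * v), add_sq S (4 * h * α * v)]
  have cross : ∀ X : ℝ, |X| ≤ M * P → |v * X| ≤ M ^ 2 * (v ^ 2 + P ^ 2) / 2 := by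
    intro X hX
    rw [abs_mul]
    have h1 : |v| * |X| ≤ |v| * (M * P) := by gcongr
    have h2 : |v| * P ≤ (v ^ 2 + P ^ 2) / 2 := by
      linarith [sq_nonneg (|v| - P), sq_abs v, sub_sq |v| P]
    have h3 : 0 ≤ (v ^ 2 + P ^ 2) / 2 := by positivity
    linarith [mul_le_mul_of_nonneg_left h2 hM0.le, mul_le_mul_of_nonneg_right hM2 h3]
  have e5 : 4 * h ^ 2 * v * X₁ ≤ 2 * M ^ 2 * h ^ 2 * (v ^ 2 + P ^ 2) := by
    have := mul_le_mul_of_nonneg_left ((le_abs_self _).trans (cross X₁ hX₁)) (sq_nonneg h)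
    linarith
  have e6 : 2 * h ^ 2 * v * X₂ ≥ -(M ^ 2 * h ^ 2 * (v ^ 2 + P ^ 2)) := by
    have := mul_le_mul_of_nonneg_left ((neg_le_abs _).trans (cross X₂ hX₂)) (sq_nonneg h)
    linarith
  have e7 : lam * κ * h * (G * v ^ 2) ≤ h * κ * (c₀ ^ 2 / 4) * v ^ 2 := by
    have h1 : lam * G ≤ c₀ ^ 2 / 4 := (mul_le_mul_of_nonneg_left hG hlam.le).trans hlamM
    have := mul_le_mul_of_nonneg_left h1 (show 0 ≤ h * κ * v ^ 2 by positivity)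
    linarith
  have e8 : lam * κ * h * (v * S) ≤ 1 / 2 * S ^ 2 + M ^ 2 * h ^ 2 * v ^ 2 := by
    have h1 : (lam * κ) ^ 2 ≤ 1 := pow_le_one₀ (by positivity) (mul_le_one₀ hlam1 hκ0.le hκ1)
    have h2 : (lam * κ) ^ 2 ≤ M ^ 2 := h1.trans (one_le_pow₀ hM)
    have := mul_le_mul_of_nonneg_left h2 (show 0 ≤ h ^ 2 * v ^ 2 by positivity)
    linarith [sq_nonneg (S - lam * κ * h * v), sub_sq S (lam * κ * h * v), show 0 ≤ M ^ 2 * (h ^ 2 * v ^ 2) by positivity,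
      show 0 ≤ S ^ 2 by positivity]
  -- The errors in v² from `e1`, `e4`, `e5`, `e6`, `e8` add up to 1 + 8 + 2 + 1 + 1 = 13; those in
  -- P² only to 5. Both are absorbed because h² = ε·hκ with ε small.
  have f1 : 13 * M ^ 2 * h ^ 2 * v ^ 2 ≤ h * κ * (c₀ ^ 2 / 4) * v ^ 2 := by
    have : 13 * M ^ 2 * ε ≤ c₀ ^ 2 / 4 := by linarith
    have := mul_le_mul_of_nonneg_left this (show 0 ≤ h * κ * v ^ 2 by positivity)
    calc _ = h * κ * v ^ 2 * (13 * M ^ 2 * ε) := by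
          nth_rewrite 1 [pow_two h]; nth_rewrite 2 [hhκ]; ring
      _ ≤ _ := by linarith
  have f2 : 13 * M ^ 2 * h ^ 2 * P ^ 2 ≤ h * κ * (lam / 2) * P ^ 2 := by
    have : 13 * M ^ 2 * ε ≤ lam / 2 := by linarith
    have := mul_le_mul_of_nonneg_left this (show 0 ≤ h * κ * P ^ 2 by positivity)
    calc _ = h * κ * P ^ 2 * (13 * M ^ 2 * ε) := by
          nth_rewrite 1 [pow_two h]; nth_rewrite 2 [hhκ]; ring
      _ ≤ _ := by linarith
  have p1 : 0 ≤ M ^ 2 * h ^ 2 * v ^ 2 := by positivity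
  have p2 : 0 ≤ M ^ 2 * h ^ 2 * P ^ 2 := by positivity
  rw [hh2]
  linarith

end

/-! ### Convexified weights -/

section

namespace Smooth

variable {n : ℕ}

/-- The convexified weight `φ + κ φ² / 2`. -/
def convexify (κ : ℝ) (φ : Smooth n ℝ) : Smooth n ℝ := φ + const κ * (const (1 / 2) * φ * φ)

/-- The Hessian of `φ` applied to its gradient, twice. -/
def hessGrad (φ : Smooth n ℝ) : Smooth n ℝ := ∑ j, ∑ k, d j (d k φ) * d j φ * d k φ

lemma d_convexify (κ : ℝ) (φ : Smooth n ℝ) (k : Fin n) :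
    d k (convexify κ φ) = (1 + const κ * φ) * d k φ := by
  ext x
  simp only [convexify, map_add, d_mul, d_const, add_apply, mul_apply, const_apply, one_apply,
    zero_apply]
  ring

lemma d_d_convexify (κ : ℝ) (φ : Smooth n ℝ) (j k : Fin n) :
    d j (d k (convexify κ φ)) = (1 + const κ * φ) * d j (d k φ) + const κ * d j φ * d k φ := by
  rw [d_convexify]
  ext x
  simp only [map_add, d_mul, d_const, d_one, add_apply, mul_apply, const_apply, one_apply,
    zero_apply]
  ring

/-- The Laplacian is affine in κ with coefficients independent of κ, so bounds on it and its
derivatives are uniform for 0 ≤ κ ≤ 1. -/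
lemma lap_convexify (κ : ℝ) (φ : Smooth n ℝ) :
    lap (convexify κ φ) = lap φ + const κ * lap (const (1 / 2) * φ * φ) := by
  simp only [lap, convexify, map_add, Finset.sum_add_distrib, Finset.mul_sum]
  congr 1
  refine Finset.sum_congr rfl fun j _ => ?_
  rw [d_mul j (const κ), d_const, mul_zero, add_zero, d_mul j (const κ), d_const, mul_zero, add_zero]

lemma energyDiv_apply (h : ℝ) (β v : Smooth n ℝ) (x : Space n) :
    energyDiv h β v x = β x * ∑ j, (h * d j v x) ^ 2 + β x * v x * (h ^ 2 * lap v x)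
      + h * v x * ∑ j, d j β x * (h * d j v x) := by
  simp only [energyDiv, lap, sum_apply, Finset.mul_sum, ← Finset.sum_add_distrib]
  refine Finset.sum_congr rfl fun j _ => ?_
  simp only [d_mul, d_const, add_apply, mul_apply, const_apply, zero_apply]
  ring

lemma carlemanDensity_apply (h : ℝ) (ψ v : Smooth n ℝ) (x : Space n) :
    carlemanDensity h ψ v x = (-(h ^ 2 * lap v x) - gradMul ψ ψ x * v x) ^ 2
      + (2 * h * gradMul ψ v x + h * lap ψ x * v x) ^ 2
      + 4 * h * (∑ j, ∑ k, d j (d k ψ) x * (h * d j v x) * (h * d k v x)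
        + v x ^ 2 * ∑ j, ∑ k, d j (d k ψ) x * d j ψ x * d k ψ x)
      + 2 * h ^ 2 * v x * ∑ j, d j (lap ψ) x * (h * d j v x) := by
  simp only [carlemanDensity, add_apply, pow_apply, sub_apply, neg_apply, mul_apply, const_apply,
    sum_apply]
  rw [add_assoc (_ + _)]
  congr 1
  simp only [lap, map_sum, sum_apply, Finset.mul_sum, Finset.sum_mul, mul_add,
    ← Finset.sum_add_distrib]
  refine Finset.sum_congr rfl fun j _ => Finset.sum_congr rfl fun k _ => ?_
  ring

/-- The value of the density for a convexified limiting Carleman weight. -/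
lemma carlemanDensity_convexify {h κ lam : ℝ} {φ r v : Smooth n ℝ} {x : Space n}
    (hr : r x * gradMul φ φ x = 1)
    (hφ : ∀ ξ : Fin n → ℝ, ∑ j, ∑ k, d j (d k φ) x * ξ j * ξ k
      = -(r x * hessGrad φ x) * ∑ j, ξ j ^ 2
        + 2 * r x * (∑ j, d j φ x * ξ j) * ∑ j, ∑ k, d j (d k φ) x * d j φ x * ξ k)
    {s mp P2 hp S K : ℝ} (hs : s = 1 + κ * φ x) (hmp : mp = ∑ j, d j φ x * (h * d j v x))
    (hP2 : P2 = ∑ j, (h * d j v x) ^ 2)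
    (hhp : hp = ∑ j, ∑ k, d j (d k φ) x * d j φ x * (h * d k v x))
    (hS : S = -(h ^ 2 * lap v x) - s ^ 2 * gradMul φ φ x * v x)
    (hK : K = 2 * s * mp + h * lap (convexify κ φ) x * v x) :
    carlemanDensity h (convexify κ φ) v x
      - 4 * h * energyDiv h (-((1 + const κ * φ) * (r * hessGrad φ))) v x
      + energyDiv h (const (lam * κ * h)) v x
    = S ^ 2 + K ^ 2 + 4 * h * (s * mp * (2 * r x * hp) + κ * mp ^ 2
        + κ * s ^ 2 * gradMul φ φ x ^ 2 * v x ^ 2)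
      + 4 * h * (-(s * (r x * hessGrad φ x))) * v x * S
      - 4 * h ^ 2 * v x * (∑ j, d j (-((1 + const κ * φ) * (r * hessGrad φ))) x * (h * d j v x))
      + 2 * h ^ 2 * v x * (∑ j, d j (lap (convexify κ φ)) x * (h * d j v x))
      + lam * κ * h * (P2 - s ^ 2 * gradMul φ φ x * v x ^ 2 - v x * S) := by
  have g1 : gradMul (convexify κ φ) (convexify κ φ) x = s ^ 2 * gradMul φ φ x := by
    simp only [gradMul, d_convexify, sum_apply, mul_apply, add_apply, one_apply, const_apply,
      Finset.mul_sum, hs]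
    exact Finset.sum_congr rfl fun j _ => by ring
  have g2 : h * gradMul (convexify κ φ) v x = s * mp := by
    simp only [gradMul, d_convexify, sum_apply, mul_apply, add_apply, one_apply, const_apply,
      Finset.mul_sum, hs, hmp]
    exact Finset.sum_congr rfl fun j _ => by ring
  -- The Hessian of the convexified weight is sφ'' + κ∇φ⊗∇φ; the hypothesis `hφ` rewrites the first
  -- summand, and the second supplies κmp².
  have E1 : ∑ j, ∑ k, d j (d k (convexify κ φ)) x * (h * d j v x) * (h * d k v x)
      = s * (-(r x * hessGrad φ x) * P2 + 2 * r x * mp * hp) + κ * mp ^ 2 := by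
    rw [hP2, hhp, hmp, ← hφ, pow_two (∑ j, _), Finset.sum_mul_sum, Finset.mul_sum, Finset.mul_sum,
      ← Finset.sum_add_distrib]
    refine Finset.sum_congr rfl fun j _ => ?_
    rw [Finset.mul_sum, Finset.mul_sum, ← Finset.sum_add_distrib]
    refine Finset.sum_congr rfl fun k _ => ?_
    simp only [d_d_convexify, mul_apply, add_apply, one_apply, const_apply, hs]
    ring
  have E2 : ∑ j, ∑ k, d j (d k (convexify κ φ)) x * d j (convexify κ φ) x * d k (convexify κ φ) x
      = s ^ 3 * hessGrad φ x + κ * s ^ 2 * gradMul φ φ x ^ 2 := by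
    simp only [hessGrad, gradMul, sum_apply, mul_apply]
    rw [pow_two (∑ j, _), Finset.sum_mul_sum, Finset.mul_sum, Finset.mul_sum,
      ← Finset.sum_add_distrib]
    refine Finset.sum_congr rfl fun j _ => ?_
    rw [Finset.mul_sum, Finset.mul_sum, ← Finset.sum_add_distrib]
    refine Finset.sum_congr rfl fun k _ => ?_
    rw [d_d_convexify]
    simp only [d_convexify, mul_apply, add_apply, one_apply, const_apply, hs]
    ring
  have b1 : (-((1 + const κ * φ) * (r * hessGrad φ)) : Smooth n ℝ) x
      = -(s * (r x * hessGrad φ x)) := by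
    simp [hs]
  -- Second derivatives of v are eliminated in favour of S.
  have b2 : h ^ 2 * lap v x = -S - s ^ 2 * gradMul φ φ x * v x := by rw [hS]; ring
  rw [carlemanDensity_apply, energyDiv_apply, energyDiv_apply, g1, E1, E2, b1, b2, ← hP2,
    show (2 * h * gradMul (convexify κ φ) v x + h * lap (convexify κ φ) x * v x) = K by
      rw [hK, mul_assoc 2 h, g2]; ring]
  simp only [d_const, zero_apply, zero_mul, Finset.sum_const_zero, const_apply]
  -- The indefinite |h∇v|² terms have cancelled by the choice of multiplier. The s³φ''(∇φ,∇φ)v²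
  -- terms, one from `E2` and one from eliminating the Laplacian, cancel because r|∇φ|² = 1.
  linear_combination (4 * h * s ^ 3 * v x ^ 2 * hessGrad φ x) * (-hr)

end Smooth

end

/-! ### The Carleman estimate for real functions -/

section

namespace Smooth

variable {n : ℕ}

lemma abs_sum_mul_le {a p : Fin n → ℝ} {B : ℝ} (ha : ∀ j, |a j| ≤ B) :
    |∑ j, a j * p j| ≤ n * B * √(∑ j, p j ^ 2) := by
  have hp : ∀ j, |p j| ≤ √(∑ j, p j ^ 2) := fun j => by
    rw [← Real.sqrt_sq_eq_abs]
    exact Real.sqrt_le_sqrt (Finset.single_le_sum (f := fun j => p j ^ 2)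
      (fun _ _ => sq_nonneg _) (Finset.mem_univ j))
  refine (Finset.abs_sum_le_sum_abs _ _).trans ?_
  have : ∀ j ∈ Finset.univ, |a j * p j| ≤ B * √(∑ j, p j ^ 2) := fun j _ => by
    rw [abs_mul]
    exact mul_le_mul (ha j) (hp j) (abs_nonneg _) ((abs_nonneg _).trans (ha j))
  refine (Finset.sum_le_sum this).trans (le_of_eq ?_)
  simp [mul_assoc]

lemma lap_eq_zero_of_notMem {v : Smooth n ℝ} {x : Space n} (hx : x ∉ tsupport v) :
    lap v x = 0 := by
  simp only [lap, sum_apply]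
  exact Finset.sum_eq_zero fun j _ =>
    d_eq_zero_of_tsupport_subset j (tsupport_d_subset j v) hx

lemma hasCompactSupport_of_forall_notMem {f v : Smooth n ℝ} (hv : HasCompactSupport v)
    (h : ∀ x ∉ tsupport v, f x = 0) : HasCompactSupport f :=
  hv.mono' fun x hx => by
    by_contra h'
    exact hx (h x h')

/-- The limiting Carleman weight condition in coordinates, together with a smooth inverse `r` of
`|∇φ|²`. -/
structure IsCarlemanPair (U : Set (Space n)) (φ r : Smooth n ℝ) : Prop where
  inv : ∀ x ∈ U, r x * gradMul φ φ x = 1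
  hessian : ∀ x ∈ U, ∀ ξ : Fin n → ℝ, ∑ j, ∑ k, d j (d k φ) x * ξ j * ξ k
      = -(r x * hessGrad φ x) * ∑ j, ξ j ^ 2
        + 2 * r x * (∑ j, d j φ x * ξ j) * ∑ j, ∑ k, d j (d k φ) x * d j φ x * ξ k

set_option maxHeartbeats 400000 in
/-- The Carleman estimate for real functions and the conjugated Laplacian. -/
theorem carleman_real {U : Set (Space n)} (hU : IsCompact (closure U)) {φ r : Smooth n ℝ}
    (hφ : IsCarlemanPair U φ r) :
    ∃ c > 0, ∃ ε₀ > 0, ∀ ε, 0 < ε → ε ≤ ε₀ → ∃ h₀ > 0, ∀ h, 0 < h → h ≤ h₀ →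
      ∀ v : Smooth n ℝ, HasCompactSupport v → tsupport v ⊆ U →
        c * (h ^ 2 / ε) * ∫ x, (v x ^ 2 + ∑ j, (h * d j v x) ^ 2)
          ≤ ∫ x, conjLap h (convexify (h / ε) φ) v x ^ 2 := by
  obtain ⟨M₁, hM₁⟩ := exists_bound_family (ι := Fin 6 ⊕ Fin 5 × Fin n)
    (Sum.elim ![φ, r, gradMul φ φ, r * hessGrad φ, lap φ, lap (const (1 / 2) * φ * φ)]
      fun p : Fin 5 × Fin n => ![d p.2 φ, d p.2 (r * hessGrad φ), d p.2 (lap φ),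
        d p.2 (lap (const (1 / 2) * φ * φ)), const 2 * r * ∑ j, d j (d p.2 φ) * d j φ] p.1) hU
  set M₀ := max M₁ 1 with hM₀
  have hM : ∀ i, ∀ x ∈ U, ‖(Sum.elim ![φ, r, gradMul φ φ, r * hessGrad φ, lap φ,
      lap (const (1 / 2) * φ * φ)] (fun p : Fin 5 × Fin n => ![d p.2 φ, d p.2 (r * hessGrad φ), d p.2 (lap φ),
        d p.2 (lap (const (1 / 2) * φ * φ)), const 2 * r * ∑ j, d j (d p.2 φ) * d j φ] p.1) i
      : Smooth n ℝ) x‖ ≤ M₀ := fun i x hx => (hM₁ i x hx).trans (le_max_left _ _)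
  clear_value M₀
  have b1 : ∀ x ∈ U, |φ x| ≤ M₀ := fun x hx => hM (Sum.inl 0) x hx
  have b2 : ∀ x ∈ U, |r x| ≤ M₀ := fun x hx => hM (Sum.inl 1) x hx
  have b3 : ∀ x ∈ U, |gradMul φ φ x| ≤ M₀ := fun x hx => hM (Sum.inl 2) x hx
  have b4 : ∀ x ∈ U, |(r * hessGrad φ) x| ≤ M₀ := fun x hx => hM (Sum.inl 3) x hx
  have b5 : ∀ x ∈ U, |lap φ x| ≤ M₀ := fun x hx => hM (Sum.inl 4) x hx
  have b6 : ∀ x ∈ U, |lap (const (1 / 2) * φ * φ) x| ≤ M₀ := fun x hx => hM (Sum.inl 5) x hx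
  have b7 : ∀ j, ∀ x ∈ U, |d j φ x| ≤ M₀ := fun j x hx => hM (Sum.inr (0, j)) x hx
  have b8 : ∀ j, ∀ x ∈ U, |d j (r * hessGrad φ) x| ≤ M₀ := fun j x hx => hM (Sum.inr (1, j)) x hx
  have b9 : ∀ j, ∀ x ∈ U, |d j (lap φ) x| ≤ M₀ := fun j x hx => hM (Sum.inr (2, j)) x hx
  have b10 : ∀ j, ∀ x ∈ U, |d j (lap (const (1 / 2) * φ * φ)) x| ≤ M₀ :=
    fun j x hx => hM (Sum.inr (3, j)) x hx
  have b11 : ∀ j, ∀ x ∈ U, |(const 2 * r * ∑ i, d i (d j φ) * d i φ : Smooth n ℝ) x| ≤ M₀ :=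
    fun j x hx => hM (Sum.inr (4, j)) x hx
  clear hM
  have hM01 : 1 ≤ M₀ := hM₀ ▸ le_max_right _ _
  have hM0 : 0 < M₀ := by linarith
  -- N dominates every coefficient met below, such as (3/2)M₀ + M₀² for the derivatives of the
  -- multiplier; the factor n + 1 in M leaves room for the sums over coordinates.
  set N := 4 * M₀ + M₀ ^ 2 with hN
  have hN4 : 4 * M₀ ≤ N := by rw [hN]; nlinarith
  set M := (n + 1) * N with hMdef
  have hn0 : (0 : ℝ) ≤ n := Nat.cast_nonneg n
  have hNM : N ≤ M := by rw [hMdef]; nlinarith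
  have hnNM : n * N ≤ M := by rw [hMdef]; nlinarith
  have hM1 : 1 ≤ M := by linarith
  -- A lower bound for |∇φ|² on U, since r ≤ M₀ and r|∇φ|² = 1.
  set c₀ := 1 / M₀ with hc₀def
  have hc₀ : 0 < c₀ := by positivity
  set lam := min 1 (c₀ ^ 2 / (4 * M)) with hlamdef
  have hlam : 0 < lam := lt_min one_pos (by positivity)
  have hlam1 : lam ≤ 1 := min_le_left _ _
  have hlamM : lam * M ≤ c₀ ^ 2 / 4 := by
    calc lam * M ≤ c₀ ^ 2 / (4 * M) * M := by gcongr; exact min_le_right _ _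
      _ = c₀ ^ 2 / 4 := by field_simp
  set c := min (lam / 2) (c₀ ^ 2 / 4) with hc
  have hc0 : 0 < c := lt_min (by positivity) (by positivity)
  refine ⟨c, hc0, min (lam / (26 * M ^ 2)) (c₀ ^ 2 / (52 * M ^ 2)),
    lt_min (by positivity) (by positivity), fun ε hε hεle => ?_⟩
  have hε1 : 26 * M ^ 2 * ε ≤ lam := by
    have := (le_div_iff₀ (by positivity)).1 (hεle.trans (min_le_left _ _))
    linarith
  have hε2 : 52 * M ^ 2 * ε ≤ c₀ ^ 2 := by
    have := (le_div_iff₀ (by positivity)).1 (hεle.trans (min_le_right _ _))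
    linarith
  -- This threshold gives κ|φ| ≤ 1/2 on U, hence 1/2 ≤ s ≤ 3/2; as M₀ ≥ 1, it also gives κ ≤ 1.
  refine ⟨ε / (2 * M₀), by positivity, fun h hh hhle v hv hvU => ?_⟩
  set κ := h / ε with hκ
  have hκ0 : 0 < κ := div_pos hh hε
  have hκM : κ * M₀ ≤ 1 / 2 := by
    have h1 := (le_div_iff₀ (by positivity)).1 hhle
    rw [hκ, div_mul_eq_mul_div, div_le_iff₀ hε]
    linarith
  have hκ1 : κ ≤ 1 := by nlinarith
  have hhε : h ≤ ε := (div_le_one hε).1 hκ1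
  -- The first multiplier is the coefficient of |h∇v|² in sφ''(h∇v, h∇v), so it removes that term.
  -- The second, λκh, buys a small positive multiple of |h∇v|² at the expense of part of the v²
  -- gain.
  rw [integral_conjLap_sq h (convexify κ φ) (-((1 + const κ * φ) * (r * hessGrad φ)))
    (const (lam * κ * h)) v hv, ← integral_const_mul]
  have hF : HasCompactSupport (carlemanDensity h (convexify κ φ) v
      - const (4 * h) * energyDiv h (-((1 + const κ * φ) * (r * hessGrad φ))) v
      + energyDiv h (const (lam * κ * h)) v : Smooth n ℝ) := by
    refine hasCompactSupport_of_forall_notMem hv fun x hx => ?_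
    simp [carlemanDensity_apply, energyDiv_apply, image_eq_zero_of_notMem_tsupport hx,
      lap_eq_zero_of_notMem hx, d_eq_zero_of_notMem _ v hx, gradMul]
  refine integral_mono_of_nonneg (Filter.Eventually.of_forall fun x => ?_) (integrable hF) 
    (Filter.Eventually.of_forall fun x => ?_)
  · have : 0 ≤ v x ^ 2 + ∑ j, (h * d j v x) ^ 2 := by positivity
    have := mul_nonneg (mul_nonneg hc0.le (show 0 ≤ h ^ 2 / ε by positivity)) this
    simpa using this
  dsimp only
  by_cases hx : x ∈ U
  swap
  · have hx' : x ∉ tsupport v := fun h => hx (hvU h)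
    simp [carlemanDensity_apply, energyDiv_apply, image_eq_zero_of_notMem_tsupport hx',
      lap_eq_zero_of_notMem hx', d_eq_zero_of_notMem _ v hx', gradMul]
  set s := 1 + κ * φ x with hs
  have hφx : |κ * φ x| ≤ 1 / 2 := by
    rw [abs_mul, abs_of_pos hκ0]
    exact (mul_le_mul_of_nonneg_left (b1 x hx) hκ0.le).trans hκM
  have hs1 : 1 / 2 ≤ s := by linarith [neg_le_of_abs_le hφx]
  have hs2 : s ≤ 3 / 2 := by linarith [le_of_abs_le hφx]
  have hsabs : |s| ≤ 3 / 2 := by rw [abs_of_nonneg (by linarith)]; exact hs2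
  have hg0 : 0 ≤ gradMul φ φ x := by
    simp only [gradMul, sum_apply, mul_apply]
    exact Finset.sum_nonneg fun j _ => mul_self_nonneg _
  have key := carleman_scalar_bound (c₀ := c₀) (M := M) (lam := lam) (ε := ε) (h := h)
    (S := -(h ^ 2 * lap v x) - s ^ 2 * gradMul φ φ x * v x)
    (K := 2 * s * (∑ j, d j φ x * (h * d j v x)) + h * lap (convexify κ φ) x * v x)
    (v := v x) (P := √(∑ j, (h * d j v x) ^ 2))
    (B := 2 * r x * ∑ j, ∑ k, d j (d k φ) x * d j φ x * (h * d k v x))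
    (X₁ := ∑ j, d j (-((1 + const κ * φ) * (r * hessGrad φ))) x * (h * d j v x))
    (X₂ := ∑ j, d j (lap (convexify κ φ)) x * (h * d j v x))
    (L := lap (convexify κ φ) x) (α := -(s * (r x * hessGrad φ x)))
    (G := s ^ 2 * gradMul φ φ x) (g := gradMul φ φ x) (s := s)
    (mp := ∑ j, d j φ x * (h * d j v x))
    hc₀ hM1 hlam hlam1 hlamM hε hε1 hε2 hh hhε ?_ ?_ ?_ ?_ ?_ ?_ ?_ hs1 rfl
  · rw [← hκ, Real.sq_sqrt (by positivity)] at key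
    rw [carlemanDensity_convexify (lam := lam) (hφ.inv x hx) (hφ.hessian x hx) hs rfl
      rfl rfl rfl rfl]
    refine le_trans ?_ key
    have hcl : c ≤ lam / 2 := min_le_left _ _
    have hcr : c ≤ c₀ ^ 2 / 4 := min_le_right _ _
    have hP0 : 0 ≤ ∑ j, (h * d j v x) ^ 2 := by positivity
    calc c * (h ^ 2 / ε) * (v x ^ 2 + ∑ j, (h * d j v x) ^ 2)
        = h ^ 2 / ε * (c * (∑ j, (h * d j v x) ^ 2) + c * v x ^ 2) := by ring
      _ ≤ _ := by gcongr
  · have : 2 * r x * ∑ j, ∑ k, d j (d k φ) x * d j φ x * (h * d k v x)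
        = ∑ k, (const 2 * r * ∑ i, d i (d k φ) * d i φ : Smooth n ℝ) x * (h * d k v x) := by
      rw [Finset.sum_comm, Finset.mul_sum]
      refine Finset.sum_congr rfl fun k _ => ?_
      simp only [mul_apply, const_apply, sum_apply, Finset.mul_sum, Finset.sum_mul]
      exact Finset.sum_congr rfl fun j _ => by ring
    rw [this]
    refine (abs_sum_mul_le (B := N) fun j => (b11 j x hx).trans (by linarith)).trans ?_
    gcongr
  · refine (abs_sum_mul_le (B := N) fun j => ?_).trans (by gcongr)
    have : d j (-((1 + const κ * φ) * (r * hessGrad φ))) x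
        = -(s * d j (r * hessGrad φ) x + κ * d j φ x * (r * hessGrad φ) x) := by
      rw [map_neg, d_mul, map_add, d_mul j (const κ), d_one, d_const, hs]
      simp only [neg_apply, add_apply, mul_apply, const_apply, one_apply, zero_apply]
      ring
    rw [this, abs_neg]
    refine (abs_add_le _ _).trans ?_
    rw [abs_mul, abs_mul, abs_mul, abs_of_pos hκ0]
    have t1 := mul_le_mul hsabs (b8 j x hx) (abs_nonneg _) (by norm_num)
    have t2 := mul_le_mul (mul_le_mul hκ1 (b7 j x hx) (abs_nonneg _) zero_le_one) (b4 x hx)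
      (abs_nonneg _) (by linarith)
    nlinarith
  · refine (abs_sum_mul_le (B := N) fun j => ?_).trans (by gcongr)
    have : d j (lap (convexify κ φ)) x
        = d j (lap φ) x + κ * d j (lap (const (1 / 2) * φ * φ)) x := by
      rw [lap_convexify, map_add, d_mul j (const κ), d_const]
      simp
    rw [this]
    refine (abs_add_le _ _).trans ?_
    rw [abs_mul, abs_of_pos hκ0]
    have t1 := mul_le_mul hκ1 (b10 j x hx) (abs_nonneg _) zero_le_one
    linarith [b9 j x hx]
  · rw [lap_convexify]
    refine (abs_add_le _ _).trans ?_
    rw [mul_apply, const_apply, abs_mul, abs_of_pos hκ0]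
    have t1 := mul_le_mul hκ1 (b6 x hx) (abs_nonneg _) zero_le_one
    linarith [b5 x hx]
  · rw [abs_neg, abs_mul]
    have t1 := mul_le_mul hsabs (b4 x hx) (abs_nonneg _) (by norm_num)
    rw [mul_apply] at t1
    linarith
  · have t1 : s ^ 2 ≤ 9 / 4 := by nlinarith
    have t2 := mul_le_mul t1 (le_of_abs_le (b3 x hx)) hg0 (by norm_num)
    linarith
  · rw [hc₀def, div_le_iff₀ hM0, ← hφ.inv x hx, mul_comm]
    exact mul_le_mul_of_nonneg_left (le_of_abs_le (b2 x hx)) hg0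

end Smooth

end

/-! ### L² norms, and passage to complex functions -/

section

/-! ### The norm of `L²(ℝⁿ)` -/

section L2

variable {n : ℕ}

/-- The norm of `L²(ℝⁿ; ℂ)`. -/
def l2norm (f : Space n → ℂ) : ℝ := (eLpNorm f 2 volume).toReal

lemma l2norm_nonneg (f : Space n → ℂ) : 0 ≤ l2norm f := ENNReal.toReal_nonneg

lemma l2norm_eq_norm_toLp {f : Space n → ℂ} (hf : MemLp f 2 volume) :
    l2norm f = ‖hf.toLp f‖ := (Lp.norm_toLp f hf).symm

lemma l2norm_sq {f : Space n → ℂ} (hf : MemLp f 2 volume) :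
    l2norm f ^ 2 = ∫ x, ‖f x‖ ^ 2 := by
  have h := hf.eLpNorm_eq_integral_rpow_norm (by simp) (by simp)
  have h0 : 0 ≤ ∫ x, ‖f x‖ ^ 2 := integral_nonneg fun x => by positivity
  simp only [ENNReal.toReal_ofNat, Real.rpow_ofNat] at h
  rw [l2norm, h, ENNReal.toReal_ofReal (by positivity), ← Real.rpow_natCast, ← Real.rpow_mul h0]
  simp

lemma l2norm_add_le {f g : Space n → ℂ} (hf : MemLp f 2 volume) (hg : MemLp g 2 volume) :
    l2norm (fun x => f x + g x) ≤ l2norm f + l2norm g := by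
  rw [l2norm, l2norm, l2norm, ← ENNReal.toReal_add hf.eLpNorm_ne_top hg.eLpNorm_ne_top]
  exact ENNReal.toReal_mono (ENNReal.add_ne_top.2 ⟨hf.eLpNorm_ne_top, hg.eLpNorm_ne_top⟩)
    (eLpNorm_add_le hf.1 hg.1 (by norm_num))

lemma l2norm_neg (f : Space n → ℂ) : l2norm (fun x => -f x) = l2norm f := by
  rw [l2norm, l2norm]; congr 1; exact eLpNorm_neg f 2 volume

lemma l2norm_sub_le {f g : Space n → ℂ} (hf : MemLp f 2 volume) (hg : MemLp g 2 volume) :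
    l2norm (fun x => f x - g x) ≤ l2norm f + l2norm g := by
  have := l2norm_add_le hf hg.neg
  simp only [Pi.neg_apply, ← sub_eq_add_neg] at this
  rwa [show (-g) = fun x => -g x from rfl, l2norm_neg] at this

lemma l2norm_sum_le {ι : Type*} (s : Finset ι) {f : ι → Space n → ℂ}
    (hf : ∀ i ∈ s, MemLp (f i) 2 volume) :
    l2norm (fun x => ∑ i ∈ s, f i x) ≤ ∑ i ∈ s, l2norm (f i) := by
  have h := eLpNorm_sum_le (s := s) (f := f) (p := 2) (μ := volume) (fun i hi => (hf i hi).1)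
    (by norm_num)
  have e : (∑ i ∈ s, f i) = fun x => ∑ i ∈ s, f i x := by ext x; simp
  rw [e] at h
  have hfin : ∀ i ∈ s, eLpNorm (f i) 2 volume ≠ ⊤ := fun i hi => (hf i hi).eLpNorm_ne_top
  simp only [l2norm]
  rw [← ENNReal.toReal_sum hfin]
  exact ENNReal.toReal_mono (ENNReal.sum_ne_top.2 hfin) h

lemma l2norm_le_mul {f g : Space n → ℂ} (hg : MemLp g 2 volume) {M : ℝ} (hM : 0 ≤ M)
    (h : ∀ᵐ x, ‖f x‖ ≤ M * ‖g x‖) : l2norm f ≤ M * l2norm g := by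
  have := eLpNorm_le_mul_eLpNorm_of_ae_le_mul h 2
  rw [l2norm, l2norm, ← ENNReal.toReal_ofReal hM, ← ENNReal.toReal_mul]
  exact ENNReal.toReal_mono (ENNReal.mul_ne_top ENNReal.ofReal_ne_top hg.eLpNorm_ne_top) this

lemma l2norm_congr {f g : Space n → ℂ} (h : ∀ x, f x = g x) : l2norm f = l2norm g := by
  rw [funext h]

end L2

namespace Smooth

variable {n : ℕ}

/-- The real part. -/
def re (f : Smooth n ℂ) : Smooth n ℝ :=
  ⟨fun x => (f x).re, Complex.reCLM.contDiff.comp f.contDiff⟩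

/-- The imaginary part. -/
def im (f : Smooth n ℂ) : Smooth n ℝ :=
  ⟨fun x => (f x).im, Complex.imCLM.contDiff.comp f.contDiff⟩

/-- A real smooth function, as a complex one. -/
def ofReal (f : Smooth n ℝ) : Smooth n ℂ :=
  ⟨fun x => (f x : ℂ), Complex.ofRealCLM.contDiff.comp f.contDiff⟩

@[simp] lemma re_apply (f : Smooth n ℂ) (x : Space n) : re f x = (f x).re := rfl
@[simp] lemma im_apply (f : Smooth n ℂ) (x : Space n) : im f x = (f x).im := rfl
@[simp] lemma ofReal_apply (f : Smooth n ℝ) (x : Space n) : ofReal f x = (f x : ℂ) := rfl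

lemma d_re (j : Fin n) (f : Smooth n ℂ) : d j (re f) = re (d j f) := by
  ext x
  have := (Complex.reCLM.hasFDerivAt.comp x (f.differentiable x).hasFDerivAt).fderiv
  rw [d_apply]
  exact congrArg (fun L => L (EuclideanSpace.single j (1 : ℝ))) this

lemma d_im (j : Fin n) (f : Smooth n ℂ) : d j (im f) = im (d j f) := by
  ext x
  have := (Complex.imCLM.hasFDerivAt.comp x (f.differentiable x).hasFDerivAt).fderiv
  rw [d_apply]
  exact congrArg (fun L => L (EuclideanSpace.single j (1 : ℝ))) this

lemma d_ofReal (j : Fin n) (f : Smooth n ℝ) : d j (ofReal f) = ofReal (d j f) := by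
  ext x
  have := (Complex.ofRealCLM.hasFDerivAt.comp x (f.differentiable x).hasFDerivAt).fderiv
  rw [d_apply]
  exact congrArg (fun L => L (EuclideanSpace.single j (1 : ℝ))) this

/-- For real h and ψ the operator has real coefficients, so the complex estimate is the sum of the
real ones for the real and imaginary parts. -/
lemma re_conjLap (h : ℝ) (ψ : Smooth n ℝ) (v : Smooth n ℂ) :
    re (conjLap (h : ℂ) (ofReal ψ) v) = conjLap h ψ (re v) := by
  ext x
  simp only [conjLap, lap, gradMul, d_ofReal, d_re, re_apply, add_apply, sub_apply, neg_apply,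
    mul_apply, sum_apply, const_apply, ofReal_apply, Complex.add_re, Complex.sub_re, Complex.neg_re,
    ← Complex.ofReal_pow, ← Complex.ofReal_mul, ← Complex.ofReal_sum, Complex.re_ofReal_mul,
    Complex.re_sum]
  rw [show (2 * (h : ℂ)) = ((2 * h : ℝ) : ℂ) by push_cast; ring, Complex.re_ofReal_mul,
    Complex.re_sum]
  simp only [Complex.re_ofReal_mul]

lemma im_conjLap (h : ℝ) (ψ : Smooth n ℝ) (v : Smooth n ℂ) :
    im (conjLap (h : ℂ) (ofReal ψ) v) = conjLap h ψ (im v) := by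
  ext x
  simp only [conjLap, lap, gradMul, d_ofReal, d_im, im_apply, add_apply, sub_apply, neg_apply,
    mul_apply, sum_apply, const_apply, ofReal_apply, Complex.add_im, Complex.sub_im, Complex.neg_im,
    ← Complex.ofReal_pow, ← Complex.ofReal_mul, ← Complex.ofReal_sum, Complex.im_ofReal_mul,
    Complex.im_sum]
  rw [show (2 * (h : ℂ)) = ((2 * h : ℝ) : ℂ) by push_cast; ring, Complex.im_ofReal_mul,
    Complex.im_sum]
  simp only [Complex.im_ofReal_mul]

lemma tsupport_re_subset (v : Smooth n ℂ) : tsupport (re v) ⊆ tsupport v :=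
  closure_mono fun x hx h => hx (by simp [show v x = 0 from h])

lemma tsupport_im_subset (v : Smooth n ℂ) : tsupport (im v) ⊆ tsupport v :=
  closure_mono fun x hx h => hx (by simp [show v x = 0 from h])

lemma memLp {f : Smooth n ℂ} (hf : HasCompactSupport f) : MemLp f 2 volume :=
  f.continuous.memLp_of_hasCompactSupport hf

lemma hasCompactSupport_mul {𝕜 : Type*} [RCLike 𝕜] (f : Smooth n 𝕜) {g : Smooth n 𝕜}
    (hg : HasCompactSupport g) : HasCompactSupport (f * g : Smooth n 𝕜) :=
  HasCompactSupport.mul_left (f := f.1) (f' := g.1) hg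

lemma conjLap_apply {𝕜 : Type*} [RCLike 𝕜] (h : 𝕜) (ψ v : Smooth n 𝕜) (x : Space n) :
    conjLap h ψ v x = -(h ^ 2 * lap v x) - gradMul ψ ψ x * v x + 2 * h * gradMul ψ v x
      + h * lap ψ x * v x := by
  simp only [conjLap, add_apply, sub_apply, neg_apply, mul_apply, const_apply]

lemma gradMul_apply {𝕜 : Type*} [RCLike 𝕜] (f g : Smooth n 𝕜) (x : Space n) :
    gradMul f g x = ∑ j, d j f x * d j g x := by
  simp only [gradMul, sum_apply, mul_apply]

lemma lap_apply {𝕜 : Type*} [RCLike 𝕜] (f : Smooth n 𝕜) (x : Space n) :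
    lap f x = ∑ j, d j (d j f) x := by
  simp only [lap, sum_apply]

lemma conjLap_eq_zero_of_notMem {𝕜 : Type*} [RCLike 𝕜] (h : 𝕜) (ψ v : Smooth n 𝕜) {x : Space n}
    (hx : x ∉ tsupport v) : conjLap h ψ v x = 0 := by
  have hl : lap v x = 0 := by
    rw [lap_apply]
    exact Finset.sum_eq_zero fun j _ =>
      d_eq_zero_of_tsupport_subset j (tsupport_d_subset j v) hx
  have hg : gradMul ψ v x = 0 := by
    rw [gradMul_apply]
    exact Finset.sum_eq_zero fun j _ => by rw [d_eq_zero_of_notMem j v hx, mul_zero]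
  rw [conjLap_apply, hl, hg, image_eq_zero_of_notMem_tsupport hx]
  ring

lemma tsupport_conjLap_subset {𝕜 : Type*} [RCLike 𝕜] (h : 𝕜) (ψ v : Smooth n 𝕜) :
    tsupport (conjLap h ψ v) ⊆ tsupport v :=
  closure_minimal (fun x hx => by
    by_contra hx'
    exact hx (conjLap_eq_zero_of_notMem h ψ v hx')) (isClosed_tsupport _)

lemma integrable_sq {f : Smooth n ℝ} (hf : HasCompactSupport f) :
    Integrable (fun x => f x ^ 2) := integrable (hasCompactSupport_sq hf)

lemma hasCompactSupport_conjLap {𝕜 : Type*} [RCLike 𝕜] (h : 𝕜) (ψ : Smooth n 𝕜) {v : Smooth n 𝕜}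
    (hv : HasCompactSupport v) : HasCompactSupport (conjLap h ψ v) :=
  hv.mono' ((subset_tsupport _).trans (tsupport_conjLap_subset h ψ v))

lemma l2norm_sq_eq_re_add_im {f : Smooth n ℂ} (hf : HasCompactSupport f) :
    l2norm f ^ 2 = (∫ x, re f x ^ 2) + ∫ x, im f x ^ 2 := by
  have h1 : HasCompactSupport (re f) := hf.mono' ((subset_tsupport _).trans (tsupport_re_subset f))
  have h2 : HasCompactSupport (im f) := hf.mono' ((subset_tsupport _).trans (tsupport_im_subset f))
  rw [l2norm_sq (memLp hf), ← integral_add (integrable_sq h1) (integrable_sq h2)]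
  refine integral_congr_ae (Filter.Eventually.of_forall fun x => ?_)
  simp [← Complex.normSq_eq_norm_sq, Complex.normSq_apply]
  ring

/-- The Carleman estimate for complex functions and the conjugated Laplacian. -/
theorem carleman_complex {U : Set (Space n)} (hU : IsCompact (closure U)) {φ r : Smooth n ℝ}
    (hφ : IsCarlemanPair U φ r) :
    ∃ c > 0, ∃ ε₀ > 0, ∀ ε, 0 < ε → ε ≤ ε₀ → ∃ h₀ > 0, ∀ h : ℝ, 0 < h → h ≤ h₀ →
      ∀ v : Smooth n ℂ, HasCompactSupport v → tsupport v ⊆ U →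
        c * (h ^ 2 / ε) * (l2norm v ^ 2 + ∑ j, (h * l2norm (d j v)) ^ 2)
          ≤ l2norm (conjLap (h : ℂ) (ofReal (convexify (h / ε) φ)) v) ^ 2 := by
  obtain ⟨c, hc, ε₀, hε₀, H⟩ := carleman_real hU hφ
  refine ⟨c, hc, ε₀, hε₀, fun ε hε hεle => ?_⟩
  obtain ⟨h₀, hh₀, H⟩ := H ε hε hεle
  refine ⟨h₀, hh₀, fun h hh hhle v hv hvU => ?_⟩
  have hr : HasCompactSupport (re v) := hv.mono' ((subset_tsupport _).trans (tsupport_re_subset v))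
  have hi : HasCompactSupport (im v) := hv.mono' ((subset_tsupport _).trans (tsupport_im_subset v))
  have Hr := H h hh hhle (re v) hr ((tsupport_re_subset v).trans hvU)
  have Hi := H h hh hhle (im v) hi ((tsupport_im_subset v).trans hvU)
  have split : ∀ w : Smooth n ℝ, HasCompactSupport w →
      ∫ x, (w x ^ 2 + ∑ j, (h * d j w x) ^ 2)
        = (∫ x, w x ^ 2) + ∑ j, h ^ 2 * ∫ x, d j w x ^ 2 := by
    intro w hw
    have hi : ∀ j, Integrable (fun x => h ^ 2 * d j w x ^ 2) := fun j =>
      (integrable_sq (hasCompactSupport_d j hw)).const_mul _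
    simp_rw [mul_pow]
    rw [integral_add (integrable_sq hw) (integrable_finsetSum _ fun j _ => hi j),
      integral_finsetSum _ fun j _ => hi j]
    simp_rw [integral_const_mul]
  rw [split _ hr] at Hr
  rw [split _ hi] at Hi
  rw [l2norm_sq_eq_re_add_im (hasCompactSupport_conjLap _ _ hv), re_conjLap, im_conjLap,
    l2norm_sq_eq_re_add_im hv]
  simp_rw [mul_pow, fun j => l2norm_sq_eq_re_add_im (hasCompactSupport_d j hv), ← d_re, ← d_im,
    mul_add, Finset.sum_add_distrib]
  simp only [mul_add] at Hr Hi
  linarith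

end Smooth

end

/-! ### The semiclassical resolvent on Schwartz functions -/

section

open scoped SchwartzMap FourierTransform LineDeriv Laplacian

variable {n : ℕ}

lemma l2norm_fourier (f : 𝓢(Space n, ℂ)) : l2norm (𝓕 f : 𝓢(Space n, ℂ)) = l2norm f := by
  have := SchwartzMap.norm_fourier_toL2_eq f
  rwa [SchwartzMap.norm_toLp, SchwartzMap.norm_toLp] at this

lemma schwartz_memLp (f : 𝓢(Space n, ℂ)) : MemLp f 2 volume := f.memLp 2 volume

/-- A solution of `g - h² Δ g = h ∂_m v` with the natural energy bounds. -/
lemma exists_schwartz_resolvent {h : ℝ} (hh : 0 < h) (v : 𝓢(Space n, ℂ)) (m : Space n)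
    (hm : ‖m‖ = 1) : ∃ g : 𝓢(Space n, ℂ), (g - (h : ℂ) ^ 2 • Δ g = (h : ℂ) • ∂_{m} v) ∧
      l2norm g ≤ l2norm v ∧
      ∀ k : Space n, ‖k‖ = 1 → l2norm ((h : ℂ) • ∂_{k} g : 𝓢(Space n, ℂ)) ≤ l2norm v := by
  -- The symbol of (1 - h²Δ)⁻¹; the factor 2π comes from the normalisation of the Fourier transform.
  set σ : Space n → ℝ := fun ξ => (1 + ‖(2 * Real.pi * h) • ξ‖ ^ 2) ^ (-1 : ℝ) with hσ
  have hσg : σ.HasTemperateGrowth :=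
    (Function.hasTemperateGrowth_one_add_norm_sq_rpow (Space n) (-1)).comp
      ((2 * Real.pi * h) • ContinuousLinearMap.id ℝ (Space n)).hasTemperateGrowth
  set g := SchwartzMap.fourierMultiplierCLM ℂ σ ((h : ℂ) • ∂_{m} v) with hg
  have fd : ∀ (f : 𝓢(Space n, ℂ)) (k ξ : Space n),
      𝓕 (∂_{k} f) ξ = 2 * Real.pi * Complex.I * ((inner ℝ ξ k : ℝ) * 𝓕 f ξ) := by
    intro f k ξ
    rw [SchwartzMap.fourier_lineDerivOp_eq, smul_apply,
      SchwartzMap.smulLeftCLM_apply_apply (by fun_prop)]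
    simp
  have fg : ∀ ξ, 𝓕 g ξ = σ ξ * (h * (2 * Real.pi * Complex.I * ((inner ℝ ξ m : ℝ) * 𝓕 v ξ))) := by
    intro ξ
    rw [hg, SchwartzMap.fourierMultiplierCLM_apply, FourierTransform.fourier_fourierInv_eq,
      SchwartzMap.smulLeftCLM_apply_apply hσg, FourierTransform.fourier_smul,
      smul_apply, fd]
    simp
  have fl : ∀ ξ, 𝓕 (Δ g) ξ = -(2 * Real.pi) ^ 2 * (‖ξ‖ ^ 2 * 𝓕 g ξ) := by
    intro ξ
    rw [SchwartzMap.laplacian_eq_fourierMultiplierCLM, SchwartzMap.fourierMultiplierCLM_apply,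
      FourierTransform.fourier_smul, FourierTransform.fourier_fourierInv_eq,
      smul_apply, SchwartzMap.smulLeftCLM_apply_apply (by fun_prop)]
    simp
  have hσ1 : ∀ ξ, σ ξ * (1 + (2 * Real.pi * h) ^ 2 * ‖ξ‖ ^ 2) = 1 := by
    intro ξ
    have : ‖(2 * Real.pi * h) • ξ‖ ^ 2 = (2 * Real.pi * h) ^ 2 * ‖ξ‖ ^ 2 := by
      rw [norm_smul, mul_pow, Real.norm_eq_abs, sq_abs]
    rw [hσ]
    simp only [this]
    rw [Real.rpow_neg_one, inv_mul_cancel₀]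
    positivity
  have hσ0 : ∀ ξ, 0 ≤ σ ξ := fun ξ => by rw [hσ]; positivity
  have hin : ∀ ξ k : Space n, ‖k‖ = 1 → |inner ℝ ξ k| ≤ ‖ξ‖ := fun ξ k hk => by
    simpa [hk] using abs_real_inner_le_norm ξ k
  refine ⟨g, ?_, ?_, fun k hk => ?_⟩
  · have : 𝓕 (g - (h : ℂ) ^ 2 • Δ g) = 𝓕 ((h : ℂ) • ∂_{m} v) := by
      ext ξ
      rw [show (𝓕 (g - (h : ℂ) ^ 2 • Δ g) : 𝓢(Space n, ℂ)) = 𝓕 g - 𝓕 ((h : ℂ) ^ 2 • Δ g) from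
          map_sub (FourierTransform.fourierCLM ℂ 𝓢(Space n, ℂ)) _ _,
        FourierTransform.fourier_smul, FourierTransform.fourier_smul, sub_apply, smul_apply,
        smul_apply, fl, fg, fd]
      have := congrArg (fun t : ℝ => (t : ℂ)) (hσ1 ξ)
      push_cast at this
      simp only [smul_eq_mul]
      linear_combination (h * (2 * Real.pi * Complex.I * ((inner ℝ ξ m : ℝ) * 𝓕 v ξ))) * this
    rw [← FourierTransform.fourierInv_fourier_eq (F := 𝓢(Space n, ℂ)) (g - (h : ℂ) ^ 2 • Δ g),
      this, FourierTransform.fourierInv_fourier_eq]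
  · rw [← l2norm_fourier g, ← l2norm_fourier v, ← one_mul (l2norm (𝓕 v : 𝓢(Space n, ℂ)))]
    refine l2norm_le_mul (schwartz_memLp _) zero_le_one (Filter.Eventually.of_forall fun ξ => ?_)
    rw [fg, one_mul]
    -- With a = 2πh‖ξ‖ this is a/(1 + a²) ≤ 1, and Plancherel turns it into the L² bound.
    have h1 : σ ξ * (2 * Real.pi * h * |inner ℝ ξ m|) ≤ 1 := by
      rw [← hσ1 ξ]
      refine mul_le_mul_of_nonneg_left ?_ (hσ0 ξ)
      have h2 : 2 * Real.pi * h * |inner ℝ ξ m| ≤ 2 * Real.pi * h * ‖ξ‖ := by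
        have := hin ξ m hm; have := Real.pi_pos; gcongr
      nlinarith [sq_nonneg (2 * Real.pi * h * ‖ξ‖ - 1), sq_nonneg (2 * Real.pi * h * ‖ξ‖)]
    calc _ = σ ξ * (2 * Real.pi * h * |inner ℝ ξ m|) * ‖𝓕 v ξ‖ := by
          simp [abs_of_pos Real.pi_pos, abs_of_pos hh, abs_of_nonneg (hσ0 ξ)]; ring
      _ ≤ 1 * ‖𝓕 v ξ‖ := by gcongr
      _ = _ := one_mul _
  · rw [← l2norm_fourier, ← l2norm_fourier v, ← one_mul (l2norm (𝓕 v : 𝓢(Space n, ℂ)))]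
    refine l2norm_le_mul (schwartz_memLp _) zero_le_one (Filter.Eventually.of_forall fun ξ => ?_)
    rw [FourierTransform.fourier_smul, smul_apply, fd, fg, one_mul]
    -- Now a²/(1 + a²) ≤ 1: the resolvent gains two derivatives, one spent on h∂_m and one on h∂_k.
    have h1 : σ ξ * ((2 * Real.pi * h) ^ 2 * (|inner ℝ ξ k| * |inner ℝ ξ m|)) ≤ 1 := by
      rw [← hσ1 ξ]
      refine mul_le_mul_of_nonneg_left ?_ (hσ0 ξ)
      have h2 : |inner ℝ ξ k| * |inner ℝ ξ m| ≤ ‖ξ‖ ^ 2 := by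
        rw [pow_two]
        exact mul_le_mul (hin ξ k hk) (hin ξ m hm) (abs_nonneg _) (norm_nonneg _)
      have := mul_le_mul_of_nonneg_left h2 (sq_nonneg (2 * Real.pi * h))
      linarith
    calc _ = σ ξ * ((2 * Real.pi * h) ^ 2 * (|inner ℝ ξ k| * |inner ℝ ξ m|)) * ‖𝓕 v ξ‖ := by
          simp [abs_of_pos Real.pi_pos, abs_of_pos hh, abs_of_nonneg (hσ0 ξ)]; ring
      _ ≤ 1 * ‖𝓕 v ξ‖ := by gcongr
      _ = _ := one_mul _

end

/-! ### A parametrix supported in the larger set -/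

section

variable {n : ℕ}

lemma l2norm_const_mul (c : ℂ) (f : Space n → ℂ) : l2norm (fun x => c * f x) = ‖c‖ * l2norm f := by
  have := eLpNorm_const_smul c f 2 volume
  rw [l2norm, show (fun x => c * f x) = c • f from rfl, this, ENNReal.toReal_mul]
  simp [l2norm]

lemma memLp_norm_ofReal {f : Space n → ℂ} (hf : MemLp f 2 volume) :
    MemLp (fun x => ((‖f x‖ : ℝ) : ℂ)) 2 volume :=
  hf.norm.ofReal

lemma l2norm_norm_ofReal (f : Space n → ℂ) : l2norm (fun x => ((‖f x‖ : ℝ) : ℂ)) = l2norm f := by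
  rw [l2norm, l2norm, ← eLpNorm_norm f]
  congr 1
  refine eLpNorm_congr_enorm_ae (Filter.Eventually.of_forall fun x => ?_)
  rw [← ofReal_norm, ← ofReal_norm]; simp

lemma l2norm_le_of_le {f g₀ : Space n → ℂ} {g : Fin n → Space n → ℂ} {M : ℝ} (hM : 0 ≤ M)
    (h₀ : MemLp g₀ 2 volume) (hg : ∀ j, MemLp (g j) 2 volume)
    (h : ∀ᵐ x, ‖f x‖ ≤ M * (‖g₀ x‖ + ∑ j, ‖g j x‖)) :
    l2norm f ≤ M * (l2norm g₀ + ∑ j, l2norm (g j)) := by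
  have hs : MemLp (fun x => ∑ j, ((‖g j x‖ : ℝ) : ℂ)) 2 volume :=
    memLp_finsetSum _ fun j _ => memLp_norm_ofReal (hg j)
  have h1 := l2norm_le_mul (f := f) ((memLp_norm_ofReal h₀).add hs) hM (by
    filter_upwards [h] with x hx
    refine hx.trans (le_of_eq ?_)
    simp only [Pi.add_apply]
    rw [← Complex.ofReal_sum, ← Complex.ofReal_add, Complex.norm_real, Real.norm_of_nonneg]
    positivity)
  refine h1.trans (mul_le_mul_of_nonneg_left ?_ hM)
  refine (l2norm_add_le (memLp_norm_ofReal h₀) hs).trans ?_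
  refine add_le_add (l2norm_norm_ofReal _).le
    ((l2norm_sum_le _ fun j _ => memLp_norm_ofReal (hg j)).trans (le_of_eq ?_))
  simp only [l2norm_norm_ofReal]

namespace Smooth

open scoped SchwartzMap LineDeriv Laplacian

/-- Schwartz functions are smooth. -/
def ofSchwartz (g : 𝓢(Space n, ℂ)) : Smooth n ℂ := ⟨g, g.smooth ⊤⟩

lemma ofSchwartz_apply (g : 𝓢(Space n, ℂ)) (x : Space n) : ofSchwartz g x = g x := rfl

lemma d_ofSchwartz (j : Fin n) (g : 𝓢(Space n, ℂ)) :
    d j (ofSchwartz g) = ofSchwartz (∂_{(EuclideanSpace.single j (1 : ℝ) : Space n)} g) := by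
  ext x
  rw [ofSchwartz_apply, SchwartzMap.lineDerivOp_apply_eq_fderiv]
  rfl

lemma lap_ofSchwartz (g : 𝓢(Space n, ℂ)) : lap (ofSchwartz g) = ofSchwartz (Δ g) := by
  ext x
  rw [lap_apply, SchwartzMap.laplacian_eq_sum (EuclideanSpace.basisFun (Fin n) ℝ), ofSchwartz_apply,
    _root_.sum_apply]
  refine Finset.sum_congr rfl fun j _ => ?_
  rw [d_ofSchwartz, d_ofSchwartz, EuclideanSpace.basisFun_apply, ofSchwartz_apply]

lemma exists_resolvent {h : ℝ} (hh : 0 < h) {v : Smooth n ℂ} (hv : HasCompactSupport v)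
    (j : Fin n) : ∃ g : Smooth n ℂ, MemLp g 2 volume ∧ (∀ k, MemLp (d k g) 2 volume) ∧
      (∀ x, g x - (h : ℂ) ^ 2 * lap g x = h * d j v x) ∧
      l2norm g ≤ l2norm v ∧ ∀ k, h * l2norm (d k g) ≤ l2norm v := by
  have he : ∀ j, ‖(EuclideanSpace.single j (1 : ℝ) : Space n)‖ = 1 := fun j => by simp
  obtain ⟨g, h1, h2, h3⟩ := exists_schwartz_resolvent hh (hv.toSchwartzMap v.contDiff)
    (EuclideanSpace.single j 1) (he j)
  have ev : ofSchwartz (hv.toSchwartzMap v.contDiff) = v := rfl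
  refine ⟨ofSchwartz g, schwartz_memLp g, fun k => ?_, fun x => ?_, h2, fun k => ?_⟩
  · rw [d_ofSchwartz]; exact schwartz_memLp _
  · have := congrArg (fun f : 𝓢(Space n, ℂ) => f x) h1
    simp only [_root_.sub_apply, _root_.smul_apply, smul_eq_mul] at this
    rw [lap_ofSchwartz, ← ev, d_ofSchwartz]
    exact this
  · have := h3 _ (he k)
    rw [d_ofSchwartz]
    refine le_trans (le_of_eq ?_) this
    rw [show (((h : ℂ) • ∂_{(EuclideanSpace.single k (1 : ℝ) : Space n)} g : 𝓢(Space n, ℂ)) : Space n → ℂ)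
      = fun x => (h : ℂ) * (∂_{(EuclideanSpace.single k (1 : ℝ) : Space n)} g) x from rfl,
      l2norm_const_mul, Complex.norm_real, Real.norm_of_nonneg hh.le]
    rfl

lemma lap_mul {𝕜 : Type*} [RCLike 𝕜] (f g : Smooth n 𝕜) (x : Space n) :
    lap (f * g) x = f x * lap g x + 2 * gradMul f g x + g x * lap f x := by
  simp only [lap_apply, gradMul_apply, Finset.mul_sum, ← Finset.sum_add_distrib]
  refine Finset.sum_congr rfl fun j _ => ?_
  simp only [d_mul, map_add, add_apply, mul_apply]
  ring

/-- The quantities bounded are the coefficients of g and of h∂_k g in T(χg) - h∂_j v and in the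
derivatives of χg. They are continuous in (h, κ, x) on the compact set [0,1]² × K, so one constant
serves all h and κ. -/
lemma exists_parametrix_bound {φ₀ φl φω : Space n → ℝ} {φd : Fin n → Space n → ℝ}
    {χ χl : Space n → ℂ} {χd : Fin n → Space n → ℂ} (c1 : Continuous φ₀) (c2 : Continuous φl)
    (c3 : Continuous φω) (c4 : ∀ j, Continuous (φd j)) (c5 : Continuous χ) (c6 : Continuous χl)
    (c7 : ∀ j, Continuous (χd j)) {K : Set (Space n)} (hK : IsCompact K) :
    ∃ M : ℝ, 0 ≤ M ∧ ∀ h ∈ Set.Icc (0 : ℝ) 1, ∀ κ ∈ Set.Icc (0 : ℝ) 1, ∀ x ∈ K,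
      (‖-χ x - h ^ 2 * χl x - (∑ k, (((1 + κ * φ₀ x) * φd k x : ℝ) : ℂ) ^ 2) * χ x
        + 2 * h * (∑ k, (((1 + κ * φ₀ x) * φd k x : ℝ) : ℂ) * χd k x)
        + h * ((φl x + κ * φω x : ℝ) : ℂ) * χ x‖ ≤ M) ∧ (‖χ x‖ ≤ M) ∧ (∀ k, ‖χd k x‖ ≤ M) ∧
      ∀ k, ‖-2 * h * χd k x + 2 * (((1 + κ * φ₀ x) * φd k x : ℝ) : ℂ) * χ x‖ ≤ M := by
  have hc : IsCompact (Set.Icc (0 : ℝ) 1 ×ˢ Set.Icc (0 : ℝ) 1 ×ˢ K) :=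
    isCompact_Icc.prod (isCompact_Icc.prod hK)
  obtain ⟨M₀, hM₀⟩ := hc.exists_bound_of_continuousOn (f := fun p : ℝ × ℝ × Space n =>
    -χ p.2.2 - p.1 ^ 2 * χl p.2.2 - (∑ k, (((1 + p.2.1 * φ₀ p.2.2) * φd k p.2.2 : ℝ) : ℂ) ^ 2) * χ p.2.2
        + 2 * p.1 * (∑ k, (((1 + p.2.1 * φ₀ p.2.2) * φd k p.2.2 : ℝ) : ℂ) * χd k p.2.2)
        + p.1 * ((φl p.2.2 + p.2.1 * φω p.2.2 : ℝ) : ℂ) * χ p.2.2) (by fun_prop)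
  obtain ⟨M₁, hM₁⟩ := hK.exists_bound_of_continuousOn c5.continuousOn
  choose M₂ hM₂ using fun k => hK.exists_bound_of_continuousOn (c7 k).continuousOn
  have : ∀ k, ∃ M, ∀ p ∈ (Set.Icc (0 : ℝ) 1 ×ˢ Set.Icc (0 : ℝ) 1 ×ˢ K),
      ‖-2 * p.1 * χd k p.2.2 + 2 * (((1 + p.2.1 * φ₀ p.2.2) * φd k p.2.2 : ℝ) : ℂ) * χ p.2.2‖ ≤ M :=
    fun k => hc.exists_bound_of_continuousOn (by fun_prop)
  choose M₃ hM₃ using this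
  have s2 : ∀ k, |M₂ k| ≤ ∑ k, |M₂ k| := fun k =>
    Finset.single_le_sum (f := fun k => |M₂ k|) (fun _ _ => abs_nonneg _) (Finset.mem_univ k)
  have s3 : ∀ k, |M₃ k| ≤ ∑ k, |M₃ k| := fun k =>
    Finset.single_le_sum (f := fun k => |M₃ k|) (fun _ _ => abs_nonneg _) (Finset.mem_univ k)
  have p2 : 0 ≤ ∑ k, |M₂ k| := Finset.sum_nonneg fun _ _ => abs_nonneg _
  have p3 : 0 ≤ ∑ k, |M₃ k| := Finset.sum_nonneg fun _ _ => abs_nonneg _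
  refine ⟨|M₀| + |M₁| + ∑ k, |M₂ k| + ∑ k, |M₃ k|, by positivity, fun h hh κ hκ x hx =>
    ⟨?_, ?_, fun k => ?_, fun k => ?_⟩⟩
  · have := hM₀ (h, κ, x) ⟨hh, hκ, hx⟩
    dsimp only at this
    linarith [le_abs_self M₀, abs_nonneg M₁]
  · linarith [hM₁ x hx, le_abs_self M₁, abs_nonneg M₀]
  · linarith [hM₂ k x hx, le_abs_self (M₂ k), s2 k, abs_nonneg M₀, abs_nonneg M₁]
  · have := hM₃ k (h, κ, x) ⟨hh, hκ, hx⟩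
    dsimp only at this
    linarith [le_abs_self (M₃ k), s3 k, abs_nonneg M₀, abs_nonneg M₁]

/-- An approximate inverse of the conjugated Laplacian on derivatives of functions supported in
`Ω`, with values in functions supported in a larger set `U`. -/
lemma exists_parametrix {Ω U : Set (Space n)} (hU : IsCompact (closure U)) (φ : Smooth n ℝ)
    {χ : Smooth n ℂ} (hχ : HasCompactSupport χ) (hχU : tsupport χ ⊆ U) (hχΩ : ∀ x ∈ Ω, χ x = 1) :
    ∃ C : ℝ, 0 ≤ C ∧ ∀ h κ : ℝ, 0 < h → h ≤ 1 → 0 ≤ κ → κ ≤ 1 → ∀ v : Smooth n ℂ,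
      HasCompactSupport v → tsupport v ⊆ Ω → ∀ j, ∃ z : Smooth n ℂ, HasCompactSupport z ∧
        tsupport z ⊆ U ∧ l2norm z ≤ C * l2norm v ∧ (∀ k, h * l2norm (d k z) ≤ C * l2norm v) ∧
        l2norm (fun x => conjLap (h : ℂ) (ofReal (convexify κ φ)) z x - h * d j v x)
          ≤ C * l2norm v := by
  obtain ⟨M, hM0, hM⟩ := exists_parametrix_bound φ.continuous (lap φ).continuous
    (lap (const (1 / 2) * φ * φ)).continuous (fun j => (d j φ).continuous) χ.continuous
    (lap χ).continuous (fun j => (d j χ).continuous) hU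
  refine ⟨M * (1 + n), by positivity, fun h κ hh hh1 hκ hκ1 v hv hvΩ j => ?_⟩
  obtain ⟨g, gm, dgm, hg, g1, g2⟩ := exists_resolvent hh hv j
  have hzU : tsupport (χ * g : Smooth n ℂ) ⊆ tsupport χ :=
    tsupport_mul_subset_left (f := χ.1) (g := g.1)
  have hzc : HasCompactSupport (χ * g : Smooth n ℂ) :=
    hχ.mono' ((subset_tsupport _).trans hzU)
  have hgm : ∀ k, MemLp (fun x => (h : ℂ) * d k g x) 2 volume := fun k => (dgm k).const_mul _
  have nh : ∀ f : Space n → ℂ, l2norm (fun x => (h : ℂ) * f x) = h * l2norm f := fun f => by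
    rw [l2norm_const_mul, Complex.norm_real, Real.norm_of_nonneg hh.le]
  have total : ∀ f : Space n → ℂ,
      (∀ x, ‖f x‖ ≤ M * (‖g x‖ + ∑ k, ‖(h : ℂ) * d k g x‖)) → l2norm f ≤ M * (1 + n) * l2norm v := by
    intro f hf
    refine (l2norm_le_of_le hM0 gm hgm (Filter.Eventually.of_forall hf)).trans ?_
    rw [mul_assoc]
    refine mul_le_mul_of_nonneg_left ?_ hM0
    simp only [nh]
    have : ∑ k, h * l2norm (d k g) ≤ ∑ _k : Fin n, l2norm v := Finset.sum_le_sum fun k _ => g2 k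
    simp only [Finset.sum_const, Finset.card_univ, Fintype.card_fin, nsmul_eq_mul] at this
    linarith
  have hIh : h ∈ Set.Icc (0 : ℝ) 1 := ⟨hh.le, hh1⟩
  have hIκ : κ ∈ Set.Icc (0 : ℝ) 1 := ⟨hκ, hκ1⟩
  have nonneg : ∀ x, 0 ≤ M * (‖g x‖ + ∑ k, ‖(h : ℂ) * d k g x‖) := fun x => by positivity
  have single : ∀ x k, ‖(h : ℂ) * d k g x‖ ≤ ∑ k, ‖(h : ℂ) * d k g x‖ := fun x k =>
    Finset.single_le_sum (f := fun k => ‖(h : ℂ) * d k g x‖) (fun _ _ => norm_nonneg _)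
      (Finset.mem_univ k)
  -- The resolvent g need not have support in U; the cutoff restores this and costs only lower-order
  -- terms.
  refine ⟨χ * g, hzc, hzU.trans hχU, total _ fun x => ?_, fun k => ?_, total _ fun x => ?_⟩
  · by_cases hx : x ∈ U
    · rw [mul_apply, norm_mul]
      have := (hM h hIh κ hIκ x (subset_closure hx)).2.1
      refine mul_le_mul this ?_ (norm_nonneg _) hM0
      linarith [Finset.sum_nonneg fun k (_ : k ∈ Finset.univ) => norm_nonneg ((h : ℂ) * d k g x)]
    · rw [eq_zero_of_tsupport_subset (hzU.trans hχU) hx, norm_zero]; exact nonneg x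
  · rw [← nh]
    refine total _ fun x => ?_
    by_cases hx : x ∈ U
    · have b := hM h hIh κ hIκ x (subset_closure hx)
      rw [d_mul, add_apply, mul_apply, mul_apply, mul_add]
      refine (norm_add_le _ _).trans ?_
      have e1 : ‖(h : ℂ) * (χ x * d k g x)‖ ≤ M * ‖(h : ℂ) * d k g x‖ := by
        rw [mul_left_comm, norm_mul]
        exact mul_le_mul_of_nonneg_right b.2.1 (norm_nonneg _)
      have e2 : ‖(h : ℂ) * (g x * d k χ x)‖ ≤ M * ‖g x‖ := by
        rw [norm_mul, norm_mul, Complex.norm_real, Real.norm_of_nonneg hh.le]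
        have := b.2.2.1 k
        calc h * (‖g x‖ * ‖d k χ x‖) ≤ 1 * (‖g x‖ * M) := by gcongr
          _ = _ := by ring
      have := mul_le_mul_of_nonneg_left (single x k) hM0
      linarith
    · rw [d_eq_zero_of_tsupport_subset k (hzU.trans hχU) hx, mul_zero, norm_zero]; exact nonneg x
  · by_cases hx : x ∈ U
    · have b := hM h hIh κ hIκ x (subset_closure hx)
      have hχv : χ x * d j v x = d j v x := by
        by_cases hxΩ : x ∈ Ω
        · rw [hχΩ x hxΩ, one_mul]
        · rw [d_eq_zero_of_tsupport_subset j hvΩ hxΩ, mul_zero]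
      have hψ : ∀ k, d k (ofReal (convexify κ φ)) x = (((1 + κ * φ x) * d k φ x : ℝ) : ℂ) := by
        intro k
        rw [d_ofReal, d_convexify]; simp
      have hψl : lap (ofReal (convexify κ φ)) x
          = ((lap φ x + κ * lap (const (1 / 2) * φ * φ) x : ℝ) : ℂ) := by
        have : lap (ofReal (convexify κ φ)) = ofReal (lap (convexify κ φ)) := by
          ext y
          rw [ofReal_apply, lap_apply, lap_apply, Complex.ofReal_sum]
          simp only [d_ofReal, ofReal_apply]
        rw [this, lap_convexify]; simp
      -- Subtracting χ(g - h²Δg) = χh∂_j v = h∂_j v cancels the second derivatives of g; only g and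
      -- h∇g remain, with bounded coefficients.
      have key : conjLap (h : ℂ) (ofReal (convexify κ φ)) (χ * g) x - h * d j v x
          = (-χ x - h ^ 2 * lap χ x - (∑ k, (((1 + κ * φ x) * d k φ x : ℝ) : ℂ) ^ 2) * χ x
            + 2 * h * (∑ k, (((1 + κ * φ x) * d k φ x : ℝ) : ℂ) * d k χ x)
            + h * ((lap φ x + κ * lap (const (1 / 2) * φ * φ) x : ℝ) : ℂ) * χ x) * g x
            + ∑ k, (-2 * h * d k χ x + 2 * (((1 + κ * φ x) * d k φ x : ℝ) : ℂ) * χ x)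
              * (h * d k g x) := by
        have s1 : ∑ k, (-2 * h * d k χ x + 2 * (((1 + κ * φ x) * d k φ x : ℝ) : ℂ) * χ x)
              * (h * d k g x) = -2 * h ^ 2 * gradMul χ g x
              + 2 * h * χ x * ∑ k, (((1 + κ * φ x) * d k φ x : ℝ) : ℂ) * d k g x := by
          rw [gradMul_apply, Finset.mul_sum, Finset.mul_sum, ← Finset.sum_add_distrib]
          exact Finset.sum_congr rfl fun k _ => by ring
        have s2 : gradMul (ofReal (convexify κ φ)) (χ * g) x
            = χ x * (∑ k, (((1 + κ * φ x) * d k φ x : ℝ) : ℂ) * d k g x)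
            + g x * ∑ k, (((1 + κ * φ x) * d k φ x : ℝ) : ℂ) * d k χ x := by
          rw [gradMul_apply, Finset.mul_sum, Finset.mul_sum, ← Finset.sum_add_distrib]
          refine Finset.sum_congr rfl fun k _ => ?_
          rw [hψ, d_mul, add_apply, mul_apply, mul_apply]; ring
        have s3 : gradMul (ofReal (convexify κ φ)) (ofReal (convexify κ φ)) x
            = ∑ k, (((1 + κ * φ x) * d k φ x : ℝ) : ℂ) ^ 2 := by
          rw [gradMul_apply]
          exact Finset.sum_congr rfl fun k _ => by rw [hψ, pow_two]
        rw [conjLap_apply, s1, s2, s3, lap_mul, hψl, mul_apply]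
        linear_combination χ x * hg x + h * hχv
      rw [key]
      refine (norm_add_le _ _).trans ?_
      rw [mul_add]
      refine add_le_add ?_ ((norm_sum_le _ _).trans ?_)
      · rw [norm_mul]
        exact mul_le_mul_of_nonneg_right b.1 (norm_nonneg _)
      · rw [Finset.mul_sum]
        refine Finset.sum_le_sum fun k _ => ?_
        rw [norm_mul]
        exact mul_le_mul_of_nonneg_right (b.2.2.2 k) (norm_nonneg _)
    · have hz : x ∉ tsupport (χ * g : Smooth n ℂ) := fun h => hx (hχU (hzU h))
      have hv0 : d j v x = 0 := by
        by_cases hxΩ : x ∈ Ω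
        · exact absurd (hχU (subset_tsupport _ (by rw [Function.mem_support, hχΩ x hxΩ]; simp))) hx
        · exact d_eq_zero_of_tsupport_subset j hvΩ hxΩ
      rw [conjLap_eq_zero_of_notMem _ _ _ hz, hv0, mul_zero, sub_zero, norm_zero]
      exact nonneg x

end Smooth

end

/-! ### First-order perturbations and the negative-order estimate -/

section

variable {n : ℕ}

/-- `b` is measurable and essentially bounded by `M`. -/
structure IsBoundedCoeff (M : ℝ) (b : Space n → ℂ) : Prop where
  meas : AEStronglyMeasurable b volume
  bound : ∀ᵐ x, ‖b x‖ ≤ M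

namespace Smooth

lemma gradMul_add {𝕜 : Type*} [RCLike 𝕜] (ψ f g : Smooth n 𝕜) (x : Space n) :
    gradMul ψ (f + g) x = gradMul ψ f x + gradMul ψ g x := by
  simp only [gradMul_apply, map_add, add_apply, mul_add, Finset.sum_add_distrib]

lemma gradMul_smul {𝕜 : Type*} [RCLike 𝕜] (c : 𝕜) (ψ f : Smooth n 𝕜) (x : Space n) :
    gradMul ψ (c • f) x = c * gradMul ψ f x := by
  simp only [gradMul_apply, map_smul, smul_apply, Finset.mul_sum]
  exact Finset.sum_congr rfl fun j _ => by ring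

lemma lap_add {𝕜 : Type*} [RCLike 𝕜] (f g : Smooth n 𝕜) (x : Space n) :
    lap (f + g) x = lap f x + lap g x := by
  simp only [lap_apply, map_add, add_apply, Finset.sum_add_distrib]

lemma lap_smul {𝕜 : Type*} [RCLike 𝕜] (c : 𝕜) (f : Smooth n 𝕜) (x : Space n) :
    lap (c • f) x = c * lap f x := by
  simp only [lap_apply, map_smul, smul_apply, Finset.mul_sum]

/-- The conjugated Laplacian with a first order perturbation. -/
def perturbed (h : ℝ) (ψ : Smooth n ℝ) (b₀ : Space n → ℂ) (b : Fin n → Space n → ℂ) :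
    Smooth n ℂ →ₗ[ℂ] (Space n → ℂ) where
  toFun y := fun x => conjLap (h : ℂ) (ofReal ψ) y x
    + h * (b₀ x * y x + ∑ j, b j x * (h * d j y x))
  map_add' y z := by
    ext x
    simp only [conjLap_apply, gradMul_add, lap_add, map_add, add_apply, Pi.add_apply, mul_add,
      Finset.sum_add_distrib]
    ring
  map_smul' c y := by
    ext x
    simp only [conjLap_apply, gradMul_smul, lap_smul, map_smul, smul_apply, Pi.smul_apply,
      smul_eq_mul, RingHom.id_apply]
    have : ∑ j, b j x * (h * (c * d j y x)) = c * ∑ j, b j x * (h * d j y x) := by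
      rw [Finset.mul_sum]; exact Finset.sum_congr rfl fun j _ => by ring
    rw [this]; ring

lemma perturbed_apply (h : ℝ) (ψ : Smooth n ℝ) (b₀ : Space n → ℂ) (b : Fin n → Space n → ℂ)
    (y : Smooth n ℂ) (x : Space n) : perturbed h ψ b₀ b y x
      = conjLap (h : ℂ) (ofReal ψ) y x + h * (b₀ x * y x + ∑ j, b j x * (h * d j y x)) := rfl

lemma l2norm_const_mul_ofReal {h : ℝ} (hh : 0 ≤ h) (f : Space n → ℂ) :
    l2norm (fun x => (h : ℂ) * f x) = h * l2norm f := by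
  rw [l2norm_const_mul, Complex.norm_real, Real.norm_of_nonneg hh]

section

variable {h M : ℝ} {b₀ : Space n → ℂ} {b : Fin n → Space n → ℂ}

lemma memLp_firstOrder (hb₀ : IsBoundedCoeff M b₀) (hb : ∀ j, IsBoundedCoeff M (b j))
    {y : Smooth n ℂ} (hy : HasCompactSupport y) :
    MemLp (fun x => (h : ℂ) * (b₀ x * y x + ∑ j, b j x * (h * d j y x))) 2 volume := by
  have aux : ∀ {c : Space n → ℂ} {f : Space n → ℂ}, IsBoundedCoeff M c → MemLp f 2 volume →
      MemLp (fun x => c x * f x) 2 volume := by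
    intro c f hc hf
    refine MemLp.of_le_mul (c := M) hf (hc.meas.mul hf.1) ?_
    filter_upwards [hc.bound] with x hx
    rw [norm_mul]
    exact mul_le_mul_of_nonneg_right hx (norm_nonneg _)
  exact ((aux hb₀ (memLp hy)).add (memLp_finsetSum _ fun j _ =>
    aux (hb j) ((memLp (hasCompactSupport_d j hy)).const_mul _))).const_mul _

/-- The perturbation costs hM times the semiclassical H¹ norm, the same power of h as the Carleman
gain h/√ε; it is the smallness of ε that makes it absorbable. -/
lemma l2norm_firstOrder_le (hh : 0 ≤ h) (hM : 0 ≤ M) (hb₀ : IsBoundedCoeff M b₀)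
    (hb : ∀ j, IsBoundedCoeff M (b j)) {y : Smooth n ℂ} (hy : HasCompactSupport y) :
    l2norm (fun x => (h : ℂ) * (b₀ x * y x + ∑ j, b j x * (h * d j y x)))
      ≤ h * (M * (l2norm y + ∑ j, h * l2norm (d j y))) := by
  rw [l2norm_const_mul_ofReal hh]
  refine mul_le_mul_of_nonneg_left ?_ hh
  have := l2norm_le_of_le (f := fun x => b₀ x * y x + ∑ j, b j x * (h * d j y x)) (g₀ := y)
    (g := fun j x => h * d j y x) hM (memLp hy)
    (fun j => (memLp (hasCompactSupport_d j hy)).const_mul _) (by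
      filter_upwards [hb₀.bound, ae_all_iff.2 fun j => (hb j).bound] with x h0 h1
      refine (norm_add_le _ _).trans ?_
      rw [mul_add]
      refine add_le_add ?_ ((norm_sum_le _ _).trans ?_)
      · rw [norm_mul]; exact mul_le_mul_of_nonneg_right h0 (norm_nonneg _)
      · rw [Finset.mul_sum]
        refine Finset.sum_le_sum fun j _ => ?_
        rw [norm_mul]; exact mul_le_mul_of_nonneg_right (h1 j) (norm_nonneg _))
  simpa only [l2norm_const_mul_ofReal hh] using this

lemma memLp_perturbed (ψ : Smooth n ℝ) (hb₀ : IsBoundedCoeff M b₀)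
    (hb : ∀ j, IsBoundedCoeff M (b j)) {y : Smooth n ℂ} (hy : HasCompactSupport y) :
    MemLp (perturbed h ψ b₀ b y) 2 volume :=
  (memLp (hasCompactSupport_conjLap _ _ hy)).add (memLp_firstOrder hb₀ hb hy)

end

lemma sq_add_sum_le (a : ℝ) (f : Fin n → ℝ) :
    (a + ∑ j, f j) ^ 2 ≤ (n + 1) * (a ^ 2 + ∑ j, f j ^ 2) := by
  have := sq_sum_le_card_mul_sum_sq (s := (Finset.univ : Finset (Option (Fin n))))
    (f := fun o => o.elim a f)
  simpa [Fintype.sum_option] using this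

/-- The Carleman estimate with a first order perturbation. -/
theorem carleman_perturbed {U : Set (Space n)} (hU : IsCompact (closure U)) {φ r : Smooth n ℝ}
    (hφ : IsCarlemanPair U φ r) {M : ℝ} (hM : 0 ≤ M) :
    ∃ ε > 0, ∃ h₀ > 0, ∀ h : ℝ, 0 < h → h ≤ h₀ → ∀ (b₀ : Space n → ℂ) (b : Fin n → Space n → ℂ),
      IsBoundedCoeff M b₀ → (∀ j, IsBoundedCoeff M (b j)) →
      ∀ y : Smooth n ℂ, HasCompactSupport y → tsupport y ⊆ U →
        h * (l2norm y + ∑ j, h * l2norm (d j y))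
          ≤ l2norm (perturbed h (convexify (h / ε) φ) b₀ b y) := by
  obtain ⟨c, hc, ε₀, hε₀, H⟩ := carleman_complex hU hφ
  -- With this ε the unperturbed estimate has constant M + 1: M absorbs the perturbation and 1 is
  -- left over. The factor n + 1 is Cauchy-Schwarz for the n + 1 terms of the H¹ norm.
  set ε := min ε₀ (c / ((n + 1) * (M + 1) ^ 2)) with hεdef
  have hε : 0 < ε := lt_min hε₀ (by positivity)
  have hεc : (n + 1) * (M + 1) ^ 2 * ε ≤ c := by
    have := (le_div_iff₀ (by positivity)).1 (min_le_right ε₀ (c / ((n + 1) * (M + 1) ^ 2)))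
    linarith
  obtain ⟨h₀, hh₀, H⟩ := H ε hε (min_le_left _ _)
  refine ⟨ε, hε, h₀, hh₀, fun h hh hhle b₀ b hb₀ hb y hy hyU => ?_⟩
  have H := H h hh hhle y hy hyU
  set Y := l2norm y + ∑ j, h * l2norm (d j y) with hY
  have hY0 : 0 ≤ Y := add_nonneg (l2norm_nonneg _)
    (Finset.sum_nonneg fun j _ => mul_nonneg hh.le (l2norm_nonneg _))
  have h1 : (h * (M + 1) * Y) ^ 2
      ≤ l2norm (conjLap (h : ℂ) (ofReal (convexify (h / ε) φ)) y) ^ 2 := by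
    refine le_trans ?_ H
    have h2 := sq_add_sum_le (l2norm y) fun j => h * l2norm (d j y)
    rw [← hY] at h2
    calc (h * (M + 1) * Y) ^ 2 = h ^ 2 * (M + 1) ^ 2 * Y ^ 2 := by ring
      _ ≤ h ^ 2 * (M + 1) ^ 2 * ((n + 1) * (l2norm y ^ 2 + ∑ j, (h * l2norm (d j y)) ^ 2)) := by
        gcongr
      _ = ((n + 1) * (M + 1) ^ 2 * ε) * (h ^ 2 / ε)
          * (l2norm y ^ 2 + ∑ j, (h * l2norm (d j y)) ^ 2) := by field_simp
      _ ≤ _ := by gcongr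
  have h3 : h * (M + 1) * Y ≤ l2norm (conjLap (h : ℂ) (ofReal (convexify (h / ε) φ)) y) :=
    le_of_sq_le_sq h1 (l2norm_nonneg _)
  have h4 : l2norm (conjLap (h : ℂ) (ofReal (convexify (h / ε) φ)) y)
      ≤ l2norm (perturbed h (convexify (h / ε) φ) b₀ b y) + h * (M * Y) := by
    have e : ∀ x, conjLap (h : ℂ) (ofReal (convexify (h / ε) φ)) y x
        = perturbed h (convexify (h / ε) φ) b₀ b y x
          - (h : ℂ) * (b₀ x * y x + ∑ j, b j x * (h * d j y x)) := fun x => by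
      rw [perturbed_apply]; ring
    rw [l2norm_congr e]
    exact (l2norm_sub_le (memLp_perturbed _ hb₀ hb hy) (memLp_firstOrder hb₀ hb hy)).trans
      (add_le_add_right (l2norm_firstOrder_le hh.le hM hb₀ hb hy) _)
  linarith

lemma hasCompactSupport_sum {ι : Type*} (s : Finset ι) {f : ι → Smooth n ℂ}
    (hf : ∀ i ∈ s, HasCompactSupport (f i)) {U : Set (Space n)} (hU : ∀ i ∈ s, tsupport (f i) ⊆ U) :
    HasCompactSupport (∑ i ∈ s, f i : Smooth n ℂ) ∧ tsupport (∑ i ∈ s, f i : Smooth n ℂ) ⊆ U := by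
  classical
  induction s using Finset.induction_on with
  | empty =>
    have : ((∑ i ∈ (∅ : Finset ι), f i : Smooth n ℂ) : Space n → ℂ) = fun _ => 0 := by
      ext x; simp
    rw [this]
    exact ⟨HasCompactSupport.zero, by simp [tsupport]⟩
  | insert a s ha ih =>
    have h1 := ih (fun i hi => hf i (Finset.mem_insert_of_mem hi))
      fun i hi => hU i (Finset.mem_insert_of_mem hi)
    rw [Finset.sum_insert ha]
    refine ⟨HasCompactSupport.add (f := (f a).1) (hf a (Finset.mem_insert_self _ _)) h1.1, ?_⟩
    exact (tsupport_add (f a).1 _).trans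
      (Set.union_subset (hU a (Finset.mem_insert_self _ _)) h1.2)

lemma hasCompactSupport_add' {f g : Smooth n ℂ} (hf : HasCompactSupport f)
    (hg : HasCompactSupport g) {U : Set (Space n)} (hfU : tsupport f ⊆ U) (hgU : tsupport g ⊆ U) :
    HasCompactSupport (f + g : Smooth n ℂ) ∧ tsupport (f + g : Smooth n ℂ) ⊆ U :=
  ⟨HasCompactSupport.add (f := f.1) hf hg,
    (tsupport_add f.1 g.1).trans (Set.union_subset hfU hgU)⟩

set_option maxHeartbeats 400000 in
/-- The Carleman estimate in a negative order Sobolev norm. -/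
theorem carleman_negative {Ω U : Set (Space n)} (hU : IsCompact (closure U)) {φ r : Smooth n ℝ}
    (hφ : IsCarlemanPair U φ r) {χ : Smooth n ℂ} (hχ : HasCompactSupport χ) (hχU : tsupport χ ⊆ U)
    (hχΩ : ∀ x ∈ Ω, χ x = 1) {M : ℝ} (hM : 0 ≤ M) :
    ∃ ε > 0, ∃ h₀ > 0, h₀ ≤ 1 ∧ h₀ ≤ ε ∧ ∃ C > 0, ∀ h : ℝ, 0 < h → h ≤ h₀ →
      ∀ (b₀ : Space n → ℂ) (b : Fin n → Space n → ℂ),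
      IsBoundedCoeff M b₀ → (∀ j, IsBoundedCoeff M (b j)) →
      ∀ y : Smooth n ℂ, HasCompactSupport y → tsupport y ⊆ U →
      ∀ v : Fin n → Smooth n ℂ, (∀ j, HasCompactSupport (v j)) → (∀ j, tsupport (v j) ⊆ Ω) →
        h * l2norm y ≤ C * (l2norm (fun x => perturbed h (convexify (h / ε) φ) b₀ b y x
          + ∑ j, h * d j (v j) x) + ∑ j, l2norm (v j)) := by
  obtain ⟨ε, hε, h₁, hh₁, H⟩ := carleman_perturbed hU hφ hM
  obtain ⟨C, hC, Z⟩ := exists_parametrix hU φ hχ hχU hχΩ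
  refine ⟨ε, hε, min h₁ (min 1 ε), by positivity, (min_le_right _ _).trans (min_le_left _ _),
    -- The remainders of the parametrix contribute C + M(1 + n)C and the norm of the correction,
    -- using h ≤ 1, another C.
    (min_le_right _ _).trans (min_le_right _ _), 1 + C * (2 + M * (1 + n)), by positivity,
    fun h hh hhle b₀ b hb₀ hb y hy hyU v hv hvΩ => ?_⟩
  have hh1 : h ≤ 1 := hhle.trans ((min_le_right _ _).trans (min_le_left _ _))
  have hhε : h ≤ ε := hhle.trans ((min_le_right _ _).trans (min_le_right _ _))
  choose z zc zU z0 z1 z2 using fun j => Z h (h / ε) hh hh1 (by positivity)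
    ((div_le_one hε).2 hhε) (v j) (hv j) (hvΩ j) j
  have hs := hasCompactSupport_sum Finset.univ (fun j _ => zc j) (fun j _ => zU j)
  obtain ⟨zs, hzs⟩ : ∃ zs, zs = ∑ j, z j := ⟨_, rfl⟩
  rw [← hzs] at hs
  have hy' := hasCompactSupport_add' hy hs.1 hyU hs.2
  have H' := H h hh (hhle.trans (min_le_left _ _)) b₀ b hb₀ hb (y + zs) hy'.1 hy'.2
  set T := perturbed h (convexify (h / ε) φ) b₀ b with hT
  have mT : ∀ {f : Smooth n ℂ}, HasCompactSupport f → MemLp (T f) 2 volume := fun hf =>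
    memLp_perturbed _ hb₀ hb hf
  have md : ∀ j, MemLp (fun x => (h : ℂ) * d j (v j) x) 2 volume := fun j =>
    (memLp (hasCompactSupport_d j (hv j))).const_mul _
  -- The correction creates the divergence up to the parametrix error, so the Carleman estimate for
  -- the test function y + zs sees Ty + h div v.
  have e1 : ∀ x, T (y + zs) x = (T y x + ∑ j, h * d j (v j) x)
      + ∑ j, (T (z j) x - h * d j (v j) x) := by
    intro x
    rw [hzs, map_add, map_sum, Pi.add_apply, Finset.sum_apply, Finset.sum_sub_distrib]
    ring
  have e2 : ∀ j, l2norm (fun x => T (z j) x - h * d j (v j) x)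
      ≤ (C + M * (1 + n) * C) * l2norm (v j) := by
    intro j
    have e : ∀ x, T (z j) x - h * d j (v j) x
        = (conjLap (h : ℂ) (ofReal (convexify (h / ε) φ)) (z j) x - h * d j (v j) x)
          + (h : ℂ) * (b₀ x * z j x + ∑ k, b k x * (h * d k (z j) x)) := fun x => by
      rw [hT, perturbed_apply]; ring
    rw [l2norm_congr e]
    refine (l2norm_add_le (f := fun x => conjLap (h : ℂ) (ofReal (convexify (h / ε) φ)) (z j) x
      - h * d j (v j) x) ((memLp (hasCompactSupport_conjLap _ _ (zc j))).sub (md j))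
      (memLp_firstOrder hb₀ hb (zc j))).trans ?_
    have t1 := l2norm_firstOrder_le hh.le hM hb₀ hb (zc j)
    have t2 : l2norm (z j) + ∑ k, h * l2norm (d k (z j)) ≤ (1 + n) * (C * l2norm (v j)) := by
      have : ∑ k, h * l2norm (d k (z j)) ≤ ∑ _k : Fin n, C * l2norm (v j) :=
        Finset.sum_le_sum fun k _ => z1 j k
      simp only [Finset.sum_const, Finset.card_univ, Fintype.card_fin, nsmul_eq_mul] at this
      linarith [z0 j]
    have t0 : 0 ≤ l2norm (z j) + ∑ k, h * l2norm (d k (z j)) := add_nonneg (l2norm_nonneg _)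
      (Finset.sum_nonneg fun j _ => mul_nonneg hh.le (l2norm_nonneg _))
    have t3 : h * (M * (l2norm (z j) + ∑ k, h * l2norm (d k (z j))))
        ≤ 1 * (M * ((1 + n) * (C * l2norm (v j)))) := by gcongr
    linarith [z2 j]
  have e3 : l2norm (T (y + zs)) ≤ l2norm (fun x => T y x + ∑ j, h * d j (v j) x)
      + ∑ j, (C + M * (1 + n) * C) * l2norm (v j) := by
    rw [l2norm_congr e1]
    refine (l2norm_add_le (f := fun x => T y x + ∑ j, h * d j (v j) x) ((mT hy).add (memLp_finsetSum _ fun j _ => md j))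
      (memLp_finsetSum _ fun j _ => (mT (zc j)).sub (md j))).trans (add_le_add_right ?_ _)
    exact (l2norm_sum_le _ fun j _ => (mT (zc j)).sub (md j)).trans
      (Finset.sum_le_sum fun j _ => e2 j)
  have e4 : l2norm y ≤ l2norm (y + zs : Smooth n ℂ) + ∑ j, C * l2norm (v j) := by
    have : ∀ x, y x = (y + zs : Smooth n ℂ) x - zs x := fun x => by rw [add_apply, add_sub_cancel_right]
    rw [l2norm_congr this]
    refine (l2norm_sub_le (memLp hy'.1) (memLp hs.1)).trans (add_le_add_right ?_ _)
    have e : ∀ x, zs x = ∑ j, z j x := fun x => by rw [hzs, sum_apply]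
    rw [l2norm_congr e]
    exact (l2norm_sum_le _ fun j _ => memLp (zc j)).trans (Finset.sum_le_sum fun j _ => z0 j)
  have e5 : h * l2norm (y + zs : Smooth n ℂ) ≤ l2norm (T (y + zs)) := by
    refine le_trans (mul_le_mul_of_nonneg_left ?_ hh.le) H'
    exact le_add_of_nonneg_right
      (Finset.sum_nonneg fun j _ => mul_nonneg hh.le (l2norm_nonneg _))
  rw [← Finset.mul_sum] at e3 e4
  set V := ∑ j, l2norm (v j) with hV
  have hV0 : 0 ≤ V := Finset.sum_nonneg fun j _ => l2norm_nonneg _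
  set E := l2norm (fun x => T y x + ∑ j, h * d j (v j) x)
  have hE0 : 0 ≤ E := l2norm_nonneg _
  clear_value V E
  have e6 : h * (C * V) ≤ C * V := mul_le_of_le_one_left (mul_nonneg hC hV0) hh1
  have e7 : h * l2norm y ≤ h * l2norm (y + zs : Smooth n ℂ) + h * (C * V) := by
    rw [← mul_add]; exact mul_le_mul_of_nonneg_left e4 hh.le
  have e8 : 0 ≤ C * (2 + M * (1 + n)) * E := by positivity
  calc h * l2norm y ≤ E + (C + M * (1 + n) * C) * V + C * V := by linarith
    _ ≤ (1 + C * (2 + M * (1 + n))) * (E + V) := by linarith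

end Smooth

end

/-! ### Duality: from the a priori estimate to weak solutions -/

section

open scoped InnerProductSpace ComplexConjugate

/-- A functional controlled by `‖L v‖` is represented by a vector, by Hahn-Banach and Riesz. -/
lemma exists_inner_eq_of_norm_le {V H : Type*} [AddCommGroup V] [Module ℂ V]
    [NormedAddCommGroup H] [InnerProductSpace ℂ H] [CompleteSpace H] (L : V →ₗ[ℂ] H)
    (l : V →ₗ[ℂ] ℂ) {c : ℝ} (hc : 0 ≤ c) (hl : ∀ v, ‖l v‖ ≤ c * ‖L v‖) :
    ∃ X : H, ‖X‖ ≤ c ∧ ∀ v, ⟪X, L v⟫_ℂ = l v := by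
  -- The bound forces the functional to vanish where L does, so it descends to the range of L and
  -- can be extended with the same norm bound.
  have hker : LinearMap.ker L ≤ LinearMap.ker l := fun v hv => by
    have := hl v
    rw [LinearMap.mem_ker.1 hv, norm_zero, mul_zero] at this
    exact LinearMap.mem_ker.2 (norm_le_zero_iff.1 this)
  set f : LinearMap.range L →ₗ[ℂ] ℂ :=
    ((LinearMap.ker L).liftQ l hker).comp L.quotKerEquivRange.symm.toLinearMap with hf
  have hfL : ∀ v, f ⟨L v, LinearMap.mem_range_self L v⟩ = l v := fun v => by
    have : L.quotKerEquivRange.symm ⟨L v, LinearMap.mem_range_self L v⟩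
        = (LinearMap.ker L).mkQ v := L.quotKerEquivRange_symm_apply_image v _
    simp only [hf, LinearMap.comp_apply, LinearEquiv.coe_coe, this]
    simp
  have hbound : ∀ x, ‖f x‖ ≤ c * ‖x‖ := by
    rintro ⟨_, v, rfl⟩
    rw [hfL]; exact hl v
  obtain ⟨g, hg, hgn⟩ := exists_extension_norm_eq (LinearMap.range L) (f.mkContinuous c hbound)
  refine ⟨(InnerProductSpace.toDual ℂ H).symm g, ?_, fun v => ?_⟩
  · rw [LinearIsometryEquiv.norm_map, hgn]
    exact LinearMap.mkContinuous_norm_le _ hc _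
  · rw [InnerProductSpace.toDual_symm_apply, ← hfL v]
    exact hg ⟨L v, LinearMap.mem_range_self L v⟩

variable {n : ℕ}

namespace Smooth

/-- The space of smooth functions with compact support in `U`. -/
def testSpace (U : Set (Space n)) : Submodule ℂ (Smooth n ℂ) where
  carrier := {f | HasCompactSupport f ∧ tsupport f ⊆ U}
  zero_mem' := by
    have : ((0 : Smooth n ℂ) : Space n → ℂ) = fun _ => 0 := rfl
    exact ⟨by rw [this]; exact HasCompactSupport.zero, by rw [this]; simp [tsupport]⟩
  add_mem' hf hg := hasCompactSupport_add' hf.1 hg.1 hf.2 hg.2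
  smul_mem' c f hf := by
    have : tsupport (c • f : Smooth n ℂ) ⊆ tsupport f := closure_mono fun x hx h0 => hx (by
      rw [smul_apply, show f x = 0 from h0, mul_zero])
    exact ⟨hf.1.mono' ((subset_tsupport _).trans this), this.trans hf.2⟩

end Smooth

/-- A linear family of square integrable functions, as a linear map into `L²`. -/
def linearToLp {V : Type*} [AddCommGroup V] [Module ℂ V] (F : V →ₗ[ℂ] (Space n → ℂ))
    (hF : ∀ v, MemLp (F v) 2 volume) : V →ₗ[ℂ] Lp (α := Space n) ℂ 2 volume where
  toFun v := (hF v).toLp (F v)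
  map_add' v w := by
    rw [← MemLp.toLp_add]
    exact MemLp.toLp_congr _ _ (by rw [map_add])
  map_smul' c v := by
    rw [RingHom.id_apply, ← MemLp.toLp_const_smul]
    exact MemLp.toLp_congr _ _ (by rw [map_smul])

lemma inner_toLp (X : Lp (α := Space n) ℂ 2 volume) {f : Space n → ℂ} (hf : MemLp f 2 volume) :
    ⟪X, hf.toLp f⟫_ℂ = ∫ x, conj (X x) * f x := by
  rw [L2.inner_def]
  refine integral_congr_ae ?_
  filter_upwards [hf.coeFn_toLp] with x hx
  rw [hx, RCLike.inner_apply, mul_comm]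

lemma memLp_conj {f : Space n → ℂ} (hf : MemLp f 2 volume) :
    MemLp (fun x => conj (f x)) 2 volume := hf.star

lemma l2norm_conj (f : Space n → ℂ) : l2norm (fun x => conj (f x)) = l2norm f := by
  rw [l2norm, l2norm]
  congr 1
  refine eLpNorm_congr_enorm_ae (Filter.Eventually.of_forall fun x => ?_)
  rw [← ofReal_norm, ← ofReal_norm, RCLike.norm_conj]

lemma norm_integral_mul_le {w y : Space n → ℂ} (hw : MemLp w 2 volume) (hy : MemLp y 2 volume) :
    ‖∫ x, w x * y x‖ ≤ l2norm w * l2norm y := by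
  have hcw := memLp_conj hw
  have : ∫ x, w x * y x = ⟪hcw.toLp _, hy.toLp y⟫_ℂ := by
    rw [inner_toLp]
    refine integral_congr_ae ?_
    filter_upwards [hcw.coeFn_toLp] with x hx
    rw [hx, Complex.conj_conj]
  rw [this]
  refine (norm_inner_le_norm _ _).trans (le_of_eq ?_)
  rw [← l2norm_eq_norm_toLp, ← l2norm_eq_norm_toLp, l2norm_conj]

lemma integrable_mul {w y : Space n → ℂ} (hw : MemLp w 2 volume) (hy : MemLp y 2 volume) :
    Integrable (fun x => w x * y x) := hw.integrable_mul hy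

/-- Pairs of a test function in `U` and a vector valued test function in `Ω`. -/
abbrev TestPair (U Ω : Set (Space n)) : Type :=
  Smooth.testSpace U × (Fin n → Smooth.testSpace Ω)

/-- The map `(y, v) ↦ (T y + h div v, v)`. -/
def pairing {U Ω : Set (Space n)} (h : ℝ) (T : Smooth n ℂ →ₗ[ℂ] (Space n → ℂ)) :
    Option (Fin n) → TestPair U Ω →ₗ[ℂ] (Space n → ℂ)
  | none =>
    { toFun := fun p x => T p.1 x + ∑ j, h * Smooth.d j (p.2 j).1 x
      map_add' := fun p q => by
        ext x
        simp only [Prod.fst_add, Prod.snd_add, Pi.add_apply, Submodule.coe_add, map_add,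
          Smooth.add_apply, mul_add, Finset.sum_add_distrib]
        ring
      map_smul' := fun c p => by
        ext x
        simp only [Prod.smul_fst, Prod.smul_snd, Pi.smul_apply, Submodule.coe_smul, map_smul,
          Smooth.smul_apply, smul_eq_mul, RingHom.id_apply, mul_add, Finset.mul_sum]
        exact congrArg _ (Finset.sum_congr rfl fun j _ => by ring) }
  | some j =>
    { toFun := fun p x => (p.2 j).1 x
      map_add' := fun p q => rfl
      map_smul' := fun c p => rfl }

/-- Duality: an a priori estimate in a negative order norm gives a weak solution in `H¹`. -/
lemma exists_weak_solution {U Ω : Set (Space n)} {h C : ℝ} (hh : 0 < h) (hC : 0 ≤ C)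
    (T : Smooth n ℂ →ₗ[ℂ] (Space n → ℂ))
    (hT : ∀ y ∈ Smooth.testSpace U, MemLp (T y) 2 volume)
    (H : ∀ y ∈ Smooth.testSpace U, ∀ v : Fin n → Smooth n ℂ, (∀ j, v j ∈ Smooth.testSpace Ω) →
      h * l2norm y ≤ C * (l2norm (fun x => T y x + ∑ j, h * Smooth.d j (v j) x)
        + ∑ j, l2norm (v j)))
    {w : Space n → ℂ} (hw : MemLp w 2 volume) :
    ∃ (u : Space n → ℂ) (g : Fin n → Space n → ℂ), MemLp u 2 volume ∧
      (∀ j, MemLp (g j) 2 volume) ∧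
      (∀ y ∈ Smooth.testSpace U, ∫ x, u x * T y x = ∫ x, w x * y x) ∧
      (∀ j, ∀ v ∈ Smooth.testSpace Ω,
        ∫ x, u x * (h * Smooth.d j v x) = -∫ x, g j x * v x) ∧
      h * l2norm u ≤ C * (n + 1) * l2norm w ∧ ∀ j, h * l2norm (g j) ≤ C * (n + 1) * l2norm w := by
  let F := pairing (U := U) (Ω := Ω) h T
  have hd : ∀ (p : TestPair U Ω) j, MemLp (fun x => (h : ℂ) * Smooth.d j (p.2 j).1 x) 2 volume := fun p j =>
    (Smooth.memLp (Smooth.hasCompactSupport_d j (p.2 j).2.1)).const_mul _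
  have hF : ∀ o p, MemLp (F o p) 2 volume := by
    rintro (_ | j) p
    · exact (hT _ p.1.2).add (memLp_finsetSum _ fun j _ => hd p j)
    · exact Smooth.memLp (p.2 j).2.1
  -- The target is (L²)^{n+1}: index `none` carries Ty + h div v, index `some j` carries v_j.
  let L : TestPair U Ω →ₗ[ℂ] PiLp 2 (fun _ : Option (Fin n) => Lp (α := Space n) ℂ 2 volume) :=
    (WithLp.linearEquiv 2 ℂ _).symm.toLinearMap.comp
      (LinearMap.pi fun o => linearToLp (V := TestPair U Ω) (F o) (hF o))
  have hL : ∀ p o, L p o = (hF o p).toLp (F o p) := fun p o => rfl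
  let l : TestPair U Ω →ₗ[ℂ] ℂ :=
    { toFun := fun p => ∫ x, w x * p.1.1 x
      map_add' := fun p q => by
        rw [← integral_add (integrable_mul hw (Smooth.memLp p.1.2.1))
          (integrable_mul hw (Smooth.memLp q.1.2.1))]
        simp only [Prod.fst_add, Submodule.coe_add, Smooth.add_apply, mul_add]
      map_smul' := fun c p => by
        rw [RingHom.id_apply, smul_eq_mul, ← integral_const_mul]
        simp only [Prod.smul_fst, Submodule.coe_smul, Smooth.smul_apply, mul_left_comm] }
  have hnorm : ∀ p o, l2norm (F o p) ≤ ‖L p‖ := fun p o => by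
    rw [l2norm_eq_norm_toLp (hF o p), ← hL]
    exact PiLp.norm_apply_le (L p) o
  have hl : ∀ p, ‖l p‖ ≤ (C * (n + 1) * l2norm w / h) * ‖L p‖ := by
    intro p
    have h1 := norm_integral_mul_le hw (Smooth.memLp p.1.2.1)
    have h2 := H p.1.1 p.1.2 (fun j => (p.2 j).1) fun j => (p.2 j).2
    have h3 : l2norm (fun x => T p.1 x + ∑ j, h * Smooth.d j (p.2 j).1 x)
        + ∑ j, l2norm (p.2 j).1 ≤ (n + 1) * ‖L p‖ := by
      have : ∑ j, l2norm (p.2 j).1 ≤ ∑ _j : Fin n, ‖L p‖ :=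
        Finset.sum_le_sum fun j _ => hnorm p (some j)
      simp only [Finset.sum_const, Finset.card_univ, Fintype.card_fin, nsmul_eq_mul] at this
      have h0 := hnorm p none
      have h0' : l2norm (fun x => T p.1 x + ∑ j, h * Smooth.d j (p.2 j).1 x) ≤ ‖L p‖ := h0
      linarith
    have h4 : h * l2norm p.1.1 ≤ C * ((n + 1) * ‖L p‖) := h2.trans (by gcongr)
    have h5 : l2norm p.1.1 ≤ C * ((n + 1) * ‖L p‖) / h := by
      rw [le_div_iff₀ hh]; linarith
    calc ‖l p‖ ≤ l2norm w * l2norm p.1.1 := h1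
      _ ≤ l2norm w * (C * ((n + 1) * ‖L p‖) / h) := by
        gcongr
        exact l2norm_nonneg _
      _ = _ := by ring
  have hc0 : 0 ≤ C * (n + 1) * l2norm w / h := by
    have := l2norm_nonneg w
    positivity
  obtain ⟨X, hX, hXl⟩ := exists_inner_eq_of_norm_le (V := TestPair U Ω) L l hc0 hl
  have hin : ∀ p : TestPair U Ω, (∫ x, conj (X none x) * (T p.1 x + ∑ j, h * Smooth.d j (p.2 j).1 x))
      + ∑ j, ∫ x, conj (X (some j) x) * (p.2 j).1 x = ∫ x, w x * p.1.1 x := by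
    intro p
    have := hXl p
    rw [PiLp.inner_apply, Fintype.sum_option] at this
    simp only [hL, inner_toLp] at this
    exact this
  have hXn : ∀ o, h * l2norm (fun x => conj (X o x)) ≤ C * (n + 1) * l2norm w := by
    intro o
    have e : l2norm (fun x => conj (X o x)) = ‖X o‖ := by rw [l2norm_conj]; rfl
    have := (le_div_iff₀ hh).1 ((PiLp.norm_apply_le X o).trans hX)
    rw [e]; linarith
  -- Conjugates appear because the inner product is conjugate-linear in its first argument while the
  -- weak formulation is bilinear.
  refine ⟨fun x => conj (X none x), fun j x => conj (X (some j) x), memLp_conj (Lp.memLp _),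
    fun j => memLp_conj (Lp.memLp _), fun y hy => ?_, fun j v hv => ?_, hXn none,
    fun j => hXn (some j)⟩
  · have := hin (⟨y, hy⟩, 0)
    simpa using this
  -- Pairs with y = 0 have right-hand side zero, which says that the j-th component is h∂_j u
  -- weakly; pairs with v = 0 gave the equation.
  · have := hin (0, Pi.single j ⟨v, hv⟩)
    have e1 : ∀ x, ∑ k, h * Smooth.d k ((Pi.single j ⟨v, hv⟩ : Fin n → Smooth.testSpace Ω) k).1 x
        = h * Smooth.d j v x := fun x => by
      rw [Finset.sum_eq_single j]
      · simp
      · intro k _ hk; rw [Pi.single_eq_of_ne hk]; simp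
      · simp
    have e2 : ∑ k, ∫ x, conj (X (some k) x)
        * ((Pi.single j ⟨v, hv⟩ : Fin n → Smooth.testSpace Ω) k).1 x
        = ∫ x, conj (X (some j) x) * v x := by
      rw [Finset.sum_eq_single j]
      · simp
      · intro k _ hk; rw [Pi.single_eq_of_ne hk]; simp
      · simp
    rw [e2] at this
    simp only [e1] at this
    refine eq_neg_of_add_eq_zero_left ?_
    simpa using this

end

/-! ### Limiting Carleman weights in coordinates -/

section

variable {n : ℕ}

lemma gradient_coord (f : Space n → ℝ) (x : Space n) (j : Fin n) :
    (∇ f x) j = fderiv ℝ f x (EuclideanSpace.single j (1 : ℝ)) := by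
  rw [← inner_gradient_left (𝕜 := ℝ), PiLp.inner_apply]
  simp [Finset.sum_ite_eq', PiLp.single_apply]

lemma inner_eq_sum (u v : Space n) : inner ℝ u v = ∑ j, u j * v j := by
  rw [PiLp.inner_apply]
  exact Finset.sum_congr rfl fun j _ => by rw [RCLike.inner_apply]; simp [mul_comm]

lemma norm_sq_eq_sum (u : Space n) : ‖u‖ ^ 2 = ∑ j, u j ^ 2 := by
  rw [← real_inner_self_eq_norm_sq, inner_eq_sum]
  exact Finset.sum_congr rfl fun j _ => (pow_two _).symm

namespace Smooth

/-- A coordinate function. -/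
def coord (k : Fin n) : Smooth n ℝ := ⟨fun x => x k, by
  change ContDiff ℝ ∞ (fun x : Space n => x k)
  fun_prop⟩

@[simp] lemma coord_apply (k : Fin n) (x : Space n) : (coord k : Smooth n ℝ) x = x k := rfl

lemma d_coord (j k : Fin n) (x : Space n) :
    d j (coord k : Smooth n ℝ) x = if k = j then 1 else 0 := by
  have : HasFDerivAt (fun y : Space n => y k) (EuclideanSpace.proj k : Space n →L[ℝ] ℝ) x :=
    (EuclideanSpace.proj k : Space n →L[ℝ] ℝ).hasFDerivAt
  rw [d_apply]
  change fderiv ℝ (fun y : Space n => y k) x _ = _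
  rw [this.fderiv]
  simp

lemma gradient_eq_d {f : Space n → ℝ} {g : Smooth n ℝ} {x : Space n} (h : f =ᶠ[nhds x] g)
    (j : Fin n) : (∇ f x) j = d j g x := by
  rw [gradient_coord, h.fderiv_eq, d_apply]

/-- The Poisson bracket of the real and imaginary parts of the symbol `p_φ`. -/
lemma poissonBracket_carlemanSymbol {φ : Space n → ℝ} {f : Smooth n ℝ} {x : Space n}
    (h : φ =ᶠ[nhds x] f) (ξ : Space n) :
    poissonBracket (fun y η => (carlemanSymbol φ y η).re)
      (fun y η => (carlemanSymbol φ y η).im) x ξ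
      = 4 * ((∑ j, ∑ k, d j (d k f) x * ξ j * ξ k) + hessGrad f x) := by
  have hre : ∀ y η, (carlemanSymbol φ y η).re = ‖η‖ ^ 2 - ‖∇ φ y‖ ^ 2 := fun y η => by
    simp [carlemanSymbol, ← Complex.ofReal_pow]
  have him : ∀ y η, (carlemanSymbol φ y η).im = 2 * inner ℝ (∇ φ y) η := fun y η => by
    simp [carlemanSymbol, ← Complex.ofReal_pow]
  -- Equality on a neighbourhood is required, because the bracket differentiates ∇φ.
  have hgr : ∀ᶠ y in nhds x, ∀ j, (∇ φ y) j = d j f y := by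
    filter_upwards [h.eventuallyEq_nhds] with y hy j using gradient_eq_d hy j
  have hx := hgr.self_of_nhds
  have a1 : ∀ j, (∇ (fun η => (carlemanSymbol φ x η).re) ξ) j = 2 * ξ j := by
    intro j
    rw [gradient_eq_d (g := ∑ k, coord k * coord k - const (‖∇ φ x‖ ^ 2))
      (Filter.Eventually.of_forall fun η => by
        simp [hre, norm_sq_eq_sum η, pow_two])]
    simp [map_sum, d_mul, d_coord, Finset.sum_add_distrib]
    ring
  have a2 : ∀ j, (∇ (fun η => (carlemanSymbol φ x η).im) ξ) j = 2 * d j f x := by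
    intro j
    rw [gradient_eq_d (g := ∑ k, const (2 * d k f x) * coord k)
      (Filter.Eventually.of_forall fun η => by
        simp only [him, inner_eq_sum, hx, Finset.mul_sum, mul_assoc, sum_apply, mul_apply,
          const_apply, coord_apply])]
    simp [map_sum, d_mul, d_coord]
  have a3 : ∀ j, (∇ (fun y => (carlemanSymbol φ y ξ).re) x) j
      = -2 * ∑ k, d j (d k f) x * d k f x := by
    intro j
    rw [gradient_eq_d (g := const (‖ξ‖ ^ 2) - ∑ k, d k f * d k f) (by
      filter_upwards [hgr] with y hy
      simp [hre, norm_sq_eq_sum (∇ φ y), hy, pow_two])]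
    simp only [map_sub, map_sum, d_mul, d_const, zero_sub, neg_apply, sum_apply, add_apply, mul_apply,
      Finset.mul_sum]
    rw [← Finset.sum_neg_distrib]
    exact Finset.sum_congr rfl fun k _ => by ring
  have a4 : ∀ j, (∇ (fun y => (carlemanSymbol φ y ξ).im) x) j
      = 2 * ∑ k, d j (d k f) x * ξ k := by
    intro j
    rw [gradient_eq_d (g := ∑ k, const (2 * ξ k) * d k f) (by
      filter_upwards [hgr] with y hy
      simp only [him, inner_eq_sum, hy, Finset.mul_sum, sum_apply, mul_apply, const_apply]
      exact Finset.sum_congr rfl fun k _ => by ring)]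
    simp only [map_sum, d_mul, d_const, sum_apply, mul_apply, const_apply,
      mul_zero, add_zero, Finset.mul_sum]
    exact Finset.sum_congr rfl fun k _ => by ring
  rw [poissonBracket, inner_eq_sum, inner_eq_sum]
  simp only [a1, a2, a3, a4]
  simp only [hessGrad, sum_apply, mul_apply, mul_add, Finset.mul_sum, Finset.sum_mul]
  rw [sub_eq_add_neg, ← Finset.sum_neg_distrib]
  congr 1
  · exact Finset.sum_congr rfl fun j _ => Finset.sum_congr rfl fun k _ => by ring
  · refine Finset.sum_congr rfl fun j _ => ?_
    rw [← Finset.sum_neg_distrib]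
    exact Finset.sum_congr rfl fun k _ => by ring

/-- The structure of a symmetric form which is constant on the vectors orthogonal to `m` of the
same length as `m`. -/
lemma quadratic_form_structure {B : Fin n → Fin n → ℝ} (hB : ∀ j k, B j k = B k j)
    {m : Fin n → ℝ} {r : ℝ} (hr : r * ∑ j, m j * m j = 1)
    (h : ∀ ξ : Fin n → ℝ, ∑ j, ξ j ^ 2 = ∑ j, m j * m j → ∑ j, m j * ξ j = 0 →
      ∑ j, ∑ k, B j k * ξ j * ξ k = -∑ j, ∑ k, B j k * m j * m k) (ξ : Fin n → ℝ) :
    ∑ j, ∑ k, B j k * ξ j * ξ k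
      = -(r * ∑ j, ∑ k, B j k * m j * m k) * ∑ j, ξ j ^ 2
        + 2 * r * (∑ j, m j * ξ j) * ∑ j, ∑ k, B j k * m j * ξ k := by
  set g := ∑ j, m j * m j with hg
  -- Decompose ξ = tm + ζ with ζ orthogonal to m. Once B(ζ,ζ) = -rB(m,m)|ζ|² is known, expanding
  -- both sides gives the claim, the two t²B(m,m) terms cancelling.
  set t := r * ∑ j, m j * ξ j with ht
  set b := ∑ j, ∑ k, B j k * m j * m k with hb
  have hg0 : 0 ≤ g := Finset.sum_nonneg fun j _ => mul_self_nonneg _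
  have horth : ∑ j, m j * (ξ j - t * m j) = 0 := by
    have : ∑ j, m j * (ξ j - t * m j) = (∑ j, m j * ξ j) - t * g := by
      rw [hg, Finset.mul_sum, ← Finset.sum_sub_distrib]
      exact Finset.sum_congr rfl fun j _ => by ring
    rw [this, ht]
    linear_combination -(∑ j, m j * ξ j) * hr
  have hlen : ∑ j, (ξ j - t * m j) ^ 2 = ∑ j, ξ j ^ 2 - t * ∑ j, m j * ξ j := by
    have : ∑ j, (ξ j - t * m j) ^ 2
        = ∑ j, ξ j ^ 2 - 2 * t * (∑ j, m j * ξ j) + t ^ 2 * g := by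
      rw [hg, Finset.mul_sum, Finset.mul_sum, ← Finset.sum_sub_distrib, ← Finset.sum_add_distrib]
      exact Finset.sum_congr rfl fun j _ => by ring
    rw [this]
    linear_combination t * (∑ j, m j * ξ j) * hr
  have hexp : ∑ j, ∑ k, B j k * (ξ j - t * m j) * (ξ k - t * m k)
      = (∑ j, ∑ k, B j k * ξ j * ξ k) - 2 * t * (∑ j, ∑ k, B j k * m j * ξ k) + t ^ 2 * b := by
    have hsym : ∑ j, ∑ k, B j k * ξ j * m k = ∑ j, ∑ k, B j k * m j * ξ k := by
      rw [Finset.sum_comm]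
      exact Finset.sum_congr rfl fun j _ => Finset.sum_congr rfl fun k _ => by rw [hB]; ring
    have e : ∑ j, ∑ k, B j k * (ξ j - t * m j) * (ξ k - t * m k)
        = (∑ j, ∑ k, B j k * ξ j * ξ k) - t * (∑ j, ∑ k, B j k * m j * ξ k)
          - t * (∑ j, ∑ k, B j k * ξ j * m k) + t ^ 2 * b := by
      simp only [hb, Finset.mul_sum, ← Finset.sum_sub_distrib, ← Finset.sum_add_distrib]
      exact Finset.sum_congr rfl fun j _ => Finset.sum_congr rfl fun k _ => by ring
    rw [e, hsym]; ring
  have hperp : ∑ j, ∑ k, B j k * (ξ j - t * m j) * (ξ k - t * m k)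
      = -(r * b) * ∑ j, (ξ j - t * m j) ^ 2 := by
    set ζ : Fin n → ℝ := fun j => ξ j - t * m j with hζ
    have hz0 : 0 ≤ ∑ j, ζ j ^ 2 := Finset.sum_nonneg fun j _ => sq_nonneg _
    change ∑ j, ∑ k, B j k * ζ j * ζ k = -(r * b) * ∑ j, ζ j ^ 2
    change ∑ j, m j * ζ j = 0 at horth
    clear_value ζ
    rcases hz0.eq_or_lt with h0 | h0
    · have : ∀ j, ζ j = 0 := fun j => by
        have := (Finset.sum_eq_zero_iff_of_nonneg fun j _ => sq_nonneg (ζ j)).1 h0.symm j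
          (Finset.mem_univ j)
        exact pow_eq_zero_iff (two_ne_zero) |>.1 this
      simp [this]
    -- Rescale ζ to the length of m, where the hypothesis applies; both sides are homogeneous of
    -- degree two.
    · set c := √(g / ∑ j, ζ j ^ 2) with hc
      have hc2 : c ^ 2 * ∑ j, ζ j ^ 2 = g := by
        rw [hc, Real.sq_sqrt (by positivity)]; field_simp
      have h1 := h (fun j => c * ζ j) (by simp only [mul_pow]; rw [← Finset.mul_sum, hc2]) (by
        have : ∀ j, m j * (c * ζ j) = c * (m j * ζ j) := fun j => by ring
        simp only [this]; rw [← Finset.mul_sum, horth, mul_zero])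
      have h2 : ∑ j, ∑ k, B j k * (c * ζ j) * (c * ζ k) = c ^ 2 * ∑ j, ∑ k, B j k * ζ j * ζ k := by
        simp only [Finset.mul_sum]
        exact Finset.sum_congr rfl fun j _ => Finset.sum_congr rfl fun k _ => by ring
      rw [h2] at h1
      have h3 : r * c ^ 2 * ∑ j, ζ j ^ 2 = 1 := by rw [mul_assoc, hc2, hr]
      linear_combination (r * ∑ j, ζ j ^ 2) * h1
        - (∑ j, ∑ k, B j k * ζ j * ζ k) * h3
  rw [hexp, hlen] at hperp
  linear_combination hperp

lemma contDiff_mul_of_tsupport {W : Set (Space n)} (hW : IsOpen W) (χ : Smooth n ℝ)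
    (hχ : tsupport χ ⊆ W) {f : Space n → ℝ} (hf : ContDiffOn ℝ ∞ f W) :
    ContDiff ℝ ∞ (fun x => χ x * f x) := by
  rw [contDiff_iff_contDiffAt]
  intro x
  by_cases hx : x ∈ tsupport χ
  · exact χ.contDiff.contDiffAt.mul (hf.contDiffAt (hW.mem_nhds (hχ hx)))
  · have : (fun x => χ x * f x) =ᶠ[nhds x] fun _ => 0 := by
      filter_upwards [notMem_tsupport_iff_eventuallyEq.1 hx] with y hy
      rw [hy]; simp
    exact contDiffAt_const.congr_of_eventuallyEq this

open scoped Manifold in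
/-- Smooth cutoff functions. -/
lemma exists_cutoff {K W : Set (Space n)} (hK : IsCompact K) (hW : IsOpen W) (hKW : K ⊆ W) :
    ∃ χ : Smooth n ℝ, HasCompactSupport χ ∧ tsupport χ ⊆ W ∧ ∀ x ∈ K, χ x = 1 := by
  obtain ⟨V, hV, hKV, hVW, hVc⟩ := exists_open_between_and_isCompact_closure hK hW hKW
  obtain ⟨f, hf, -, hfs, hf1⟩ := exists_contMDiff_support_eq_eq_one_iff (n := (⊤ : ℕ∞))
    (𝓘(ℝ, Space n)) hV hK.isClosed hKV
  refine ⟨⟨f, hf.contDiff⟩, ?_, ?_, fun x hx => (hf1 x).1 hx⟩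
  · refine HasCompactSupport.of_support_subset_isCompact hVc ?_
    change Function.support f ⊆ _
    rw [hfs]; exact subset_closure
  · change closure (Function.support f) ⊆ W
    rw [hfs]; exact hVW

/-- A limiting Carleman weight agrees near a compact set with a globally smooth function that
satisfies the coordinate form of the condition. -/
lemma exists_isCarlemanPair {U W : Set (Space n)} (hU : IsOpen U) (hUc : IsCompact (closure U))
    (hW : IsOpen W) (hUW : closure U ⊆ W) {φ : Space n → ℝ} (hφ : IsLimitingCarlemanWeight W φ) :
    ∃ f r : Smooth n ℝ, (∀ x ∈ U, f x = φ x) ∧ IsCarlemanPair U f r := by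
  obtain ⟨χ, -, hχW, hχ1⟩ := exists_cutoff hUc hW hUW
  -- The cutoff equals 1 on the closure of U, so χφ and χ/|∇φ|² are global smooth functions with the
  -- right values and derivatives on the open set U.
  set f : Smooth n ℝ := ⟨fun x => χ x * φ x, contDiff_mul_of_tsupport hW χ hχW hφ.smooth⟩ with hf
  have hfd : ContDiffOn ℝ ∞ (fun x => ∑ j, fderiv ℝ φ x (EuclideanSpace.single j (1 : ℝ)) ^ 2) W :=
    ContDiffOn.sum fun j _ => ((hφ.smooth.fderiv_of_isOpen hW (m := ∞) (by simp)).clm_apply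
      contDiffOn_const).pow 2
  have hgn : ∀ x, ∑ j, fderiv ℝ φ x (EuclideanSpace.single j (1 : ℝ)) ^ 2 = ‖∇ φ x‖ ^ 2 := fun x => by
    rw [norm_sq_eq_sum]
    exact Finset.sum_congr rfl fun j _ => by rw [gradient_coord]
  have hne : ∀ x ∈ W, ∑ j, fderiv ℝ φ x (EuclideanSpace.single j (1 : ℝ)) ^ 2 ≠ 0 := fun x hx => by
    rw [hgn]
    exact pow_ne_zero 2 (norm_ne_zero_iff.2 (hφ.gradient_ne_zero x hx))
  set r : Smooth n ℝ := ⟨_, contDiff_mul_of_tsupport hW χ hχW (hfd.inv hne)⟩ with hr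
  have hfφ : ∀ x ∈ U, f x = φ x := fun x hx => by
    change χ x * φ x = φ x
    rw [hχ1 x (subset_closure hx), one_mul]
  have hnear : ∀ x ∈ U, φ =ᶠ[nhds x] f := fun x hx =>
    Filter.eventually_of_mem (hU.mem_nhds hx) fun y hy => (hfφ y hy).symm
  have hinv : ∀ x ∈ U, r x * gradMul f f x = 1 := fun x hx => by
    have e : gradMul f f x = ∑ j, fderiv ℝ φ x (EuclideanSpace.single j (1 : ℝ)) ^ 2 := by
      rw [gradMul_apply]
      exact Finset.sum_congr rfl fun j _ => by
        rw [← gradient_eq_d (hnear x hx), gradient_coord, pow_two]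
    change χ x * (∑ j, fderiv ℝ φ x (EuclideanSpace.single j (1 : ℝ)) ^ 2)⁻¹ * gradMul f f x = 1
    rw [e, hχ1 x (subset_closure hx), one_mul,
      inv_mul_cancel₀ (hne x (hUW (subset_closure hx)))]
  refine ⟨f, r, hfφ, hinv, fun x hx ξ => ?_⟩
  have hin := hinv x hx
  rw [gradMul_apply] at hin
  have key := quadratic_form_structure (B := fun j k => d j (d k f) x) (m := fun j => d j f x)
    (fun j k => by rw [d_comm]) hin (fun η h1 h2 => ?_) ξ
  · simpa only [hessGrad, sum_apply, mul_apply] using key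
  -- The zeros of p_φ over x are exactly the covectors orthogonal to ∇φ of the same length, the
  -- vectors admitted in `quadratic_form_structure`.
  · have hs : carlemanSymbol φ x (WithLp.toLp 2 η) = 0 := by
      have i1 : inner ℝ (∇ φ x) (WithLp.toLp 2 η) = 0 := by
        rw [inner_eq_sum, ← h2]
        exact Finset.sum_congr rfl fun j _ => by rw [gradient_eq_d (hnear x hx)]
      have i2 : ‖(WithLp.toLp 2 η : Space n)‖ ^ 2 = ‖∇ φ x‖ ^ 2 := by
        rw [norm_sq_eq_sum, norm_sq_eq_sum]
        refine Eq.trans h1 (Finset.sum_congr rfl fun j _ => ?_)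
        rw [gradient_eq_d (hnear x hx), pow_two]
      rw [carlemanSymbol, i1, i2]; simp
    have hb := hφ.bracket_eq_zero x (hUW (subset_closure hx)) _ hs
    rw [poissonBracket_carlemanSymbol (hnear x hx)] at hb
    simp only [hessGrad, sum_apply, mul_apply] at hb
    linarith

end Smooth

end

/-! ### Conjugating the magnetic operator -/

section

variable {n : ℕ}

namespace Smooth

/-- The exponential of a real smooth function. -/
def exp (f : Smooth n ℝ) : Smooth n ℝ := ⟨fun x => Real.exp (f x), f.contDiff.exp⟩

@[simp] lemma exp_apply (f : Smooth n ℝ) (x : Space n) : exp f x = Real.exp (f x) := rfl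

lemma d_exp (j : Fin n) (f : Smooth n ℝ) : d j (exp f) = exp f * d j f := by
  ext x
  have := ((f.differentiable x).hasFDerivAt.exp).fderiv
  rw [d_apply]
  change fderiv ℝ (fun x => Real.exp (f x)) x _ = _
  rw [this]
  simp [d_apply]

/-- The weight `e^{-ψ/h}`. -/
def weight (h : ℝ) (ψ : Smooth n ℝ) : Smooth n ℂ := ofReal (exp (const (-h⁻¹) * ψ))

lemma weight_apply (h : ℝ) (ψ : Smooth n ℝ) (x : Space n) :
    weight h ψ x = (Real.exp (-h⁻¹ * ψ x) : ℂ) := rfl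

lemma d_weight (h : ℝ) (ψ : Smooth n ℝ) (j : Fin n) :
    d j (weight h ψ) = const (-(h : ℂ)⁻¹) * (weight h ψ * d j (ofReal ψ)) := by
  ext x
  simp only [weight, d_ofReal, d_exp, d_mul, d_const, ofReal_apply, mul_apply, add_apply,
    const_apply, zero_apply]
  push_cast
  ring

/-- This justifies the explicit formula chosen for `conjLap`: it really is -h²Δ conjugated by
e^{-ψ/h}. -/
lemma sq_mul_lap_weight_mul {h : ℝ} (hh : h ≠ 0) (ψ : Smooth n ℝ) (y : Smooth n ℂ) (x : Space n) :
    (h : ℂ) ^ 2 * lap (weight h ψ * y) x = -(weight h ψ x * conjLap (h : ℂ) (ofReal ψ) y x) := by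
  have hc : (h : ℂ) ≠ 0 := Complex.ofReal_ne_zero.2 hh
  have hl : lap (weight h ψ) x
      = weight h ψ x * ((h : ℂ)⁻¹ ^ 2 * gradMul (ofReal ψ) (ofReal ψ) x
        - (h : ℂ)⁻¹ * lap (ofReal ψ) x) := by
    simp only [lap_apply, gradMul_apply, Finset.mul_sum, ← Finset.sum_sub_distrib]
    refine Finset.sum_congr rfl fun j _ => ?_
    simp only [d_weight, d_mul, d_const, mul_apply, add_apply, const_apply, zero_apply]
    ring
  have hg : gradMul (weight h ψ) y x = -((h : ℂ)⁻¹ * weight h ψ x * gradMul (ofReal ψ) y x) := by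
    simp only [gradMul_apply, Finset.mul_sum, ← Finset.sum_neg_distrib]
    refine Finset.sum_congr rfl fun j _ => ?_
    simp only [d_weight, mul_apply, const_apply]
    ring
  rw [lap_mul, hl, hg, conjLap_apply]
  field_simp
  ring

end Smooth

open Smooth

/-- The divergence of a vector field. -/
def divergence (A : Space n → Space n) (x : Space n) : ℝ :=
  ∑ j, (fderiv ℝ A x (EuclideanSpace.single j (1 : ℝ))) j

/-- The product rule on ∂_j(A_j v) produces the divergence of A; only first derivatives of A at the
point enter, which is why C¹ regularity suffices. -/
lemma magneticSchrodinger_neg_apply {A : Space n → Space n} (q : Space n → ℂ) {x : Space n}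
    (hA : DifferentiableAt ℝ A x) (v : Smooth n ℂ) :
    magneticSchrodinger (-A) q v x = -lap v x + 2 * Complex.I * ∑ j, (A x j : ℂ) * d j v x
      + (Complex.I * divergence A x + (∑ j, (A x j : ℂ) ^ 2) + q x) * v x := by
  have key : ∀ j, magneticD (-A) j (magneticD (-A) j v) x = -d j (d j v) x
      + 2 * Complex.I * ((A x j : ℂ) * d j v x)
      + (Complex.I * ((fderiv ℝ A x (EuclideanSpace.single j (1 : ℝ))) j : ℝ)
        + (A x j : ℂ) ^ 2) * v x := by
    intro j
    have e0 : magneticD (-A) j v = fun y => -Complex.I * d j v y - (A y j : ℂ) * v y := by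
      funext y
      simp [magneticD, partialDeriv, d_apply, sub_eq_add_neg]
    have hAj : HasFDerivAt (fun y => A y j)
        ((EuclideanSpace.proj j : Space n →L[ℝ] ℝ).comp (fderiv ℝ A x)) x :=
      (EuclideanSpace.proj j : Space n →L[ℝ] ℝ).hasFDerivAt.comp x hA.hasFDerivAt
    have hAc : HasFDerivAt (fun y => (A y j : ℂ))
        (Complex.ofRealCLM.comp ((EuclideanSpace.proj j : Space n →L[ℝ] ℝ).comp (fderiv ℝ A x))) x :=
      Complex.ofRealCLM.hasFDerivAt.comp x hAj
    have e1 := (((d j v).differentiable x).hasFDerivAt.const_mul (-Complex.I)).sub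
      (hAc.mul (v.differentiable x).hasFDerivAt)
    have e2 : partialDeriv j (magneticD (-A) j v) x = -Complex.I * d j (d j v) x
        - ((A x j : ℂ) * d j v x
          + v x * ((fderiv ℝ A x (EuclideanSpace.single j (1 : ℝ))) j : ℝ)) := by
      rw [e0, partialDeriv]
      erw [e1.fderiv]
      simp [d_apply]
    rw [magneticD, e2, e0]
    simp only [Pi.neg_apply, PiLp.neg_apply, Complex.ofReal_neg]
    linear_combination (d j (d j v) x) * Complex.I_sq
  simp only [magneticSchrodinger, key, Finset.sum_add_distrib, Finset.sum_neg_distrib,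
    ← Finset.mul_sum, ← Finset.sum_mul, lap_apply, divergence]
  push_cast
  ring

/-- The first order coefficients of the conjugated magnetic operator. -/
def firstOrderCoeff (Ω : Set (Space n)) (A : Space n → Space n) (j : Fin n) : Space n → ℂ :=
  Ω.indicator fun x => 2 * Complex.I * (A x j : ℂ)

/-- The zeroth order coefficient of the conjugated magnetic operator. -/
def zerothOrderCoeff (Ω : Set (Space n)) (A : Space n → Space n) (q : Space n → ℂ) (h : ℝ)
    (ψ : Smooth n ℝ) : Space n → ℂ :=
  Ω.indicator fun x => h * (Complex.I * divergence A x + (∑ j, (A x j : ℂ) ^ 2) + q x)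
    - 2 * Complex.I * ∑ j, (A x j : ℂ) * (d j ψ x : ℂ)

/-- Conjugation of the magnetic operator by a weight. -/
lemma sq_mul_magneticSchrodinger_weight_mul {Ω : Set (Space n)} {A : Space n → Space n}
    (q : Space n → ℂ) {x : Space n} (hx : x ∈ Ω) (hA : DifferentiableAt ℝ A x) {h : ℝ}
    (hh : h ≠ 0) (ψ : Smooth n ℝ) (y : Smooth n ℂ) :
    (h : ℂ) ^ 2 * magneticSchrodinger (-A) q (weight h ψ * y : Smooth n ℂ) x
      = weight h ψ x * perturbed h ψ (zerothOrderCoeff Ω A q h ψ) (firstOrderCoeff Ω A) y x := by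
  have hc : (h : ℂ) ≠ 0 := Complex.ofReal_ne_zero.2 hh
  have hg : ∑ j, (A x j : ℂ) * d j (weight h ψ * y) x
      -- A derivative falling on the weight costs h⁻¹. After multiplication by h² this term is O(h),
      -- hence the summand -2iA·∇ψ without a factor h in the zeroth-order coefficient.
      = weight h ψ x * (∑ j, (A x j : ℂ) * d j y x)
        - (h : ℂ)⁻¹ * weight h ψ x * y x * ∑ j, (A x j : ℂ) * (d j ψ x : ℂ) := by
    simp only [Finset.mul_sum, ← Finset.sum_sub_distrib]
    refine Finset.sum_congr rfl fun j _ => ?_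
    simp only [d_mul, d_weight, d_ofReal, ofReal_apply, mul_apply, Smooth.add_apply, const_apply]
    ring
  have hs : ∑ j, firstOrderCoeff Ω A j x * (h * d j y x)
      = 2 * Complex.I * h * ∑ j, (A x j : ℂ) * d j y x := by
    rw [Finset.mul_sum]
    refine Finset.sum_congr rfl fun j _ => ?_
    rw [firstOrderCoeff, Set.indicator_of_mem hx]; ring
  rw [magneticSchrodinger_neg_apply q hA, hg, perturbed_apply, hs, zerothOrderCoeff,
    Set.indicator_of_mem hx, mul_add, mul_add, mul_neg, sq_mul_lap_weight_mul hh, mul_apply]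
  field_simp
  ring

lemma norm_coord_le (v : Space n) (j : Fin n) : ‖((v j : ℝ) : ℂ)‖ ≤ ‖v‖ := by
  rw [Complex.norm_real]; exact PiLp.norm_apply_le v j

lemma norm_divergence_le (A : Space n → Space n) (x : Space n) :
    ‖((divergence A x : ℝ) : ℂ)‖ ≤ n * ‖fderiv ℝ A x‖ := by
  rw [Complex.norm_real, divergence]
  refine (norm_sum_le _ _).trans ((Finset.sum_le_sum fun j _ => ?_).trans_eq
    (by rw [Finset.sum_const, Finset.card_univ, Fintype.card_fin, nsmul_eq_mul]))
  refine (PiLp.norm_apply_le _ j).trans ?_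
  simpa using (fderiv ℝ A x).le_opNorm (EuclideanSpace.single j (1 : ℝ))

lemma IsC1OnClosure.exists_bound {Ω : Set (Space n)} {A : Space n → Space n}
    (hA : IsC1OnClosure Ω A) (hΩ : Bornology.IsBounded Ω) :
    ∃ M : ℝ, 0 ≤ M ∧ ∀ x ∈ Ω, ‖A x‖ ≤ M ∧ ‖fderiv ℝ A x‖ ≤ M := by
  obtain ⟨A₀, c₀, e₀⟩ := hA.extends_continuously
  obtain ⟨A₁, c₁, e₁⟩ := hA.fderiv_extends_continuously
  obtain ⟨M₀, h₀⟩ := hΩ.isCompact_closure.exists_bound_of_continuousOn c₀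
  obtain ⟨M₁, h₁⟩ := hΩ.isCompact_closure.exists_bound_of_continuousOn c₁
  refine ⟨max 0 (max M₀ M₁), le_max_left _ _, fun x hx => ⟨?_, ?_⟩⟩
  · rw [← e₀ hx]
    exact (h₀ x (subset_closure hx)).trans ((le_max_left _ _).trans (le_max_right _ _))
  · rw [← e₁ hx]
    exact (h₁ x (subset_closure hx)).trans ((le_max_right _ _).trans (le_max_right _ _))

/-- Uniform bounds for the coefficients of the conjugated magnetic operator. -/
lemma exists_isBoundedCoeff {Ω : Set (Space n)} (hΩ : IsOpen Ω) (hΩb : Bornology.IsBounded Ω)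
    {A : Space n → Space n} (hA : IsC1OnClosure Ω A) {q : Space n → ℂ}
    (hq : MemLp q ⊤ (volume.restrict Ω)) {K : ℝ} (hK : 0 ≤ K) :
    ∃ M : ℝ, 0 ≤ M ∧ (∀ j, IsBoundedCoeff M (firstOrderCoeff Ω A j)) ∧
      ∀ h : ℝ, 0 ≤ h → h ≤ 1 → ∀ ψ : Smooth n ℝ, (∀ x ∈ Ω, ∀ j, |d j ψ x| ≤ K) →
        IsBoundedCoeff M (zerothOrderCoeff Ω A q h ψ) := by
  obtain ⟨MA, hMA, hb⟩ := hA.exists_bound hΩb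
  obtain ⟨Mq, hMq⟩ : ∃ Mq : ℝ, ∀ᵐ x, x ∈ Ω → ‖q x‖ ≤ Mq := by
    refine ⟨(eLpNorm q ⊤ (volume.restrict Ω)).toReal, ?_⟩
    rw [← ae_restrict_iff' hΩ.measurableSet]
    filter_upwards [enorm_ae_le_eLpNormEssSup q (volume.restrict Ω)] with x hx
    rw [← toReal_enorm]
    exact ENNReal.toReal_mono hq.2.ne (by rwa [eLpNorm_exponent_top])
  have hAc : ContinuousOn A Ω := hA.contDiffOn.continuousOn
  have hAj : ∀ j, AEStronglyMeasurable (fun x => (A x j : ℂ)) (volume.restrict Ω) := fun j =>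
    (Continuous.comp_continuousOn (g := fun v : Space n => ((v j : ℝ) : ℂ)) (by fun_prop)
      hAc).aestronglyMeasurable hΩ.measurableSet
  have hdiv : AEStronglyMeasurable (fun x => (divergence A x : ℂ)) (volume.restrict Ω) := by
    have hc : ContinuousOn (fderiv ℝ A) Ω := hA.contDiffOn.continuousOn_fderiv_of_isOpen hΩ le_rfl
    refine (Continuous.comp_continuousOn
      (g := fun L : Space n →L[ℝ] Space n =>
        ((∑ j, (L (EuclideanSpace.single j (1 : ℝ))) j : ℝ) : ℂ)) ?_ hc).aestronglyMeasurable
      hΩ.measurableSet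
    fun_prop
  have hsum : ∀ x ∈ Ω, ∀ c : Fin n → ℂ, ∀ B : ℝ, (∀ j, ‖c j‖ ≤ B) →
      ‖∑ j, (A x j : ℂ) * c j‖ ≤ n * (MA * B) := fun x hx c B hc => by
    refine (norm_sum_le _ _).trans ((Finset.sum_le_sum fun j _ => ?_).trans_eq
      (by rw [Finset.sum_const, Finset.card_univ, Fintype.card_fin, nsmul_eq_mul]))
    rw [norm_mul]
    exact mul_le_mul ((norm_coord_le _ _).trans (hb x hx).1) (hc j) (norm_nonneg _) hMA
  have hI : ‖(2 * Complex.I : ℂ)‖ = 2 := by simp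
  refine ⟨2 * MA + (n * MA + n * (MA * MA) + |Mq| + 2 * (n * (MA * K))), by positivity,
    fun j => ⟨?_, ?_⟩, fun h hh hh1 ψ hψ => ⟨?_, ?_⟩⟩
  · exact (aestronglyMeasurable_indicator_iff hΩ.measurableSet).2 ((hAj j).const_mul _)
  · refine Filter.Eventually.of_forall fun x => ?_
    by_cases hx : x ∈ Ω
    · rw [firstOrderCoeff, Set.indicator_of_mem hx, norm_mul, hI]
      have := (norm_coord_le (A x) j).trans (hb x hx).1
      have : 0 ≤ n * MA + n * (MA * MA) + |Mq| + 2 * (n * (MA * K)) := by positivity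
      linarith
    · rw [firstOrderCoeff, Set.indicator_of_notMem hx, norm_zero]
      positivity
  · refine (aestronglyMeasurable_indicator_iff hΩ.measurableSet).2 ?_
    refine (((hdiv.const_mul _).add ?_).add hq.1).const_mul _ |>.sub
      (AEStronglyMeasurable.const_mul ?_ _)
    · exact Finset.aestronglyMeasurable_fun_sum _ fun j _ => (hAj j).pow 2
    · exact Finset.aestronglyMeasurable_fun_sum _ fun j _ => (hAj j).mul
        (ofReal (d j ψ)).continuous.aestronglyMeasurable
  · filter_upwards [hMq] with x hxq
    by_cases hx : x ∈ Ω
    · rw [zerothOrderCoeff, Set.indicator_of_mem hx]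
      have t1 : ‖Complex.I * (divergence A x : ℂ)‖ ≤ n * MA := by
        rw [norm_mul, Complex.norm_I, one_mul]
        exact (norm_divergence_le A x).trans
          (mul_le_mul_of_nonneg_left (hb x hx).2 (Nat.cast_nonneg _))
      have t2 : ‖∑ j, (A x j : ℂ) ^ 2‖ ≤ n * (MA * MA) := by
        simp only [pow_two]
        exact hsum x hx _ MA fun j => (norm_coord_le _ _).trans (hb x hx).1
      have t3 : ‖∑ j, (A x j : ℂ) * (d j ψ x : ℂ)‖ ≤ n * (MA * K) :=
        hsum x hx _ K fun j => by rw [Complex.norm_real]; exact hψ x hx j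
      have t4 : ‖Complex.I * (divergence A x : ℂ) + (∑ j, (A x j : ℂ) ^ 2) + q x‖
          ≤ n * MA + n * (MA * MA) + |Mq| :=
        norm_add₃_le.trans (add_le_add (add_le_add t1 t2) ((hxq hx).trans (le_abs_self _)))
      have t5 : ‖(h : ℂ)‖ ≤ 1 := by rwa [Complex.norm_real, Real.norm_of_nonneg hh]
      refine (norm_sub_le _ _).trans ?_
      rw [norm_mul, norm_mul, hI]
      have := mul_le_mul t5 t4 (norm_nonneg _) zero_le_one
      linarith
    · rw [zerothOrderCoeff, Set.indicator_of_notMem hx, norm_zero]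
      positivity

end

/-! ### Returning to the original weight and norms -/

section

variable {n : ℕ}

lemma normL2_nonneg (Ω : Set (Space n)) (f : Space n → ℂ) : 0 ≤ normL2 Ω f := Real.sqrt_nonneg _

lemma l2norm_indicator {Ω : Set (Space n)} (hΩ : MeasurableSet Ω) {f : Space n → ℂ}
    (hf : MemL2 Ω f) : l2norm (Ω.indicator f) = normL2 Ω f := by
  rw [normL2, ← Real.sqrt_sq (l2norm_nonneg (Ω.indicator f)),
    l2norm_sq ((memLp_indicator_iff_restrict hΩ).2 hf), ← integral_indicator hΩ]
  congr 2
  funext x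
  by_cases hx : x ∈ Ω <;> simp [hx]

lemma normL2_le_mul {Ω : Set (Space n)} (hΩ : MeasurableSet Ω) {f g : Space n → ℂ}
    (hg : MemLp g 2 volume) {M : ℝ} (hM : 0 ≤ M) (h : ∀ x ∈ Ω, ‖f x‖ ≤ M * ‖g x‖) :
    normL2 Ω f ≤ M * l2norm g := by
  have hgi : Integrable (fun x => (M * ‖g x‖) ^ 2) := by
    simp only [mul_pow]
    exact ((memLp_two_iff_integrable_sq_norm hg.1).1 hg).const_mul _
  refine (Real.sqrt_le_left (mul_nonneg hM (l2norm_nonneg g))).2 ?_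
  calc ∫ x in Ω, ‖f x‖ ^ 2 ≤ ∫ x in Ω, (M * ‖g x‖) ^ 2 := by
        refine integral_mono_of_nonneg (Filter.Eventually.of_forall fun x => sq_nonneg _)
          hgi.integrableOn ?_
        filter_upwards [ae_restrict_mem hΩ] with x hx
        exact pow_le_pow_left₀ (norm_nonneg _) (h x hx) 2
    _ ≤ ∫ x, (M * ‖g x‖) ^ 2 :=
        setIntegral_le_integral hgi (Filter.Eventually.of_forall fun x => sq_nonneg _)
    _ = (M * l2norm g) ^ 2 := by
        rw [mul_pow, l2norm_sq hg, ← integral_const_mul]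
        simp only [mul_pow]

lemma normL2_le_mul_add {Ω : Set (Space n)} (hΩ : MeasurableSet Ω) {f g₁ g₂ : Space n → ℂ}
    (hg₁ : MemLp g₁ 2 volume) (hg₂ : MemLp g₂ 2 volume) {M : ℝ} (hM : 0 ≤ M)
    (h : ∀ x ∈ Ω, ‖f x‖ ≤ M * (‖g₁ x‖ + ‖g₂ x‖)) :
    normL2 Ω f ≤ M * (l2norm g₁ + l2norm g₂) := by
  have m₁ := memLp_norm_ofReal hg₁
  have m₂ := memLp_norm_ofReal hg₂
  refine (normL2_le_mul hΩ (m₁.add m₂) hM fun x hx => (h x hx).trans_eq ?_).trans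
    (mul_le_mul_of_nonneg_left ((l2norm_add_le m₁ m₂).trans_eq ?_) hM)
  · rw [Pi.add_apply, ← Complex.ofReal_add, Complex.norm_real, Real.norm_of_nonneg (by positivity)]
  · rw [l2norm_norm_ofReal, l2norm_norm_ofReal]

lemma normH1scl_le (Ω : Set (Space n)) (h : ℝ) (u : Space n → ℂ) (g : Fin n → Space n → ℂ) :
    normH1scl Ω h u g ≤ (∑ j, normL2 Ω (fun x => (h : ℂ) * g j x)) + normL2 Ω u := by
  have h1 : 0 ≤ ∑ j, normL2 Ω (fun x => (h : ℂ) * g j x) :=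
    Finset.sum_nonneg fun j _ => normL2_nonneg _ _
  have h2 := normL2_nonneg Ω u
  refine (Real.sqrt_le_left (add_nonneg h1 h2)).2 ?_
  have h3 := Finset.sum_sq_le_sq_sum_of_nonneg (s := Finset.univ)
    (f := fun j => normL2 Ω (fun x => (h : ℂ) * g j x)) (fun j _ => normL2_nonneg _ _)
  nlinarith [mul_nonneg h1 h2]

lemma memL2_mul {Ω : Set (Space n)} (hΩ : MeasurableSet Ω) (p : Smooth n ℝ) {M : ℝ}
    (hp : ∀ x ∈ Ω, ‖p x‖ ≤ M) {u : Space n → ℂ} (hu : MemL2 Ω u) :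
    MemL2 Ω (fun x => (p x : ℂ) * u x) := by
  refine MemLp.of_le_mul (c := M) hu
    ((Smooth.ofReal p).continuous.aestronglyMeasurable.mul hu.1) ?_
  filter_upwards [ae_restrict_mem hΩ] with x hx
  rw [norm_mul, Complex.norm_real]
  exact mul_le_mul_of_nonneg_right (hp x hx) (norm_nonneg _)

namespace Smooth

lemma mul_mem_testSpace (p : Smooth n ℂ) {U : Set (Space n)} {v : Smooth n ℂ}
    (hv : v ∈ testSpace U) : (p * v : Smooth n ℂ) ∈ testSpace U :=
  ⟨hasCompactSupport_mul p hv.1, (tsupport_mul_subset_right (f := p.1) (g := v.1)).trans hv.2⟩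

lemma perturbed_eq_zero_of_notMem (h : ℝ) (ψ : Smooth n ℝ) (b₀ : Space n → ℂ)
    (b : Fin n → Space n → ℂ) {y : Smooth n ℂ} {x : Space n} (hx : x ∉ tsupport y) :
    perturbed h ψ b₀ b y x = 0 := by
  rw [perturbed_apply, conjLap_eq_zero_of_notMem _ _ _ hx, image_eq_zero_of_notMem_tsupport hx]
  simp [fun j => d_eq_zero_of_notMem j y hx]

/-- A weak gradient is transformed by the product rule under multiplication by a smooth function. -/
lemma isH1WithGradient_mul {Ω : Set (Space n)} (hΩ : MeasurableSet Ω) {h : ℝ} (hh : h ≠ 0)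
    (p : Smooth n ℝ) {M : ℝ} (hp : ∀ x ∈ Ω, ‖p x‖ ≤ M) (hdp : ∀ j, ∀ x ∈ Ω, ‖d j p x‖ ≤ M)
    {u : Space n → ℂ} {g : Fin n → Space n → ℂ} (hu : MemLp u 2 volume)
    (hg : ∀ j, MemLp (g j) 2 volume)
    (H : ∀ j, ∀ v ∈ testSpace Ω, ∫ x, u x * (h * d j v x) = -∫ x, g j x * v x) :
    IsH1WithGradient Ω (fun x => (p x : ℂ) * u x)
      (fun j x => (p x : ℂ) * ((h : ℂ)⁻¹ * g j x) + (d j p x : ℂ) * u x) := by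
  have hc : (h : ℂ) ≠ 0 := Complex.ofReal_ne_zero.2 hh
  refine ⟨memL2_mul hΩ p hp (hu.restrict _), fun j => (memL2_mul hΩ p hp
    (((hg j).restrict _).const_mul _)).add (memL2_mul hΩ _ (hdp j) (hu.restrict _)), fun j v hv => ?_⟩
  obtain ⟨v', rfl⟩ : ∃ v' : Smooth n ℂ, v'.1 = v := ⟨⟨v, hv.smooth⟩, rfl⟩
  have hv' : v' ∈ testSpace Ω := ⟨hv.hasCompactSupport, hv.tsupport_subset⟩
  have hpv := mul_mem_testSpace (ofReal p) hv'
  have hdv := mul_mem_testSpace (ofReal (d j p)) hv'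
  have i1 := integrable_mul hu ((memLp (hasCompactSupport_d j hpv.1)).const_mul (h : ℂ))
  have i2 := integrable_mul hu (memLp hdv.1)
  have i3 := integrable_mul (hg j) (memLp hpv.1)
  rw [setIntegral_eq_integral_of_forall_compl_eq_zero, setIntegral_eq_integral_of_forall_compl_eq_zero]
  -- The hypothesis is tested against pv, and the product rule moves the derivative of p onto u. The
  -- h⁻¹ is there because g stands for h∇u.
  · have e1 : ∀ x, (p x : ℂ) * u x * partialDeriv j v' x
        = (h : ℂ)⁻¹ * (u x * (h * d j (ofReal p * v') x)) - u x * (ofReal (d j p) * v') x := by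
      intro x
      have : partialDeriv j v' x = d j v' x := rfl
      simp only [this, d_mul, d_ofReal, Smooth.add_apply, Smooth.mul_apply, ofReal_apply]
      field_simp
      ring
    have e2 : ∀ x, ((p x : ℂ) * ((h : ℂ)⁻¹ * g j x) + (d j p x : ℂ) * u x) * v' x
        = (h : ℂ)⁻¹ * (g j x * (ofReal p * v') x) + u x * (ofReal (d j p) * v') x := by
      intro x
      simp only [Smooth.mul_apply, ofReal_apply]
      ring
    simp only [e1, e2]
    rw [integral_sub (i1.const_mul _) i2, integral_add (i3.const_mul _) i2, integral_const_mul,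
      integral_const_mul, H j _ hpv]
    ring
  · intro x hx
    rw [eq_zero_of_tsupport_subset hv'.2 hx, mul_zero]
  · intro x hx
    have : partialDeriv j v' x = d j v' x := rfl
    rw [this, d_eq_zero_of_tsupport_subset j hv'.2 hx, mul_zero]

end Smooth

open Smooth

/-- The weak form of the conjugated equation gives the weak form of the original one. -/
lemma solvesWeakly_of_perturbed {Ω : Set (Space n)} (hΩ : IsOpen Ω) {A : Space n → Space n}
    (hA : ContDiffOn ℝ 1 A Ω) {q : Space n → ℂ} {h : ℝ} (hh : h ≠ 0) {φ : Space n → ℝ}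
    {ψ p s : Smooth n ℝ} (hp : ∀ x ∈ Ω, Real.exp (φ x / h) * p x = Real.exp (h⁻¹ * ψ x))
    (hs : ∀ x ∈ Ω, Real.exp (h⁻¹ * ψ x) * s x = Real.exp (φ x / h))
    {u w : Space n → ℂ}
    (H : ∀ y ∈ testSpace Ω, ∫ x, u x * perturbed h ψ (zerothOrderCoeff Ω A q h ψ)
      (firstOrderCoeff Ω A) y x = ∫ x, Ω.indicator (fun x => (s x : ℂ) * w x) x * y x) :
    SolvesWeakly Ω A q ((h : ℂ) ^ 2)
      (fun x => (Real.exp (φ x / h) : ℂ) * ((p x : ℂ) * u x))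
      (fun x => (Real.exp (φ x / h) : ℂ) * w x) := by
  intro v hv
  obtain ⟨v', rfl⟩ : ∃ v' : Smooth n ℂ, v'.1 = v := ⟨⟨v, hv.smooth⟩, rfl⟩
  have hv' : v' ∈ testSpace Ω := ⟨hv.hasCompactSupport, hv.tsupport_subset⟩
  set E : Smooth n ℂ := ofReal (Smooth.exp (const h⁻¹ * ψ)) with hE
  have hEx : ∀ x, E x = (Real.exp (h⁻¹ * ψ x) : ℂ) := fun x => rfl
  have hwE : weight h ψ * (E * v') = v' := by
    ext x
    rw [Smooth.mul_apply, Smooth.mul_apply, weight_apply, hEx, ← mul_assoc, ← Complex.ofReal_mul,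
      ← Real.exp_add]
    simp
  -- The conjugated equation is tested with y = e^{ψ/h}v, for which e^{-ψ/h}y = v.
  have hy := mul_mem_testSpace E hv'
  have key := H _ hy
  rw [← setIntegral_eq_integral_of_forall_compl_eq_zero (s := Ω)
      (f := fun x => u x * perturbed h ψ _ _ _ x),
    ← setIntegral_eq_integral_of_forall_compl_eq_zero (s := Ω)
      (f := fun x => Ω.indicator (fun x => (s x : ℂ) * w x) x * (E * v') x)] at key
  · rw [← integral_const_mul]
    refine ((setIntegral_congr_fun hΩ.measurableSet fun x hx => ?_).trans key).trans
      (setIntegral_congr_fun hΩ.measurableSet fun x hx => ?_)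
    · have hd : DifferentiableAt ℝ A x :=
        (hA.differentiableOn (by simp)).differentiableAt (hΩ.mem_nhds hx)
      have h1 := sq_mul_magneticSchrodinger_weight_mul q hx hd hh ψ (E * v')
      rw [hwE, weight_apply] at h1
      have h2 : (Real.exp (φ x / h) : ℂ) * (p x : ℂ) * (Real.exp (-h⁻¹ * ψ x) : ℂ) = 1 := by
        rw [← Complex.ofReal_mul, hp x hx, ← Complex.ofReal_mul, ← Real.exp_add]
        simp
      simp only
      linear_combination (Real.exp (φ x / h) : ℂ) * (p x : ℂ) * u x * h1
        + u x * perturbed h ψ (zerothOrderCoeff Ω A q h ψ) (firstOrderCoeff Ω A) (E * v') x * h2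
    · have h2 : (Real.exp (h⁻¹ * ψ x) : ℂ) * (s x : ℂ) = (Real.exp (φ x / h) : ℂ) := by
        rw [← Complex.ofReal_mul, hs x hx]
      simp only [Set.indicator_of_mem hx, Smooth.mul_apply, hEx]
      linear_combination w x * v'.1 x * h2
  · intro x hx
    rw [eq_zero_of_tsupport_subset hy.2 hx, mul_zero]
  · intro x hx
    rw [perturbed_eq_zero_of_notMem _ _ _ _ fun h' => hx (hy.2 h'), mul_zero]

/-- Solvability for a weight which is part of a Carleman pair. -/
theorem exists_solution_of_isCarlemanPair {Ω U : Set (Space n)} (hΩ : IsOpen Ω)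
    (hΩb : Bornology.IsBounded Ω) (hU : IsOpen U) (hUc : IsCompact (closure U))
    (hΩU : closure Ω ⊆ U) {f r : Smooth n ℝ} (hf : IsCarlemanPair U f r) {φ : Space n → ℝ}
    (hfφ : ∀ x ∈ Ω, f x = φ x) {A : Space n → Space n} (hA : IsC1OnClosure Ω A)
    {q : Space n → ℂ} (hq : MemLp q ⊤ (volume.restrict Ω)) :
    ∃ h₀ : ℝ, 0 < h₀ ∧ ∃ C : ℝ, 0 < C ∧ ∀ h : ℝ, 0 < h → h ≤ h₀ →
      ∀ w : Space n → ℂ, MemL2 Ω w →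
        ∃ (u : Space n → ℂ) (g : Fin n → Space n → ℂ), IsH1WithGradient Ω u g ∧
          SolvesWeakly Ω A q ((h : ℂ) ^ 2) (fun x => (Real.exp (φ x / h) : ℂ) * u x)
            (fun x => (Real.exp (φ x / h) : ℂ) * w x) ∧
          h * normH1scl Ω h u g ≤ C * normL2 Ω w := by
  have hΩc := hΩb.isCompact_closure
  have hΩm := hΩ.measurableSet
  obtain ⟨χ, hχc, hχU, hχ1⟩ := exists_cutoff hΩc hU hΩU
  have hχs : tsupport (ofReal χ) ⊆ tsupport χ := by
    refine closure_mono fun x hx hx0 => hx ?_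
    rw [ofReal_apply, hx0, Complex.ofReal_zero]
  obtain ⟨K₀, hK₀⟩ := f.exists_bound hΩc
  obtain ⟨K₁, hK₁⟩ := exists_bound_family (fun j => d j f) hΩc
  obtain ⟨M, hM, hb, hb₀⟩ := exists_isBoundedCoeff hΩ hΩb hA hq
    -- This bounds (1 + κ|f|)|∂_j f| for every κ ≤ 1. Hence M is fixed before ε, which depends on M;
    -- there is no circularity.
    (K := (1 + |K₀|) * |K₁|) (by positivity)
  obtain ⟨ε, hε, h₀, hh₀, hh₀1, hh₀ε, C, hC, hmain⟩ := carleman_negative (Ω := Ω) hUc hf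
    (χ := ofReal χ) (hχc.mono' ((subset_tsupport _).trans hχs)) (hχs.trans hχU)
    (fun x hx => by rw [ofReal_apply, hχ1 x (subset_closure hx), Complex.ofReal_one]) hM
  -- On Ω, e^{ψ/h} = e^{φ/h}p and s = 1/p. The final solution is p times the dual one, with data sw;
  -- neither p nor s depends on h.
  set p : Smooth n ℝ := Smooth.exp (const (1 / (2 * ε)) * (f * f)) with hp
  set s : Smooth n ℝ := Smooth.exp (const (-(1 / (2 * ε))) * (f * f)) with hs
  obtain ⟨P₀, hP₀⟩ := p.exists_bound hΩc
  obtain ⟨P₁, hP₁⟩ := exists_bound_family (fun j => d j p) hΩc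
  set P := max |P₀| |P₁| with hPdef
  have hP : 0 ≤ P := (abs_nonneg _).trans (le_max_left _ _)
  have hpP : ∀ x ∈ Ω, ‖p x‖ ≤ P := fun x hx =>
    (hP₀ x hx).trans ((le_abs_self _).trans (le_max_left _ _))
  have hdpP : ∀ j, ∀ x ∈ Ω, ‖d j p x‖ ≤ P := fun j x hx =>
    (hP₁ j x hx).trans ((le_abs_self _).trans (le_max_right _ _))
  -- Each of the n gradient components costs two terms and the function itself one; the added 1
  -- keeps the constant positive when P = 0.
  refine ⟨h₀, hh₀, P * (2 * n + 1) * (C * (n + 1)) + 1, by positivity, fun h hh hhle w hw => ?_⟩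
  have hκ : h / ε ≤ 1 := (div_le_one hε).2 (hhle.trans hh₀ε)
  set ψ := convexify (h / ε) f with hψ
  have hψd : ∀ x ∈ Ω, ∀ j, |d j ψ x| ≤ (1 + |K₀|) * |K₁| := by
    intro x hx j
    rw [hψ, d_convexify, Smooth.mul_apply, abs_mul]
    refine mul_le_mul ?_ ((hK₁ j x hx).trans (le_abs_self _)) (abs_nonneg _) (by positivity)
    rw [Smooth.add_apply, Smooth.mul_apply, one_apply, const_apply]
    refine (abs_add_le _ _).trans (add_le_add abs_one.le ?_)
    rw [abs_mul, abs_of_nonneg (by positivity)]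
    have : |f x| ≤ |K₀| := (hK₀ x hx).trans (le_abs_self _)
    nlinarith [abs_nonneg (f x)]
  have hb₀' := hb₀ h hh.le (hhle.trans hh₀1) ψ hψd
  have hψx : ∀ x, h⁻¹ * ψ x = f x / h + 1 / (2 * ε) * (f x * f x) := by
    intro x
    simp only [hψ, convexify, Smooth.add_apply, Smooth.mul_apply, const_apply]
    field_simp
  have hsw : MemL2 Ω (fun x => (s x : ℂ) * w x) := by
    obtain ⟨S, hS⟩ := s.exists_bound hΩc
    exact memL2_mul hΩm s hS hw
  obtain ⟨u, g, hu, hg, hsol, hgrad, hun, hgn⟩ := exists_weak_solution (U := U) (Ω := Ω) hh hC.le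
    -- The coefficients are extended by zero, so the estimate makes sense on U although A and q
    -- matter only on Ω; the equation is later tested only in Ω.
    (perturbed h ψ (zerothOrderCoeff Ω A q h ψ) (firstOrderCoeff Ω A))
    (fun y hy => memLp_perturbed ψ hb₀' hb hy.1)
    (fun y hy v hv => hmain h hh hhle _ _ hb₀' hb y hy.1 hy.2 v (fun j => (hv j).1)
      (fun j => (hv j).2))
    ((memLp_indicator_iff_restrict hΩm).2 hsw)
  have hwn : l2norm (Ω.indicator fun x => (s x : ℂ) * w x) ≤ normL2 Ω w := by
    rw [← l2norm_indicator hΩm hw, ← one_mul (l2norm (Ω.indicator w))]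
    refine l2norm_le_mul ((memLp_indicator_iff_restrict hΩm).2 hw) zero_le_one
      (Filter.Eventually.of_forall fun x => ?_)
    by_cases hx : x ∈ Ω
    · rw [Set.indicator_of_mem hx, Set.indicator_of_mem hx, norm_mul, Complex.norm_real, hs, exp_apply,
        Real.norm_of_nonneg (Real.exp_pos _).le]
      refine mul_le_mul_of_nonneg_right (Real.exp_le_one_iff.2 ?_) (norm_nonneg _)
      simp only [Smooth.mul_apply, const_apply]
      have : 0 ≤ 1 / (2 * ε) * (f x * f x) := mul_nonneg (by positivity) (mul_self_nonneg _)
      linarith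
    · rw [Set.indicator_of_notMem hx, norm_zero]; positivity
  refine ⟨_, _, isH1WithGradient_mul hΩm hh.ne' p hpP hdpP hu hg hgrad,
    solvesWeakly_of_perturbed hΩ hA.contDiffOn hh.ne' (ψ := ψ) (s := s) (fun x hx => ?_)
      (fun x hx => ?_) (fun y hy => hsol y ⟨hy.1, hy.2.trans (subset_closure.trans hΩU)⟩), ?_⟩
  · rw [hψx, hp, exp_apply, ← Real.exp_add, Smooth.mul_apply, Smooth.mul_apply,
      const_apply, hfφ x hx]
  · rw [hψx, hs, exp_apply, ← Real.exp_add, hfφ x hx]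
    simp only [Smooth.mul_apply, const_apply, hfφ x hx]
    congr 1
    ring
  · set N := normL2 Ω w
    set G := C * (n + 1) * N with hG
    have hGb : C * (n + 1) * l2norm (Ω.indicator fun x => (s x : ℂ) * w x) ≤ G :=
      mul_le_mul_of_nonneg_left hwn (by positivity)
    have hc : (h : ℂ) ≠ 0 := Complex.ofReal_ne_zero.2 hh.ne'
    have hu1 : normL2 Ω (fun x => (p x : ℂ) * u x) ≤ P * l2norm u :=
      normL2_le_mul hΩm hu hP fun x hx => by
        rw [norm_mul, Complex.norm_real]
        exact mul_le_mul_of_nonneg_right (hpP x hx) (norm_nonneg _)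
    have hg1 : ∀ j, normL2 Ω (fun x => (h : ℂ) * ((p x : ℂ) * ((h : ℂ)⁻¹ * g j x)
        + (d j p x : ℂ) * u x)) ≤ P * (l2norm (g j) + l2norm u) := fun j =>
      normL2_le_mul_add hΩm (hg j) hu hP fun x hx => by
        have e : (h : ℂ) * ((p x : ℂ) * ((h : ℂ)⁻¹ * g j x) + (d j p x : ℂ) * u x)
            = (p x : ℂ) * g j x + h * ((d j p x : ℂ) * u x) := by
          field_simp
        rw [e, mul_add]
        refine (norm_add_le _ _).trans (add_le_add ?_ ?_)
        · rw [norm_mul, Complex.norm_real]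
          exact mul_le_mul_of_nonneg_right (hpP x hx) (norm_nonneg _)
        · rw [norm_mul, norm_mul, Complex.norm_real, Complex.norm_real, Real.norm_of_nonneg hh.le]
          have h1 := mul_le_mul_of_nonneg_right (hdpP j x hx) (norm_nonneg (u x))
          have h2 : 0 ≤ ‖d j p x‖ * ‖u x‖ := by positivity
          nlinarith [hhle.trans hh₀1]
    have hsum := Finset.sum_le_sum fun j (_ : j ∈ Finset.univ) => (hg1 j)
    calc h * normH1scl Ω h _ _ ≤ h * (∑ j, P * (l2norm (g j) + l2norm u) + P * l2norm u) :=
          mul_le_mul_of_nonneg_left ((normH1scl_le _ _ _ _).trans (add_le_add hsum hu1)) hh.le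
      _ = ∑ j, P * (h * l2norm (g j) + h * l2norm u) + P * (h * l2norm u) := by
          rw [mul_add, Finset.mul_sum]
          congr 1
          · exact Finset.sum_congr rfl fun j _ => by ring
          · ring
      _ ≤ ∑ _j : Fin n, P * (G + G) + P * G := by
          gcongr with j
          · exact (hgn j).trans hGb
          · exact hun.trans hGb
          · exact hun.trans hGb
      _ = P * (2 * n + 1) * (C * (n + 1)) * N := by
          rw [Finset.sum_const, Finset.card_univ, Fintype.card_fin, nsmul_eq_mul, hG]
          ring
      _ ≤ (P * (2 * n + 1) * (C * (n + 1)) + 1) * N := by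
          have := normL2_nonneg Ω w
          nlinarith

end

end MagneticSchrodinger

end

theorem proposition2p4 {n : ℕ} (hn : 3 ≤ n)
    (Ω Ω' : Set (MagneticSchrodinger.Space n))
    (hΩ : IsOpen Ω) (hΩb : Bornology.IsBounded Ω)
    (hΩ' : IsOpen Ω') (hΩΩ' : closure Ω ⊆ Ω')
    (φ : MagneticSchrodinger.Space n → ℝ)
    (hφ : MagneticSchrodinger.IsLimitingCarlemanWeight Ω' φ)
    (A : MagneticSchrodinger.Space n → MagneticSchrodinger.Space n)
    (hA : MagneticSchrodinger.IsC1OnClosure Ω A)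
    (q : MagneticSchrodinger.Space n → ℂ)
    (hq : MemLp q ⊤ (volume.restrict Ω)) :
    ∃ h₀ : ℝ, 0 < h₀ ∧ ∃ C : ℝ, 0 < C ∧
      ∀ h : ℝ, 0 < h → h ≤ h₀ →
        ∀ w : MagneticSchrodinger.Space n → ℂ, MagneticSchrodinger.MemL2 Ω w →
          ∃ (u : MagneticSchrodinger.Space n → ℂ) (g : Fin n → MagneticSchrodinger.Space n → ℂ),
            MagneticSchrodinger.IsH1WithGradient Ω u g ∧
            MagneticSchrodinger.SolvesWeakly Ω A q ((h : ℂ) ^ 2)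
              (fun x => (Real.exp (φ x / h) : ℂ) * u x)
              (fun x => (Real.exp (φ x / h) : ℂ) * w x) ∧
            h * MagneticSchrodinger.normH1scl Ω h u g ≤ C * MagneticSchrodinger.normL2 Ω w := by
  -- The intermediate set leaves room around the closure of Ω for the parametrix cutoff while
  -- keeping all bounds on φ uniform by compactness.
  obtain ⟨U, hU, hΩU, hUΩ', hUc⟩ :=
    exists_open_between_and_isCompact_closure hΩb.isCompact_closure hΩ' hΩΩ'
  obtain ⟨f, r, hfφ, hf⟩ := MagneticSchrodinger.Smooth.exists_isCarlemanPair hU hUc hΩ' hUΩ' hφ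
  exact MagneticSchrodinger.exists_solution_of_isCarlemanPair hΩ hΩb hU hUc hΩU hf
    (fun x hx => hfφ x (hΩU (subset_closure hx))) hA hq
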